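/- Let $(Z,d)$ be a metric space with a Borel regular measure $\mu$ for which every open ball has positive and finite measure, and suppose that $\mu$ is doubling: for some constants $Q>0$ and $C\ge 1$ one has $\mu(B(\xi,\lambda r))\le C\lambda^Q\mu(B(\xi,r))$ for all $\xi\in Z$, $r>0$ and $\lambda\ge 1$. Write $L^1_{\rm loc}(Z)$ for the measurable functions $f\colon Z\to\mathbb C$ that are integrable on bounded measurable sets. **Hyperbolic filling.** A hyperbolic filling $X$ of $Z$ is a disjoint union of levels $X_n$; write $|x|=n$ for $x\in X_n$. If $Z$ is unbounded, then for every $n\in\mathbb Z$ the level $X_n$ indexes a maximal set of points $\{\xi_x\}_{x\in X_n}$ of $Z$ with pairwise distances at least $2^{-n-1}$, and $B(x)=B(\xi_x,2^{-n})$. If $Z$ is bounded, the same is done for $n\ge 1$ only, $X_0$ consists of a single vertex whose ball is $B(x)=Z$, and there are no negative levels. Two vertices $x\neq y$ are neighbors, $x\sim y$, if $||x|-|y||\le 1$ and $B(x)\cap B(y)\ne\emptyset$. For $f\in L^1_{\rm loc}(Z)$ put $Pf(x)=\frac1{\mu(B(x))}\int_{B(x)}f\,d\mu$, and for $u\colon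 X\to\mathbb C$ put $|du|(x)=\big(\sum_{y\sim x}|u(y)-u(x)|^2\big)^{1/2}$. The space $\dot F^s_{p,q}(Z)$ consists of all $f\in L^1_{\rm loc}(Z)$ such that $$\|f\|_{\dot F^s_{p,q}(Z)}=\Big(\int_Z\big\|\{2^{|x|s}\,|d(Pf)|(x): x\in X,\ \xi\in B(x)\}\big\|_{\ell^q}^p\,d\mu(\xi)\Big)^{1/p}<\infty .$$ **Hajłasz gradients.** A fractional $s$-Hajłasz gradient of $f$ is a sequence $(g_k)_{k\in\mathbb Z}$ of measurable functions $g_k\colon Z\to[0,\infty]$ for which there is a measurable set $E$ with $\mu(E)=0$ such that $|f(\xi)-f(\eta)|\le d(\xi,\eta)^s(g_k(\xi)+g_k(\eta))$ whenever $k\in\mathbb Z$, $\xi,\eta\in Z\setminus E$ and $2^{-k-1}\le d(\xi,\eta)<2^{-k}$. The space $\dot M^s_{p,q}(Z)$ consists of all measurable $f\colon Z\to\mathbb C$ such that $$\|f\|_{\dot M^s_{p,q}(Z)}=\inf_{(g_k)}\Big(\int_Z\big\|\{g_k(\xi):k\in\mathbb Z\}\big\|_{\ell^q}^p\,d\mu(\xi)\Big)^{1/p}<\infty,$$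 where the infimum is over all fractional $s$-Hajłasz gradients of $f$. **Proposition.** Let $0<s\le 1$, $Q/(Q+s)<p<\infty$ and $Q/(Q+s)<q\le\infty$. Then $\dot F^s_{p,q}(Z)=\dot M^s_{p,q}(Z)$ as sets of functions, with equivalent quasi-norms: there is a finite constant $K$, independent of the choice of the filling $X$, such that $$\|f\|_{\dot F^s_{p,q}(Z)}\le K\|f\|_{\dot M^s_{p,q}(Z)}\quad\text{and}\quad\|f\|_{\dot M^s_{p,q}(Z)}\le K\|f\|_{\dot F^s_{p,q}(Z)}$$ for all $f$ in this space. -/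

import Mathlib

open MeasureTheory Set
open scoped ENNReal NNReal

noncomputable section

/-- The `ℓ^q` quasi-norm, `0 < q ≤ ∞`, of a family of extended non-negative numbers. -/
def lqNorm {ι : Type*} (q : ℝ≥0∞) (a : ι → ℝ≥0∞) : ℝ≥0∞ :=
  if q = ∞ then ⨆ i, a i else (∑' i, a i ^ q.toReal) ^ (1 / q.toReal)

/-- The functions that are measurable (with respect to the completion of `μ`) and integrable on
all bounded measurable sets. -/
def LocInt {Z : Type*} [MetricSpace Z] [MeasurableSpace Z] (μ : Measure Z) (f : Z → ℂ) : Prop :=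
  AEStronglyMeasurable f μ ∧
    ∀ S : Set Z, MeasurableSet S → Bornology.IsBounded S → IntegrableOn f S μ

/-- `A` is a maximal set of points with pairwise distances at least `r`. -/
def IsMaximalSeparated {Z : Type*} [MetricSpace Z] (r : ℝ) (A : Set Z) : Prop :=
  Maximal (fun B : Set Z => B.Pairwise fun x y => r ≤ dist x y) A

/-- A hyperbolic filling of `Z`, given by the centers `ξ_x` of the balls of each level `n`: a maximal
`2^{-n-1}`-separated set for every `n ∈ ℤ` if `Z` is unbounded; if `Z` is bounded, such a set for
every `n ≥ 1`, a single vertex at level `0`, and no vertices at the negative levels. The vertices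
of a given level have different centers, so that they can be indexed by their centers. -/
structure HyperbolicFilling (Z : Type*) [MetricSpace Z] where
  net : ℤ → Set Z
  net_unbounded : ¬ Bornology.IsBounded (univ : Set Z) →
    ∀ n : ℤ, IsMaximalSeparated ((2 : ℝ) ^ (-n - 1)) (net n)
  net_bounded : Bornology.IsBounded (univ : Set Z) →
    (∃ z, net 0 = {z}) ∧ (∀ n < 0, net n = ∅) ∧
      ∀ n : ℤ, 1 ≤ n → IsMaximalSeparated ((2 : ℝ) ^ (-n - 1)) (net n)

namespace HyperbolicFilling

variable {Z : Type*} [MetricSpace Z]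

/-- The vertex set of the filling: the disjoint union of its levels. -/
def Vertex (X : HyperbolicFilling Z) : Type _ := Σ n : ℤ, X.net n

/-- The level `|x|` of a vertex. -/
def level {X : HyperbolicFilling Z} (x : X.Vertex) : ℤ := x.1

/-- The point `ξ_x`. -/
def center {X : HyperbolicFilling Z} (x : X.Vertex) : Z := x.2.1

open Classical in
/-- The ball `B(x) = B(ξ_x, 2^{-|x|})`, except that the root of the filling of a bounded space has
the whole space as its ball. -/
def ball {X : HyperbolicFilling Z} (x : X.Vertex) : Set Z :=
  if Bornology.IsBounded (univ : Set Z) ∧ level x = 0 then univ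
  else Metric.ball (center x) ((2 : ℝ) ^ (-level x))

/-- The graph structure of the filling. -/
def graph (X : HyperbolicFilling Z) : SimpleGraph X.Vertex where
  Adj x y := x ≠ y ∧ |level x - level y| ≤ 1 ∧ (ball x ∩ ball y).Nonempty
  symm := ⟨fun x y h => ⟨h.1.symm, by rw [abs_sub_comm]; exact h.2.1, by
    rw [inter_comm]; exact h.2.2⟩⟩
  loopless := ⟨fun _ h => h.1 rfl⟩

/-- The pointwise norm `|du|(x) = (∑_{y ∼ x} |u(y) - u(x)|²)^{1/2}` of the discrete derivative. -/
def absDeriv {X : HyperbolicFilling Z} (u : X.Vertex → ℂ) (x : X.Vertex) : ℝ≥0∞ :=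
  (∑' y : X.graph.neighborSet x, ‖u y - u x‖ₑ ^ 2) ^ (1 / 2 : ℝ)

/-- The cone `Γ_ξ` of width `1` at the point `ξ`. -/
def cone (X : HyperbolicFilling Z) (ξ : Z) : Set X.Vertex := {x | ξ ∈ ball x}

variable [MeasurableSpace Z]

/-- The Poisson extension `Pf(x)`: the mean value of `f` over `B(x)`. -/
def poisson (X : HyperbolicFilling Z) (μ : Measure Z) (f : Z → ℂ) (x : X.Vertex) : ℂ :=
  ⨍ η in ball x, f η ∂μ

/-- The quasi-norm of the sequence space `J^s_{p,q}(X)`, as a function of the absolute value `w` of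
the sequence. -/
def jNorm (X : HyperbolicFilling Z) (μ : Measure Z) (s p : ℝ) (q : ℝ≥0∞)
    (w : X.Vertex → ℝ≥0∞) : ℝ≥0∞ :=
  (∫⁻ ξ, lqNorm q (fun x : X.cone ξ =>
    ENNReal.ofReal ((2 : ℝ) ^ ((level x.1 : ℝ) * s)) * w x.1) ^ p ∂μ) ^ (1 / p)

/-- The quasi-norm `‖f‖ = ‖d(Pf)‖` of the Triebel–Lizorkin space of the filling. -/
def tlNorm (X : HyperbolicFilling Z) (μ : Measure Z) (s p : ℝ) (q : ℝ≥0∞) (f : Z → ℂ) : ℝ≥0∞ :=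
  X.jNorm μ s p q (absDeriv (X.poisson μ f))

/-- The Triebel–Lizorkin space `Ḟ^s_{p,q}(Z)` of the filling. -/
def tlSpace (X : HyperbolicFilling Z) (μ : Measure Z) (s p : ℝ) (q : ℝ≥0∞) : Set (Z → ℂ) :=
  {f | LocInt μ f ∧ X.tlNorm μ s p q f < ∞}

end HyperbolicFilling

/-- `g` is a fractional `s`-Hajłasz gradient of `f`. -/
def IsHajlaszGradient {Z : Type*} [MetricSpace Z] [MeasurableSpace Z] (μ : Measure Z) (s : ℝ)
    (f : Z → ℂ) (g : ℤ → Z → ℝ≥0∞) : Prop :=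
  (∀ k, AEMeasurable (g k) μ) ∧
    ∃ E : Set Z, MeasurableSet E ∧ μ E = 0 ∧ ∀ (k : ℤ) (ξ η : Z), ξ ∉ E → η ∉ E →
      (2 : ℝ) ^ (-k - 1) ≤ dist ξ η → dist ξ η < (2 : ℝ) ^ (-k) →
        ‖f ξ - f η‖ₑ ≤ ENNReal.ofReal (dist ξ η ^ s) * (g k ξ + g k η)

/-- The quasi-norm of the space `Ṁ^s_{p,q}(Z)`: an infimum over fractional Hajłasz gradients. -/
def hajlaszNorm {Z : Type*} [MetricSpace Z] [MeasurableSpace Z] (μ : Measure Z) (s p : ℝ)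
    (q : ℝ≥0∞) (f : Z → ℂ) : ℝ≥0∞ :=
  ⨅ (g : ℤ → Z → ℝ≥0∞) (_ : IsHajlaszGradient μ s f g),
    (∫⁻ ξ, lqNorm q (fun k : ℤ => g k ξ) ^ p ∂μ) ^ (1 / p)

/-- The space `Ṁ^s_{p,q}(Z)`. -/
def hajlaszSpace {Z : Type*} [MetricSpace Z] [MeasurableSpace Z] (μ : Measure Z) (s p : ℝ)
    (q : ℝ≥0∞) : Set (Z → ℂ) :=
  {f | AEStronglyMeasurable f μ ∧ hajlaszNorm μ s p q f < ∞}

end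

/-! Both bounds compare $f$ with its means over balls; they differ in which side supplies the
telescoping.

From a gradient to the filling. A gradient $(g_i)$ bounds the oscillation of $f$ below scale
$2^{-j}$ by the tail $T_j=\sum_{i\ge j}2^{-is}g_i$ (`hajlaszTail`). Since $p$ and $q$ may be at most
$1$, the means of $f$ have to be controlled by $L^t$ means of $T_j$ with some $t<1$. This is the
Sobolev–Poincaré inequality `exists_setLIntegral_enorm_sub_le`. Its proof joins $\xi$ to a fixed
point through points $y_l\in B(\xi,2^{-k-l})$ at which $T_{k+l-2}$ does not exceed its $L^t$ mean.
Integrating the $l$-th mean costs a factor $2^{lQ(1/t-1)}$, which the decay $2^{-ls}$ of the tails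
absorbs exactly when $t>Q/(Q+s)$. The hypotheses on $p$ and $q$ leave room for such a $t$ below $1$,
$p$ and $q$ (`exists_exponent`). The discrete derivative at a vertex is at most a mean oscillation
over a dilated ball, so its $t$-th power is bounded by a ball average of exponential tails of
$(g_i^t)$. The Fefferman–Stein inequality for averaging operators, with exponents $p/t,q/t>1$,
removes the averages, and Hardy's inequality `exists_lqNorm_expTail_le` removes the tails. The same
Poincaré inequality gives local integrability of functions in the Hajłasz space.

From the filling to a gradient. By Lebesgue differentiation, $Pf$ converges to $f(\xi)$ along
vertices of increasing level whose balls contain $\xi$, for almost every $\xi$. Consecutive vertices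
are neighbors, so telescoping bounds $|f(\xi)-Pf(x)|$ by a tail of $|d(Pf)|$. Two points at distance
about $2^{-k}$ lie in the ball of a common vertex of level at least $k-1$, which makes these tails a
fractional gradient (`isHajlaszGradient_expTail`). Hardy's inequality bounds its norm; here every
$p,q>0$ is allowed. -/

noncomputable section

/-! ### Powers and geometric series in $[0,\infty]$. -/

namespace ENNReal

lemma rpow_iSup {ι : Sort*} (a : ι → ℝ≥0∞) {t : ℝ} (ht : 0 < t) :
    (⨆ i, a i) ^ t = ⨆ i, a i ^ t :=
  (ENNReal.orderIsoRpow t ht).map_iSup a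

lemma rpow_sum_le_sum_rpow_of_le_one {ι : Type*} (F : Finset ι) (a : ι → ℝ≥0∞) {t : ℝ}
    (ht : 0 < t) (ht1 : t ≤ 1) : (∑ i ∈ F, a i) ^ t ≤ ∑ i ∈ F, a i ^ t := by
  classical
  induction F using Finset.induction_on with
  | empty => simp [ht]
  | insert i F hi ih =>
    rw [Finset.sum_insert hi, Finset.sum_insert hi]
    exact (ENNReal.rpow_add_le_add_rpow _ _ ht.le ht1).trans (by gcongr)

lemma rpow_tsum_le_tsum_rpow {ι : Type*} (a : ι → ℝ≥0∞) {t : ℝ} (ht : 0 < t) (ht1 : t ≤ 1) :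
    (∑' i, a i) ^ t ≤ ∑' i, a i ^ t := by
  rw [ENNReal.tsum_eq_iSup_sum, rpow_iSup _ ht]
  exact iSup_le fun F =>
    (rpow_sum_le_sum_rpow_of_le_one F a ht ht1).trans (ENNReal.sum_le_tsum F)

lemma two_rpow_ne_top (x : ℝ) : (2 : ℝ≥0∞) ^ x ≠ ∞ :=
  ENNReal.rpow_ne_top_of_ne_zero (by norm_num) (by norm_num)

lemma two_rpow_ne_zero (x : ℝ) : (2 : ℝ≥0∞) ^ x ≠ 0 := by
  simp [ENNReal.rpow_eq_zero_iff]

lemma two_rpow_add (x y : ℝ) : (2 : ℝ≥0∞) ^ (x + y) = 2 ^ x * 2 ^ y :=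
  ENNReal.rpow_add _ _ (by norm_num) (by norm_num)

lemma two_rpow_le_two_rpow {x y : ℝ} (h : x ≤ y) : (2 : ℝ≥0∞) ^ x ≤ 2 ^ y :=
  ENNReal.rpow_le_rpow_of_exponent_le (by norm_num) h

lemma ofReal_two_rpow (x : ℝ) : ENNReal.ofReal ((2 : ℝ) ^ x) = 2 ^ x := by
  rw [← ENNReal.ofReal_rpow_of_pos (by norm_num)]; norm_num

lemma tsum_two_rpow_ne_top {d : ℝ} (hd : 0 < d) :
    ∑' l : ℕ, (2 : ℝ≥0∞) ^ (-((l : ℝ) * d)) ≠ ∞ := by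
  have h : ∀ l : ℕ, (2 : ℝ≥0∞) ^ (-((l : ℝ) * d)) = ((2 : ℝ≥0∞) ^ (-d)) ^ l := fun l => by
    rw [← ENNReal.rpow_natCast, ← ENNReal.rpow_mul]; congr 1; ring
  simp_rw [h, ENNReal.tsum_geometric]
  have h1 : (2 : ℝ≥0∞) ^ (-d) < 1 :=
    ENNReal.rpow_lt_one_of_one_lt_of_neg (by norm_num) (by linarith)
  exact ENNReal.inv_ne_top.2 (tsub_pos_of_lt h1).ne'

end ENNReal

/-! ### Sequence quasi-norms and Hardy's inequality. -/

section lqNorm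

variable {ι κ : Type*} {q : ℝ≥0∞}

lemma lqNorm_top (a : ι → ℝ≥0∞) : lqNorm ∞ a = ⨆ i, a i := if_pos rfl

lemma lqNorm_of_ne_top (hq : q ≠ ∞) (a : ι → ℝ≥0∞) :
    lqNorm q a = (∑' i, a i ^ q.toReal) ^ (1 / q.toReal) := if_neg hq

lemma lqNorm_rpow_toReal (hq0 : q ≠ 0) (hq : q ≠ ∞) (a : ι → ℝ≥0∞) :
    lqNorm q a ^ q.toReal = ∑' i, a i ^ q.toReal := by
  have := ENNReal.toReal_pos hq0 hq
  rw [lqNorm_of_ne_top hq, ← ENNReal.rpow_mul, one_div_mul_cancel this.ne', ENNReal.rpow_one]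

lemma le_lqNorm (hq0 : q ≠ 0) (a : ι → ℝ≥0∞) (i : ι) : a i ≤ lqNorm q a := by
  by_cases hq : q = ∞
  · subst hq; rw [lqNorm_top]; exact le_iSup a i
  · have := ENNReal.toReal_pos hq0 hq
    rw [← ENNReal.rpow_le_rpow_iff this, lqNorm_rpow_toReal hq0 hq]
    exact ENNReal.le_tsum i

lemma lqNorm_comp_equiv (e : κ ≃ ι) (a : ι → ℝ≥0∞) :
    lqNorm q (fun k => a (e k)) = lqNorm q a := by
  by_cases hq : q = ∞
  · subst hq; simp_rw [lqNorm_top]; exact e.iSup_comp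
  · simp_rw [lqNorm_of_ne_top hq]
    rw [e.tsum_eq (fun i => a i ^ q.toReal)]

lemma lqNorm_const_mul (hq0 : q ≠ 0) (c : ℝ≥0∞) (a : ι → ℝ≥0∞) :
    lqNorm q (fun k => c * a k) = c * lqNorm q a := by
  by_cases hq : q = ∞
  · subst hq; simp_rw [lqNorm_top]; rw [ENNReal.mul_iSup]
  · have := ENNReal.toReal_pos hq0 hq
    simp_rw [lqNorm_of_ne_top hq, ENNReal.mul_rpow_of_nonneg _ _ this.le]
    rw [ENNReal.tsum_mul_left, ENNReal.mul_rpow_of_nonneg _ _ (by positivity),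
      ← ENNReal.rpow_mul, mul_one_div_cancel this.ne', ENNReal.rpow_one]

/-- This turns $\ell^q$ norms of possibly small exponent into $\ell^{q/t}$ norms with $q/t>1$, where
averaging operators are bounded. -/
lemma lqNorm_rpow (hq0 : q ≠ 0) {t : ℝ} (ht : 0 < t) (a : ι → ℝ≥0∞) :
    lqNorm q a ^ t = lqNorm (q / ENNReal.ofReal t) (fun i => a i ^ t) := by
  have ht' : ENNReal.ofReal t ≠ 0 := by simpa using ht
  by_cases hq : q = ∞
  · subst hq
    rw [ENNReal.top_div_of_ne_top ENNReal.ofReal_ne_top, lqNorm_top, lqNorm_top,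
      ENNReal.rpow_iSup _ ht]
  · have := ENNReal.toReal_pos hq0 hq
    have h2 : q / ENNReal.ofReal t ≠ ∞ := ENNReal.div_ne_top hq ht'
    rw [lqNorm_of_ne_top hq, lqNorm_of_ne_top h2, ENNReal.toReal_div, ENNReal.toReal_ofReal ht.le,
      ← ENNReal.rpow_mul]
    congr 1
    · refine tsum_congr fun i => ?_
      rw [← ENNReal.rpow_mul]; congr 1; field_simp
    · field_simp

/-- The convolution of a sequence with the one-sided exponential `2^{-l d}`, `l ≥ 0`. -/
def expTail (d : ℝ) (φ : ℤ → ℝ≥0∞) (k : ℤ) : ℝ≥0∞ :=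
  ∑' l : ℕ, (2 : ℝ≥0∞) ^ (-((l : ℝ) * d)) * φ (k + l)

/-- Hardy's inequality for the exponential tail, for all exponents. -/
lemma exists_lqNorm_expTail_le {d : ℝ} (hd : 0 < d) (hq0 : q ≠ 0) :
    ∃ K : ℝ≥0, ∀ φ : ℤ → ℝ≥0∞, lqNorm q (expTail d φ) ≤ K * lqNorm q φ := by
  set c := ∑' l : ℕ, (2 : ℝ≥0∞) ^ (-((l : ℝ) * (d / 2))) with hc
  have hct : c ≠ ∞ := ENNReal.tsum_two_rpow_ne_top (half_pos hd)
  -- Half of the decay is spent on summing over $l$, which leaves a supremum with the other half.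
  -- Convexity is avoided, so exponents below $1$ are covered too.
  have key : ∀ (φ : ℤ → ℝ≥0∞) (k : ℤ), expTail d φ k ≤
      c * ⨆ l : ℕ, (2 : ℝ≥0∞) ^ (-((l : ℝ) * (d / 2))) * φ (k + l) := by
    intro φ k
    rw [hc, ← ENNReal.tsum_mul_right]
    refine ENNReal.tsum_le_tsum fun l => ?_
    have : (2 : ℝ≥0∞) ^ (-((l : ℝ) * d)) =
        2 ^ (-((l : ℝ) * (d / 2))) * 2 ^ (-((l : ℝ) * (d / 2))) := by
      rw [← ENNReal.two_rpow_add]; congr 1; ring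
    rw [this, mul_assoc]
    gcongr
    exact le_iSup (fun l : ℕ => (2 : ℝ≥0∞) ^ (-((l : ℝ) * (d / 2))) * φ (k + l)) l
  have hle1 : ∀ l : ℕ, (2 : ℝ≥0∞) ^ (-((l : ℝ) * (d / 2))) ≤ 1 := fun l => by
    rw [← ENNReal.rpow_zero (x := 2)]
    exact ENNReal.two_rpow_le_two_rpow (neg_nonpos.2 (by positivity))
  by_cases hq : q = ∞
  · subst hq
    refine ⟨c.toNNReal, fun φ => ?_⟩
    rw [ENNReal.coe_toNNReal hct, lqNorm_top, lqNorm_top]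
    refine iSup_le fun k => (key φ k).trans ?_
    gcongr
    exact iSup_le fun l => (mul_le_of_le_one_left' (hle1 l)).trans (le_iSup φ _)
  · have hr := ENNReal.toReal_pos hq0 hq
    set r := q.toReal
    set c' := ∑' l : ℕ, (2 : ℝ≥0∞) ^ (-((l : ℝ) * (d / 2 * r))) with hc'
    have hct' : c' ≠ ∞ := ENNReal.tsum_two_rpow_ne_top (by positivity)
    have hK : c * c' ^ (1 / r) ≠ ∞ :=
      ENNReal.mul_ne_top hct (ENNReal.rpow_ne_top_of_nonneg (by positivity) hct')
    refine ⟨(c * c' ^ (1 / r)).toNNReal, fun φ => ?_⟩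
    rw [ENNReal.coe_toNNReal hK, ← ENNReal.rpow_le_rpow_iff hr, lqNorm_rpow_toReal hq0 hq,
      ENNReal.mul_rpow_of_nonneg _ _ hr.le, lqNorm_rpow_toReal hq0 hq,
      ENNReal.mul_rpow_of_nonneg _ _ hr.le, ← ENNReal.rpow_mul, one_div_mul_cancel hr.ne',
      ENNReal.rpow_one]
    calc ∑' k, expTail d φ k ^ r
        ≤ ∑' k : ℤ, c ^ r * ∑' l : ℕ, (2 : ℝ≥0∞) ^ (-((l : ℝ) * (d / 2 * r))) * φ (k + l) ^ r := by
          refine ENNReal.tsum_le_tsum fun k => ?_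
          refine (ENNReal.rpow_le_rpow (key φ k) hr.le).trans ?_
          rw [ENNReal.mul_rpow_of_nonneg _ _ hr.le, ENNReal.rpow_iSup _ hr]
          gcongr
          -- The $r$-th power of the supremum is at most the sum of the $r$-th powers; the sum over
          -- $k$ is then invariant under the shift by $l$.
          refine iSup_le fun l => le_trans (le_of_eq ?_) (ENNReal.le_tsum l)
          rw [ENNReal.mul_rpow_of_nonneg _ _ hr.le, ← ENNReal.rpow_mul]
          congr 2; ring
      _ = c ^ r * (c' * ∑' k, φ k ^ r) := by
          rw [ENNReal.tsum_mul_left, ENNReal.tsum_comm, hc', ← ENNReal.tsum_mul_right]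
          congr 1
          refine tsum_congr fun l => ?_
          rw [ENNReal.tsum_mul_left]
          congr 1
          exact (Equiv.addRight (l : ℤ)).tsum_eq (fun k => φ k ^ r)
      _ = _ := by rw [mul_assoc]

end lqNorm

/-! ### Doubling measures, ball averages and the maximal function. -/

/-- A measure with positive and finite measure of balls and the doubling property with upper
dimension `Q`. -/
structure IsDoubling {Z : Type*} [MetricSpace Z] [MeasurableSpace Z] (μ : Measure Z) (Q C : ℝ) :
    Prop where
  pos : ∀ (ξ : Z) (r : ℝ), 0 < r → 0 < μ (Metric.ball ξ r)
  lt_top : ∀ (ξ : Z) (r : ℝ), μ (Metric.ball ξ r) < ∞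
  dim_pos : 0 < Q
  one_le : 1 ≤ C
  measure_mul_le : ∀ (ξ : Z) (r l : ℝ), 0 < r → 1 ≤ l →
    μ (Metric.ball ξ (l * r)) ≤ ENNReal.ofReal (C * l ^ Q) * μ (Metric.ball ξ r)

/-- The average of `φ` over the ball of radius `r` centered at the given point. -/
def ballAverage {Z : Type*} [MetricSpace Z] [MeasurableSpace Z] (μ : Measure Z) (r : ℝ)
    (φ : Z → ℝ≥0∞) (ξ : Z) : ℝ≥0∞ :=
  (∫⁻ η in Metric.ball ξ r, φ η ∂μ) / μ (Metric.ball ξ r)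

/-- The uncentered Hardy–Littlewood maximal function. -/
def maximalFunction {Z : Type*} [MetricSpace Z] [MeasurableSpace Z] (μ : Measure Z)
    (φ : Z → ℝ≥0∞) (ξ : Z) : ℝ≥0∞ :=
  ⨆ (z : Z) (r : ℝ) (_ : ξ ∈ Metric.ball z r), ballAverage μ r φ z

namespace ENNReal

/-- A dyadic layer-cake bound for the Marcinkiewicz argument: if $2^n<a\le2^{n+1}$, the term of
index $n-1$ alone suffices. -/
lemma rpow_le_tsum_dyadic {P : ℝ} (hP : 0 < P) (a : ℝ≥0∞) :
    a ^ P ≤ ∑' n : ℤ, (2 : ℝ≥0∞) ^ (((n : ℝ) + 2) * P) *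
      (if (2 : ℝ≥0∞) ^ ((n : ℝ) + 1) < a then 1 else 0) := by
  rcases eq_or_ne a 0 with rfl | h0
  · simp [hP]
  rcases eq_or_ne a ∞ with rfl | ht
  · refine le_trans ?_ (ENNReal.tsum_comp_le_tsum_of_injective (f := fun n : ℕ => (n : ℤ))
      Nat.cast_injective _)
    have : ∀ n : ℕ, (1 : ℝ≥0∞) ≤ (2 : ℝ≥0∞) ^ ((((n : ℤ) : ℝ) + 2) * P) *
        (if (2 : ℝ≥0∞) ^ (((n : ℤ) : ℝ) + 1) < ∞ then 1 else 0) := fun n => by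
      rw [if_pos (two_rpow_ne_top _).lt_top, mul_one, ← ENNReal.rpow_zero (x := 2)]
      exact two_rpow_le_two_rpow (by push_cast; positivity)
    refine le_trans ?_ (ENNReal.tsum_le_tsum this)
    rw [ENNReal.tsum_const_eq_top_of_ne_zero one_ne_zero]
    exact le_top
  · obtain ⟨n, hn⟩ := ENNReal.exists_mem_Ioc_zpow h0 ht (y := 2) (by norm_num) (by norm_num)
    refine le_trans ?_ (ENNReal.le_tsum (n - 1))
    have h1 : (2 : ℝ≥0∞) ^ (((n - 1 : ℤ) : ℝ) + 1) = 2 ^ n := by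
      rw [← ENNReal.rpow_intCast]; push_cast; congr 1; ring
    have h2 : (2 : ℝ≥0∞) ^ ((((n - 1 : ℤ) : ℝ) + 2) * P) = (2 ^ (n + 1)) ^ P := by
      rw [← ENNReal.rpow_intCast, ← ENNReal.rpow_mul]; push_cast; congr 1; ring
    rw [h1, if_pos hn.1, mul_one, h2]
    exact ENNReal.rpow_le_rpow hn.2 hP.le

/-- Only indices with $2^n<a$ contribute, and this geometric series is dominated by its top term. -/
lemma exists_tsum_dyadic_le_rpow {d : ℝ} (hd : 0 < d) :
    ∃ K : ℝ≥0, ∀ a : ℝ≥0∞, ∑' n : ℤ, (2 : ℝ≥0∞) ^ ((n : ℝ) * d) *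
      (if (2 : ℝ≥0∞) ^ (n : ℝ) < a then 1 else 0) ≤ K * a ^ d := by
  set c := ∑' l : ℕ, (2 : ℝ≥0∞) ^ (-((l : ℝ) * d)) with hc
  have hct : c ≠ ∞ := tsum_two_rpow_ne_top hd
  have hc0 : c ≠ 0 := by
    intro h0
    have := ENNReal.tsum_eq_zero.1 h0 0
    exact two_rpow_ne_zero _ this
  refine ⟨c.toNNReal, fun a => ?_⟩
  rw [ENNReal.coe_toNNReal hct]
  rcases eq_or_ne a 0 with rfl | h0
  · simp
  rcases eq_or_ne a ∞ with rfl | ht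
  · rw [ENNReal.top_rpow_of_pos hd, ENNReal.mul_top hc0]; exact le_top
  obtain ⟨m, hm⟩ := ENNReal.exists_mem_Ioc_zpow h0 ht (y := 2) (by norm_num) (by norm_num)
  have hinj : Function.Injective (fun l : ℕ => m - (l : ℤ)) := fun a b h => by
    simp only at h; omega
  rw [← hinj.tsum_eq]
  · calc ∑' l : ℕ, (2 : ℝ≥0∞) ^ (((m - (l : ℤ) : ℤ) : ℝ) * d) *
          (if (2 : ℝ≥0∞) ^ ((m - (l : ℤ) : ℤ) : ℝ) < a then 1 else 0)
        ≤ ∑' l : ℕ, 2 ^ (-((l : ℝ) * d)) * (2 ^ m : ℝ≥0∞) ^ d := by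
          refine ENNReal.tsum_le_tsum fun l => ?_
          refine (mul_le_of_le_one_right' (by split_ifs <;> simp)).trans (le_of_eq ?_)
          rw [← ENNReal.rpow_intCast, ← ENNReal.rpow_mul, ← two_rpow_add]
          push_cast; congr 1; ring
      _ ≤ c * a ^ d := by
          rw [ENNReal.tsum_mul_right]
          gcongr
          exact hm.1.le
  · intro n hn
    rw [Function.mem_support] at hn
    have : (2 : ℝ≥0∞) ^ (n : ℝ) < a := by
      by_contra h
      exact hn (by rw [if_neg h, mul_zero])
    have h2 : (2 : ℝ≥0∞) ^ (n : ℝ) < 2 ^ ((m + 1 : ℤ) : ℝ) := by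
      rw [ENNReal.rpow_intCast 2 (m + 1)]; exact this.trans_le hm.2
    have h3 : n < m + 1 := by
      by_contra h
      push Not at h
      exact absurd h2 (not_lt.2 (two_rpow_le_two_rpow (by exact_mod_cast h)))
    exact ⟨(m - n).toNat, by simp only; omega⟩

end ENNReal

lemma maximalFunction_mono {Z : Type*} [MetricSpace Z] [MeasurableSpace Z] {μ : Measure Z}
    {φ ψ : Z → ℝ≥0∞} (h : ∀ ξ, φ ξ ≤ ψ ξ) (ξ : Z) :
    maximalFunction μ φ ξ ≤ maximalFunction μ ψ ξ := by
  refine iSup_mono fun z => iSup_mono fun r => iSup_mono fun _ => ?_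
  exact ENNReal.div_le_div_right (lintegral_mono h) _

lemma ballAverage_mono {Z : Type*} [MetricSpace Z] [MeasurableSpace Z] {μ : Measure Z} {r : ℝ}
    {φ ψ : Z → ℝ≥0∞} (h : ∀ ξ, φ ξ ≤ ψ ξ) (ξ : Z) :
    ballAverage μ r φ ξ ≤ ballAverage μ r ψ ξ :=
  ENNReal.div_le_div_right (lintegral_mono h) _

lemma ballAverage_le_maximalFunction {Z : Type*} [MetricSpace Z] [MeasurableSpace Z]
    {μ : Measure Z} {r : ℝ} (hr : 0 < r) (φ : Z → ℝ≥0∞) (ξ : Z) :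
    ballAverage μ r φ ξ ≤ maximalFunction μ φ ξ :=
  le_iSup_of_le ξ (le_iSup_of_le r (le_iSup_of_le (Metric.mem_ball_self hr) le_rfl))

lemma exists_isMaximalSeparated {Z : Type*} [MetricSpace Z] (r : ℝ) :
    ∃ A : Set Z, IsMaximalSeparated r A := by
  refine zorn_subset _ fun c hc hchain => ⟨⋃₀ c, ?_, fun s hs => subset_sUnion_of_mem hs⟩
  exact (Set.pairwise_sUnion hchain.directedOn).2 fun s hs => hc hs

lemma IsMaximalSeparated.exists_dist_lt {r : ℝ} {Z : Type*} [MetricSpace Z] {A : Set Z} (hr : 0 < r)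
    (hA : IsMaximalSeparated r A) (ξ : Z) : ∃ x ∈ A, dist ξ x < r := by
  by_contra! hcon
  have hmem : ξ ∈ A := by
    refine hA.mem_of_prop_insert ?_
    refine hA.prop.insert fun b hb _ => ⟨hcon b hb, ?_⟩
    rw [dist_comm]; exact hcon b hb
  simpa using (hcon ξ hmem).trans_lt' hr

namespace IsDoubling

variable {Z : Type*} [MetricSpace Z] [MeasurableSpace Z] {μ : Measure Z} {Q C : ℝ}

lemma measure_ball_le (h : IsDoubling μ Q C) {ξ η : Z} {R r l : ℝ} (hr : 0 < r) (hl : 1 ≤ l)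
    (hs : Metric.ball ξ R ⊆ Metric.ball η (l * r)) :
    μ (Metric.ball ξ R) ≤ ENNReal.ofReal (C * l ^ Q) * μ (Metric.ball η r) :=
  (measure_mono hs).trans (h.measure_mul_le η r l hr hl)

lemma ne_zero (h : IsDoubling μ Q C) (ξ : Z) {r : ℝ} (hr : 0 < r) : μ (Metric.ball ξ r) ≠ 0 :=
  (h.pos ξ r hr).ne'

lemma ne_top (h : IsDoubling μ Q C) (ξ : Z) (r : ℝ) : μ (Metric.ball ξ r) ≠ ∞ :=
  (h.lt_top ξ r).ne

lemma sigmaFinite (h : IsDoubling μ Q C) : SigmaFinite μ := by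
  rcases isEmpty_or_nonempty Z with hZ | ⟨⟨z⟩⟩
  · rw [Measure.eq_zero_of_isEmpty μ]; infer_instance
  · exact ⟨⟨⟨fun n : ℕ => Metric.ball z n, fun _ => trivial, fun n => h.lt_top z n,
      Metric.iUnion_ball_nat z⟩⟩⟩

lemma ballAverage_const (h : IsDoubling μ Q C) {r : ℝ} (hr : 0 < r) (c : ℝ≥0∞) (ξ : Z) :
    ballAverage μ r (fun _ => c) ξ = c := by
  rw [ballAverage, setLIntegral_const,
    ENNReal.mul_div_cancel_right (h.ne_zero ξ hr) (h.ne_top ξ r)]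

/-- The maximal function is uncentered, so the set is a union of balls; `φ` need not be measurable.
-/
lemma isOpen_lt_maximalFunction (φ : Z → ℝ≥0∞) (a : ℝ≥0∞) :
    IsOpen {ξ | a < maximalFunction μ φ ξ} := by
  have : {ξ | a < maximalFunction μ φ ξ} =
      ⋃ (z : Z) (r : ℝ) (_ : a < ballAverage μ r φ z), Metric.ball z r := by
    ext ξ
    simp [maximalFunction, lt_iSup_iff, and_comm]
  rw [this]
  exact isOpen_iUnion fun z => isOpen_iUnion fun r => isOpen_iUnion fun _ => Metric.isOpen_ball

lemma maximalFunction_add_const_le (h : IsDoubling μ Q C) (φ : Z → ℝ≥0∞) (a : ℝ≥0∞)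
    (ξ : Z) : maximalFunction μ (fun η => φ η + a) ξ ≤ maximalFunction μ φ ξ + a := by
  refine iSup_le fun z => iSup_le fun r => iSup_le fun hξ => ?_
  have : ballAverage μ r (fun η => φ η + a) z = ballAverage μ r φ z + a := by
    conv_rhs => rw [← h.ballAverage_const (Metric.pos_of_mem_ball hξ) a z]
    simp only [ballAverage]
    rw [lintegral_add_right _ measurable_const, ENNReal.add_div]
  rw [this]
  gcongr
  exact le_iSup_of_le z (le_iSup_of_le r (le_iSup_of_le hξ le_rfl))

variable [BorelSpace Z]

/-- The balls of radius $\varepsilon/2$ about an $\varepsilon$-separated set are disjoint and of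
positive measure, so $\sigma$-finiteness leaves only countably many. Second countability gives the
joint measurability needed for Tonelli. -/
lemma secondCountableTopology (h : IsDoubling μ Q C) : SecondCountableTopology Z := by
  have := h.sigmaFinite
  refine Metric.secondCountable_of_almost_dense_set fun ε hε => ?_
  obtain ⟨A, hA⟩ := exists_isMaximalSeparated (Z := Z) ε
  refine ⟨A, ?_, fun x => ?_⟩
  · have := Measure.countable_meas_pos_of_disjoint_iUnion (μ := μ)
      (As := fun a : A => Metric.ball (a : Z) (ε / 2)) (fun _ => Metric.isOpen_ball.measurableSet)
      (fun a b hab => Metric.ball_disjoint_ball (by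
        have := hA.prop a.2 b.2 (fun e => hab (Subtype.ext e)); linarith))
    have h2 : {a : A | 0 < μ (Metric.ball (a : Z) (ε / 2))} = univ :=
      eq_univ_of_forall fun a => h.pos _ _ (half_pos hε)
    rw [h2, countable_univ_iff] at this
    exact this
  · obtain ⟨y, hy, hlt⟩ := hA.exists_dist_lt hε x
    exact ⟨y, hy, hlt.le⟩

lemma measurable_indicator_dist (r : ℝ) [SecondCountableTopology Z] :
    MeasurableSet {z : Z × Z | dist z.2 z.1 < r} :=
  measurableSet_lt (measurable_snd.dist measurable_fst) measurable_const

lemma lintegral_ball_eq (r : ℝ) (φ : Z → ℝ≥0∞) (ξ : Z) :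
    ∫⁻ η in Metric.ball ξ r, φ η ∂μ =
      ∫⁻ η, {z : Z × Z | dist z.2 z.1 < r}.indicator (fun z => φ z.2) (ξ, η) ∂μ := by
  rw [← lintegral_indicator Metric.isOpen_ball.measurableSet]
  rfl

lemma measurable_lintegral_ball (h : IsDoubling μ Q C) (r : ℝ) {φ : Z → ℝ≥0∞}
    (hφ : Measurable φ) : Measurable fun ξ => ∫⁻ η in Metric.ball ξ r, φ η ∂μ := by
  have := h.secondCountableTopology
  have := h.sigmaFinite
  simp_rw [lintegral_ball_eq]
  exact Measurable.lintegral_prod_right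
    ((hφ.comp measurable_snd).indicator (measurable_indicator_dist r))

lemma measurable_measure_ball (h : IsDoubling μ Q C) (r : ℝ) :
    Measurable fun ξ => μ (Metric.ball ξ r) := by
  simpa using h.measurable_lintegral_ball r (φ := fun _ => 1) measurable_const

lemma measurable_ballAverage (h : IsDoubling μ Q C) (r : ℝ) {φ : Z → ℝ≥0∞}
    (hφ : Measurable φ) : Measurable (ballAverage μ r φ) :=
  (h.measurable_lintegral_ball r hφ).div (h.measurable_measure_ball r)

/-- Averaging operators are self-adjoint up to a constant. -/
lemma lintegral_ballAverage_mul_le (h : IsDoubling μ Q C) {r : ℝ} (hr : 0 < r) {φ ψ : Z → ℝ≥0∞}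
    (hφ : Measurable φ) (hψ : Measurable ψ) :
    ∫⁻ ξ, ballAverage μ r φ ξ * ψ ξ ∂μ ≤
      ENNReal.ofReal (C * 2 ^ Q) * ∫⁻ ξ, φ ξ * ballAverage μ r ψ ξ ∂μ := by
  have := h.secondCountableTopology
  have := h.sigmaFinite
  -- The kernel $1_{d<r}/\mu(B(\xi,r))$ is symmetric up to the doubling constant; the rest is
  -- Tonelli.
  have hinv : ∀ ξ η : Z, dist η ξ < r → (μ (Metric.ball ξ r))⁻¹ ≤
      ENNReal.ofReal (C * 2 ^ Q) * (μ (Metric.ball η r))⁻¹ := fun ξ η hd => by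
    have h1 : μ (Metric.ball η r) ≤ ENNReal.ofReal (C * 2 ^ Q) * μ (Metric.ball ξ r) :=
      h.measure_ball_le hr (by norm_num) (Metric.ball_subset_ball' (by linarith))
    rw [← div_eq_mul_inv, ENNReal.le_div_iff_mul_le (Or.inl (h.ne_zero η hr))
      (Or.inl (h.ne_top η r)), mul_comm, ← div_eq_mul_inv]
    exact ENNReal.div_le_of_le_mul h1
  let S : Set (Z × Z) := {z | dist z.2 z.1 < r}
  have hS : MeasurableSet S := measurable_indicator_dist r
  have hmeas : Measurable fun z : Z × Z =>
      S.indicator (fun z => φ z.2) z * (ψ z.1 * (μ (Metric.ball z.1 r))⁻¹) :=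
    ((hφ.comp measurable_snd).indicator hS).mul
      ((hψ.comp measurable_fst).mul ((h.measurable_measure_ball r).comp measurable_fst).inv)
  calc ∫⁻ ξ, ballAverage μ r φ ξ * ψ ξ ∂μ
      = ∫⁻ ξ, ∫⁻ η, S.indicator (fun z => φ z.2) (ξ, η) *
          (ψ ξ * (μ (Metric.ball ξ r))⁻¹) ∂μ ∂μ := by
        refine lintegral_congr fun ξ => ?_
        rw [lintegral_mul_const, ballAverage, lintegral_ball_eq, div_eq_mul_inv]
        · ring
        · exact ((hφ.comp measurable_snd).indicator hS).comp measurable_prodMk_left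
    _ = ∫⁻ η, ∫⁻ ξ, S.indicator (fun z => φ z.2) (ξ, η) *
          (ψ ξ * (μ (Metric.ball ξ r))⁻¹) ∂μ ∂μ :=
        lintegral_lintegral_swap hmeas.aemeasurable
    _ ≤ ∫⁻ η, ENNReal.ofReal (C * 2 ^ Q) * (φ η * ballAverage μ r ψ η) ∂μ := by
        refine lintegral_mono fun η => ?_
        have : ∀ ξ, S.indicator (fun z => φ z.2) (ξ, η) * (ψ ξ * (μ (Metric.ball ξ r))⁻¹) ≤
            ENNReal.ofReal (C * 2 ^ Q) * (φ η * (μ (Metric.ball η r))⁻¹) *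
              S.indicator (fun z => ψ z.2) (η, ξ) := fun ξ => by
          by_cases hd : dist η ξ < r
          · have h1 : (ξ, η) ∈ S := hd
            have h2 : (η, ξ) ∈ S := by simpa [S, dist_comm] using hd
            rw [indicator_of_mem h1, indicator_of_mem h2]
            calc φ η * (ψ ξ * (μ (Metric.ball ξ r))⁻¹)
                ≤ φ η * (ψ ξ * (ENNReal.ofReal (C * 2 ^ Q) * (μ (Metric.ball η r))⁻¹)) := by
                  gcongr; exact hinv ξ η hd
              _ = _ := by ring
          · have h1 : (ξ, η) ∉ S := hd
            rw [indicator_of_notMem h1]; simp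
        refine (lintegral_mono this).trans (le_of_eq ?_)
        rw [lintegral_const_mul, ballAverage, lintegral_ball_eq, div_eq_mul_inv]
        · ring
        · exact ((hψ.comp measurable_snd).indicator hS).comp measurable_prodMk_left
    _ = _ := lintegral_const_mul _ (hφ.mul (h.measurable_ballAverage r hψ))

lemma lintegral_ballAverage_le (h : IsDoubling μ Q C) {r : ℝ} (hr : 0 < r) {φ : Z → ℝ≥0∞}
    (hφ : Measurable φ) :
    ∫⁻ ξ, ballAverage μ r φ ξ ∂μ ≤ ENNReal.ofReal (C * 2 ^ Q) * ∫⁻ ξ, φ ξ ∂μ := by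
  simpa [h.ballAverage_const hr] using
    h.lintegral_ballAverage_mul_le hr hφ (measurable_const (a := (1 : ℝ≥0∞)))

lemma measurable_maximalFunction (φ : Z → ℝ≥0∞) : Measurable (maximalFunction μ φ) :=
  measurable_of_Ioi fun a => (isOpen_lt_maximalFunction φ a).measurableSet

/-- The weak type `(1,1)` inequality for the maximal function. -/
lemma mul_measure_lt_maximalFunction_le (h : IsDoubling μ Q C) (φ : Z → ℝ≥0∞) (a : ℝ≥0∞) :
    a * μ {ξ | a < maximalFunction μ φ ξ} ≤ ENNReal.ofReal (C * 5 ^ Q) * ∫⁻ ξ, φ ξ ∂μ := by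
  have := h.sigmaFinite
  -- Vitali's lemma needs bounded radii. The bound $N$ is removed afterwards by monotone
  -- convergence.
  let T : ℕ → Set (Z × ℝ) := fun N => {b | 0 < b.2 ∧ b.2 ≤ N ∧ a < ballAverage μ b.2 φ b.1}
  have hU : {ξ | a < maximalFunction μ φ ξ} = ⋃ N, ⋃ b ∈ T N, Metric.ball b.1 b.2 := by
    ext ξ
    simp only [maximalFunction, lt_iSup_iff, mem_ofPred_eq, mem_iUnion, T]
    constructor
    · rintro ⟨z, r, hz, ha⟩
      obtain ⟨N, hN⟩ := exists_nat_ge r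
      exact ⟨N, (z, r), ⟨Metric.pos_of_mem_ball hz, hN, ha⟩, hz⟩
    · rintro ⟨N, b, hb, hξ⟩
      exact ⟨b.1, b.2, hξ, hb.2.2⟩
  have hmono : Monotone fun N => ⋃ b ∈ T N, Metric.ball b.1 b.2 := by
    intro N M hNM
    refine biUnion_subset_biUnion_left fun b hb => ⟨hb.1, hb.2.1.trans ?_, hb.2.2⟩
    exact_mod_cast hNM
  rw [hU, hmono.measure_iUnion, ENNReal.mul_iSup]
  refine iSup_le fun N => ?_
  obtain ⟨u, huT, hdisj, hcov⟩ := Vitali.exists_disjoint_subfamily_covering_enlargement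
    (fun b : Z × ℝ => Metric.ball b.1 b.2) (T N) (fun b => b.2) 2 (by norm_num)
    (fun b hb => hb.1.le) N (fun b hb => hb.2.1) (fun b hb => Metric.nonempty_ball.2 hb.1)
  have hdisj' : Pairwise (Function.onFun Disjoint fun b : u => Metric.ball b.1.1 b.1.2) :=
    fun b c hbc => hdisj b.2 c.2 (fun e => hbc (Subtype.ext e))
  have hcount : Countable u := by
    have := Measure.countable_meas_pos_of_disjoint_iUnion (μ := μ)
      (As := fun b : u => Metric.ball b.1.1 b.1.2) (fun _ => Metric.isOpen_ball.measurableSet)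
      hdisj'
    have h2 : {b : u | 0 < μ (Metric.ball b.1.1 b.1.2)} = univ :=
      eq_univ_of_forall fun b => h.pos _ _ (huT b.2).1
    rwa [h2, countable_univ_iff] at this
  have hsub : (⋃ b ∈ T N, Metric.ball b.1 b.2) ⊆ ⋃ b : u, Metric.ball b.1.1 (5 * b.1.2) := by
    refine iUnion₂_subset fun b hb => ?_
    obtain ⟨c, hc, ⟨z, hz1, hz2⟩, hle⟩ := hcov b hb
    -- The selected ball meets the given one and has at least half its radius, so $2+2+1=5$ times
    -- its radius reaches across.
    refine subset_iUnion_of_subset ⟨c, hc⟩ fun ξ hξ => ?_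
    simp only [Metric.mem_ball] at *
    have h1 := dist_triangle ξ b.1 c.1
    have h2 := dist_triangle_left b.1 c.1 z
    linarith
  calc a * μ (⋃ b ∈ T N, Metric.ball b.1 b.2)
      ≤ a * ∑' b : u, μ (Metric.ball b.1.1 (5 * b.1.2)) := by
        gcongr; exact (measure_mono hsub).trans (measure_iUnion_le _)
    _ ≤ ∑' b : u, ENNReal.ofReal (C * 5 ^ Q) * ∫⁻ ξ in Metric.ball b.1.1 b.1.2, φ ξ ∂μ := by
        rw [← ENNReal.tsum_mul_left]
        refine ENNReal.tsum_le_tsum fun b => ?_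
        have hb := huT b.2
        calc a * μ (Metric.ball b.1.1 (5 * b.1.2))
            ≤ a * (ENNReal.ofReal (C * 5 ^ Q) * μ (Metric.ball b.1.1 b.1.2)) := by
              gcongr; exact h.measure_mul_le _ _ _ hb.1 (by norm_num)
          _ = ENNReal.ofReal (C * 5 ^ Q) * (a * μ (Metric.ball b.1.1 b.1.2)) := by ring
          _ ≤ _ := by
              gcongr
              exact ENNReal.mul_le_of_le_div hb.2.2.le
    _ = ENNReal.ofReal (C * 5 ^ Q) * ∫⁻ ξ in ⋃ b : u, Metric.ball b.1.1 b.1.2, φ ξ ∂μ := by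
        rw [ENNReal.tsum_mul_left,
          lintegral_iUnion (fun b => Metric.isOpen_ball.measurableSet) hdisj']
    _ ≤ _ := by gcongr; exact Measure.restrict_le_self

/-- The maximal function is bounded on `L^P` for `P > 1`. -/
lemma exists_lintegral_maximalFunction_rpow_le (h : IsDoubling μ Q C) {P : ℝ} (hP : 1 < P) :
    ∃ K : ℝ≥0, ∀ φ : Z → ℝ≥0∞, Measurable φ →
      ∫⁻ ξ, maximalFunction μ φ ξ ^ P ∂μ ≤ K * ∫⁻ ξ, φ ξ ^ P ∂μ := by
  obtain ⟨c, hc⟩ := ENNReal.exists_tsum_dyadic_le_rpow (sub_pos.2 hP)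
  refine ⟨2 ^ (2 * P) * Real.toNNReal (C * 5 ^ Q) * c, fun φ hφ => ?_⟩
  have hcoe : ((2 ^ (2 * P) * Real.toNNReal (C * 5 ^ Q) * c : ℝ≥0) : ℝ≥0∞) =
      2 ^ (2 * P) * ENNReal.ofReal (C * 5 ^ Q) * c := by
    push_cast
    rw [ENNReal.coe_rpow_of_nonneg _ (by positivity)]; rfl
  rw [hcoe]
  -- The part of `φ` below $2^n$ adds at most $2^n$ to the maximal function, so the weak type bound
  -- at height $2^n$ is applied only to the part above it.
  let cut : ℤ → Z → ℝ≥0∞ := fun n ξ => φ ξ * (if (2 : ℝ≥0∞) ^ (n : ℝ) < φ ξ then 1 else 0)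
  have hcut : ∀ n, Measurable (cut n) := fun n =>
    hφ.mul (Measurable.ite (measurableSet_lt measurable_const hφ) measurable_const measurable_const)
  have hlevel : ∀ n : ℤ, μ {ξ | (2 : ℝ≥0∞) ^ ((n : ℝ) + 1) < maximalFunction μ φ ξ} ≤
      2 ^ (-(n : ℝ)) * (ENNReal.ofReal (C * 5 ^ Q) * ∫⁻ ξ, cut n ξ ∂μ) := fun n => by
    have hsub : {ξ | (2 : ℝ≥0∞) ^ ((n : ℝ) + 1) < maximalFunction μ φ ξ} ⊆
        {ξ | (2 : ℝ≥0∞) ^ (n : ℝ) < maximalFunction μ (cut n) ξ} := fun ξ hξ => by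
      have h1 : maximalFunction μ φ ξ ≤ maximalFunction μ (cut n) ξ + 2 ^ (n : ℝ) := by
        refine le_trans (maximalFunction_mono (fun η => ?_) ξ)
          (h.maximalFunction_add_const_le (cut n) (2 ^ (n : ℝ)) ξ)
        simp only [cut]
        split_ifs with hlt
        · simp
        · simpa using hlt
      have h2 := lt_of_lt_of_le hξ h1
      rw [ENNReal.two_rpow_add, ENNReal.rpow_one, mul_two] at h2
      exact lt_of_add_lt_add_right h2
    have h3 := h.mul_measure_lt_maximalFunction_le (cut n) (2 ^ (n : ℝ))
    calc _ ≤ μ {ξ | (2 : ℝ≥0∞) ^ (n : ℝ) < maximalFunction μ (cut n) ξ} := measure_mono hsub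
      _ = 2 ^ (-(n : ℝ)) * (2 ^ (n : ℝ) *
          μ {ξ | (2 : ℝ≥0∞) ^ (n : ℝ) < maximalFunction μ (cut n) ξ}) := by
        rw [← mul_assoc, ← ENNReal.two_rpow_add]; simp
      _ ≤ _ := by gcongr
  calc ∫⁻ ξ, maximalFunction μ φ ξ ^ P ∂μ
      ≤ ∫⁻ ξ, ∑' n : ℤ, (2 : ℝ≥0∞) ^ (((n : ℝ) + 2) * P) *
          {ξ | (2 : ℝ≥0∞) ^ ((n : ℝ) + 1) < maximalFunction μ φ ξ}.indicator 1 ξ ∂μ := by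
        refine lintegral_mono fun ξ => ?_
        refine (ENNReal.rpow_le_tsum_dyadic (by linarith) _).trans (le_of_eq ?_)
        simp [indicator_apply]
    _ = ∑' n : ℤ, (2 : ℝ≥0∞) ^ (((n : ℝ) + 2) * P) *
          μ {ξ | (2 : ℝ≥0∞) ^ ((n : ℝ) + 1) < maximalFunction μ φ ξ} := by
        have hm : ∀ n : ℤ, MeasurableSet
            {ξ | (2 : ℝ≥0∞) ^ ((n : ℝ) + 1) < maximalFunction μ φ ξ} := fun n =>
          (isOpen_lt_maximalFunction φ _).measurableSet
        rw [lintegral_tsum fun n =>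
          ((measurable_one.indicator (hm n)).const_mul _).aemeasurable]
        refine tsum_congr fun n => ?_
        rw [lintegral_const_mul _ (measurable_one.indicator (hm n)), lintegral_indicator_one (hm n)]
    _ ≤ ∑' n : ℤ, (2 : ℝ≥0∞) ^ (((n : ℝ) + 2) * P) *
          (2 ^ (-(n : ℝ)) * (ENNReal.ofReal (C * 5 ^ Q) * ∫⁻ ξ, cut n ξ ∂μ)) := by
        gcongr with n; exact hlevel n
    _ = 2 ^ (2 * P) * ENNReal.ofReal (C * 5 ^ Q) *
          ∑' n : ℤ, (2 : ℝ≥0∞) ^ ((n : ℝ) * (P - 1)) * ∫⁻ ξ, cut n ξ ∂μ := by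
        rw [← ENNReal.tsum_mul_left]
        refine tsum_congr fun n => ?_
        have : (2 : ℝ≥0∞) ^ (((n : ℝ) + 2) * P) * 2 ^ (-(n : ℝ)) =
            2 ^ (2 * P) * 2 ^ ((n : ℝ) * (P - 1)) := by
          rw [← ENNReal.two_rpow_add, ← ENNReal.two_rpow_add]; congr 1; ring
        rw [← mul_assoc, this]; ring
    _ = 2 ^ (2 * P) * ENNReal.ofReal (C * 5 ^ Q) *
          ∫⁻ ξ, φ ξ * ∑' n : ℤ, (2 : ℝ≥0∞) ^ ((n : ℝ) * (P - 1)) *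
            (if (2 : ℝ≥0∞) ^ (n : ℝ) < φ ξ then 1 else 0) ∂μ := by
        congr 1
        simp_rw [← ENNReal.tsum_mul_left]
        rw [lintegral_tsum]
        · refine tsum_congr fun n => ?_
          rw [← lintegral_const_mul _ (hcut n)]
          refine lintegral_congr fun ξ => ?_
          simp only [cut]; ring
        · intro n
          exact (hφ.mul ((Measurable.ite (measurableSet_lt measurable_const hφ) measurable_const
            measurable_const).const_mul _)).aemeasurable
    _ ≤ 2 ^ (2 * P) * ENNReal.ofReal (C * 5 ^ Q) * ∫⁻ ξ, c * φ ξ ^ P ∂μ := by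
        refine mul_le_mul_right (lintegral_mono fun ξ => ?_) _
        calc _ ≤ φ ξ * (c * φ ξ ^ (P - 1)) := by gcongr; exact hc (φ ξ)
          _ = c * (φ ξ ^ (1 : ℝ) * φ ξ ^ (P - 1)) := by rw [ENNReal.rpow_one]; ring
          _ = _ := by
            rw [← ENNReal.rpow_add_of_nonneg _ _ zero_le_one (by linarith)]; congr 2; ring
    _ = _ := by rw [lintegral_const_mul _ (hφ.pow_const P)]; ring

end IsDoubling

/-! ### The Fefferman–Stein inequality for averaging operators. -/

/-- A converse of Hölder's inequality on `σ`-finite measure spaces. -/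
lemma lintegral_rpow_le_of_forall_lintegral_mul_le {X : Type*} [MeasurableSpace X] {μ : Measure X}
    [SigmaFinite μ] {F : X → ℝ≥0∞} (hF : Measurable F) {α β : ℝ} (hαβ : α.HolderConjugate β)
    {A : ℝ≥0∞} (hA : ∀ h : X → ℝ≥0∞, Measurable h →
      ∫⁻ x, F x * h x ∂μ ≤ A * (∫⁻ x, h x ^ β ∂μ) ^ (1 / β)) :
    ∫⁻ x, F x ^ α ∂μ ≤ A ^ α := by
  have hα0 := hαβ.pos
  have hβ0 := hαβ.symm.pos
  -- Truncation in height and in space makes $J=\int T^\alpha$ finite, so that it can be cancelled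
  -- below.
  let T : ℕ → X → ℝ≥0∞ := fun N => (spanningSets μ N).indicator fun x => min (F x) N
  have hT : ∀ N, Measurable (T N) := fun N =>
    (hF.min measurable_const).indicator (measurableSet_spanningSets μ N)
  have hTF : ∀ N x, T N x ≤ F x := fun N x => by
    by_cases hx : x ∈ spanningSets μ N
    · simp [T, hx]
    · simp [T, hx]
  have hTmono : Monotone T := by
    intro N M hNM x
    simp only [T]
    refine (indicator_le_indicator_of_subset (monotone_spanningSets μ hNM)
      (fun _ => zero_le) x).trans (indicator_le_indicator ?_)
    gcongr
  have hsup : ∀ x, F x ^ α = ⨆ N, T N x ^ α := fun x => by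
    rw [← ENNReal.rpow_iSup _ hα0]
    congr 1
    refine le_antisymm ?_ (iSup_le fun N => hTF N x)
    refine ENNReal.le_of_forall_nnreal_lt fun c hc => ?_
    obtain ⟨N, hN⟩ := exists_nat_ge c
    have hx : x ∈ ⋃ N, spanningSets μ N := by rw [iUnion_spanningSets]; trivial
    obtain ⟨M, hM⟩ := mem_iUnion.1 hx
    refine le_iSup_of_le (max N M) ?_
    have hM' : x ∈ spanningSets μ (max N M) := monotone_spanningSets μ (le_max_right N M) hM
    simp only [T, indicator_of_mem hM']
    refine le_min hc.le ?_
    have : c ≤ ((max N M : ℕ) : ℝ≥0) := hN.trans (by exact_mod_cast le_max_left N M)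
    exact_mod_cast this
  have hfin : ∀ N, ∫⁻ x, T N x ^ α ∂μ ≠ ∞ := fun N => by
    have hle : ∀ x, T N x ^ α ≤ (spanningSets μ N).indicator (fun _ => (N : ℝ≥0∞) ^ α) x :=
      fun x => by
        by_cases hx : x ∈ spanningSets μ N
        · simp only [T, indicator_of_mem hx]
          exact ENNReal.rpow_le_rpow (min_le_right _ _) hα0.le
        · simp [T, hx, hα0]
    refine ne_top_of_le_ne_top ?_ (lintegral_mono hle)
    rw [lintegral_indicator_const (measurableSet_spanningSets μ N)]
    exact ENNReal.mul_ne_top (ENNReal.rpow_ne_top_of_nonneg hα0.le (ENNReal.natCast_ne_top N))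
      (measure_spanningSets_lt_top μ N).ne
  simp_rw [hsup]
  rw [lintegral_iSup (fun N => (hT N).pow_const α)
    (fun N M hNM x => ENNReal.rpow_le_rpow (hTmono hNM x) hα0.le)]
  refine iSup_le fun N => ?_
  set J := ∫⁻ x, T N x ^ α ∂μ with hJ
  have h1 : J ≤ A * J ^ (1 / β) := by
    -- The test function $T^{\alpha-1}$ has $\beta$-th power $T^\alpha$, whence $J\le
    -- A\,J^{1/\beta}$.
    have := hA (fun x => T N x ^ (α - 1)) ((hT N).pow_const _)
    have h2 : ∀ x, (T N x ^ (α - 1)) ^ β = T N x ^ α := fun x => by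
      rw [← ENNReal.rpow_mul, hαβ.sub_one_mul_conj]
    simp_rw [h2] at this
    refine le_trans (lintegral_mono fun x => ?_) this
    calc T N x ^ α = T N x ^ (1 : ℝ) * T N x ^ (α - 1) := by
          rw [← ENNReal.rpow_add_of_nonneg _ _ zero_le_one hαβ.sub_one_pos.le]; congr 1; ring
      _ ≤ _ := by rw [ENNReal.rpow_one]; gcongr; exact hTF N x
  rcases eq_or_ne J 0 with h0 | h0
  · rw [h0]; exact zero_le
  have hJt : J ≠ ∞ := hfin N
  have h3 : J = J ^ (1 / α) * J ^ (1 / β) := by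
    rw [← ENNReal.rpow_add _ _ h0 hJt]
    have := hαβ.inv_add_inv_eq_one
    rw [one_div, one_div, this, ENNReal.rpow_one]
  have h4 : J ^ (1 / α) ≤ A := by
    have h5 : J ^ (1 / β) ≠ 0 := by simp [ENNReal.rpow_eq_zero_iff, h0, hJt]
    have h6 : J ^ (1 / β) ≠ ∞ := ENNReal.rpow_ne_top_of_nonneg (by positivity) hJt
    rw [← ENNReal.mul_le_mul_iff_left h5 h6, ← h3]
    exact h1
  calc J = (J ^ (1 / α)) ^ α := by
        rw [← ENNReal.rpow_mul, one_div_mul_cancel hα0.ne', ENNReal.rpow_one]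
    _ ≤ A ^ α := ENNReal.rpow_le_rpow h4 hα0.le

namespace IsDoubling

variable {Z : Type*} [MetricSpace Z] [MeasurableSpace Z] {μ : Measure Z} {Q C : ℝ}

lemma _root_.ballAverage_eq_lintegral (r : ℝ) (φ : Z → ℝ≥0∞) (ξ : Z) :
    ballAverage μ r φ ξ =
      ∫⁻ η, φ η ∂((μ (Metric.ball ξ r))⁻¹ • μ.restrict (Metric.ball ξ r)) := by
  rw [lintegral_smul_measure, ballAverage, div_eq_mul_inv, mul_comm, smul_eq_mul]

lemma _root_.ballAverage_mono_ae {r : ℝ} {φ ψ : Z → ℝ≥0∞} (h : ∀ᵐ ξ ∂μ, φ ξ ≤ ψ ξ) (ξ : Z) :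
    ballAverage μ r φ ξ ≤ ballAverage μ r ψ ξ :=
  ENNReal.div_le_div_right (lintegral_mono_ae (ae_restrict_of_ae h)) _

/-- Hölder's inequality for the normalized measure on the ball, with $p/q=p-1$. -/
lemma _root_.ballAverage_mul_rpow_le {r : ℝ} {φ ψ : Z → ℝ≥0∞} (hφ : Measurable φ)
    (hψ : Measurable ψ) {p q : ℝ} (hpq : p.HolderConjugate q) (ξ : Z) :
    ballAverage μ r (fun η => φ η * ψ η) ξ ^ p ≤
      ballAverage μ r (fun η => φ η ^ p) ξ * ballAverage μ r (fun η => ψ η ^ q) ξ ^ (p - 1) := by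
  simp_rw [ballAverage_eq_lintegral]
  refine (ENNReal.rpow_le_rpow (ENNReal.lintegral_mul_le_Lp_mul_Lq _ hpq hφ.aemeasurable
    hψ.aemeasurable) hpq.nonneg).trans (le_of_eq ?_)
  rw [ENNReal.mul_rpow_of_nonneg _ _ hpq.nonneg, ← ENNReal.rpow_mul, ← ENNReal.rpow_mul,
    one_div_mul_cancel hpq.ne_zero, ENNReal.rpow_one]
  congr 2
  rw [← hpq.div_conj_eq_sub_one]; ring

lemma ballAverage_rpow_le (h : IsDoubling μ Q C) {r : ℝ} (hr : 0 < r) {φ : Z → ℝ≥0∞}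
    (hφ : Measurable φ) {p : ℝ} (hp : 1 < p) (ξ : Z) :
    ballAverage μ r φ ξ ^ p ≤ ballAverage μ r (fun η => φ η ^ p) ξ := by
  have := ballAverage_mul_rpow_le (μ := μ) (r := r) hφ (measurable_const (a := (1 : ℝ≥0∞)))
    (Real.HolderConjugate.conjExponent hp) ξ
  simpa [h.ballAverage_const hr] using this

variable [BorelSpace Z] {ι : Type*} [Countable ι]

lemma measurable_tsum_ballAverage_rpow (h : IsDoubling μ Q C) (ρ : ι → ℝ) {R : ℝ}
    {φ : ι → Z → ℝ≥0∞} (hφ : ∀ k, Measurable (φ k)) :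
    Measurable fun ξ => ∑' k, ballAverage μ (ρ k) (φ k) ξ ^ R :=
  Measurable.tsum fun k => (h.measurable_ballAverage (ρ k) (hφ k)).pow_const R

lemma lintegral_tsum_ballAverage_mul_le (h : IsDoubling μ Q C) {ρ : ι → ℝ} (hρ : ∀ k, 0 < ρ k)
    {φ : ι → Z → ℝ≥0∞} (hφ : ∀ k, Measurable (φ k)) {ψ : Z → ℝ≥0∞} (hψ : Measurable ψ) :
    ∫⁻ ξ, (∑' k, ballAverage μ (ρ k) (φ k) ξ) * ψ ξ ∂μ ≤
      ENNReal.ofReal (C * 2 ^ Q) * ∫⁻ ξ, (∑' k, φ k ξ) * maximalFunction μ ψ ξ ∂μ := by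
  simp_rw [← ENNReal.tsum_mul_right]
  rw [lintegral_tsum fun k => by
      exact ((h.measurable_ballAverage (ρ k) (hφ k)).mul hψ).aemeasurable,
    lintegral_tsum fun k => by
      exact ((hφ k).mul (measurable_maximalFunction ψ)).aemeasurable,
    ← ENNReal.tsum_mul_left]
  refine ENNReal.tsum_le_tsum fun k =>
    (h.lintegral_ballAverage_mul_le (hρ k) (hφ k) hψ).trans ?_
  gcongr
  exact ballAverage_le_maximalFunction (hρ k) ψ _

lemma lintegral_tsum_ballAverage_le (h : IsDoubling μ Q C) {ρ : ι → ℝ} (hρ : ∀ k, 0 < ρ k)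
    {φ : ι → Z → ℝ≥0∞} (hφ : ∀ k, Measurable (φ k)) :
    ∫⁻ ξ, ∑' k, ballAverage μ (ρ k) (φ k) ξ ∂μ ≤
      ENNReal.ofReal (C * 2 ^ Q) * ∫⁻ ξ, ∑' k, φ k ξ ∂μ := by
  rw [lintegral_tsum fun k => (h.measurable_ballAverage (ρ k) (hφ k)).aemeasurable,
    lintegral_tsum fun k => (hφ k).aemeasurable, ← ENNReal.tsum_mul_left]
  exact ENNReal.tsum_le_tsum fun k => h.lintegral_ballAverage_le (hρ k) (hφ k)

/-- Duality in $L^{P/R}$: after Jensen, the averages are moved onto the test function, where the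
maximal function dominates all of them at once and is bounded on the dual space. -/
lemma exists_lintegral_tsum_ballAverage_rpow_le_of_lt (h : IsDoubling μ Q C) {P R : ℝ}
    (hR : 1 < R) (hRP : R < P) :
    ∃ K : ℝ≥0, ∀ ρ : ι → ℝ, (∀ k, 0 < ρ k) → ∀ φ : ι → Z → ℝ≥0∞, (∀ k, Measurable (φ k)) →
      ∫⁻ ξ, (∑' k, ballAverage μ (ρ k) (φ k) ξ ^ R) ^ (P / R) ∂μ ≤
        K * ∫⁻ ξ, (∑' k, φ k ξ ^ R) ^ (P / R) ∂μ := by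
  have := h.sigmaFinite
  have hR0 : 0 < R := by linarith
  set α := P / R with hα
  have hα1 : 1 < α := (one_lt_div hR0).2 hRP
  have hα0 : 0 < α := by linarith
  set β := α.conjExponent
  have hαβ : α.HolderConjugate β := Real.HolderConjugate.conjExponent hα1
  have hβ0 : 0 < β := hαβ.symm.pos
  obtain ⟨c, hc⟩ := h.exists_lintegral_maximalFunction_rpow_le hαβ.symm.lt
  have hK : (ENNReal.ofReal (C * 2 ^ Q) * (c : ℝ≥0∞) ^ (1 / β)) ^ α ≠ ∞ :=
    ENNReal.rpow_ne_top_of_nonneg hα0.le (ENNReal.mul_ne_top ENNReal.ofReal_ne_top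
      (ENNReal.rpow_ne_top_of_nonneg (by positivity) ENNReal.coe_ne_top))
  refine ⟨((ENNReal.ofReal (C * 2 ^ Q) * (c : ℝ≥0∞) ^ (1 / β)) ^ α).toNNReal,
    fun ρ hρ φ hφ => ?_⟩
  rw [ENNReal.coe_toNNReal hK]
  set D : Z → ℝ≥0∞ := fun ξ => ∑' k, φ k ξ ^ R with hD
  have hDm : Measurable D := Measurable.tsum fun k => (hφ k).pow_const R
  have main := lintegral_rpow_le_of_forall_lintegral_mul_le (μ := μ)
    (h.measurable_tsum_ballAverage_rpow ρ (R := R) hφ) hαβ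
    (A := ENNReal.ofReal (C * 2 ^ Q) * (c : ℝ≥0∞) ^ (1 / β) * (∫⁻ ξ, D ξ ^ α ∂μ) ^ (1 / α)) ?_
  · refine main.trans (le_of_eq ?_)
    rw [ENNReal.mul_rpow_of_nonneg _ _ hα0.le, ← ENNReal.rpow_mul, one_div_mul_cancel hα0.ne',
      ENNReal.rpow_one]
  · intro ψ hψ
    calc ∫⁻ ξ, (∑' k, ballAverage μ (ρ k) (φ k) ξ ^ R) * ψ ξ ∂μ
        ≤ ∫⁻ ξ, (∑' k, ballAverage μ (ρ k) (fun η => φ k η ^ R) ξ) * ψ ξ ∂μ := by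
          refine lintegral_mono fun ξ => mul_le_mul_left (ENNReal.tsum_le_tsum fun k => ?_) _
          exact h.ballAverage_rpow_le (hρ k) (hφ k) hR ξ
      _ ≤ ENNReal.ofReal (C * 2 ^ Q) * ∫⁻ ξ, D ξ * maximalFunction μ ψ ξ ∂μ :=
          h.lintegral_tsum_ballAverage_mul_le hρ (fun k => (hφ k).pow_const R) hψ
      _ ≤ ENNReal.ofReal (C * 2 ^ Q) * ((∫⁻ ξ, D ξ ^ α ∂μ) ^ (1 / α) *
            (∫⁻ ξ, maximalFunction μ ψ ξ ^ β ∂μ) ^ (1 / β)) := by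
          gcongr
          exact ENNReal.lintegral_mul_le_Lp_mul_Lq μ hαβ hDm.aemeasurable
            (measurable_maximalFunction ψ).aemeasurable
      _ ≤ ENNReal.ofReal (C * 2 ^ Q) * ((∫⁻ ξ, D ξ ^ α ∂μ) ^ (1 / α) *
            (c * ∫⁻ ξ, ψ ξ ^ β ∂μ) ^ (1 / β)) := by
          refine mul_le_mul_right (mul_le_mul_right ?_ _) _
          exact ENNReal.rpow_le_rpow (hc ψ hψ) (by positivity)
      _ = _ := by rw [ENNReal.mul_rpow_of_nonneg _ _ (by positivity)]; ring

/-- Here $P/R<1$ and duality is unavailable. With $D=\sum_k\varphi_k^R$, one writes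
$\varphi_k=(\varphi_kD^{-e})D^e$ and applies Hölder inside each average. The second factor is
bounded by a maximal function independent of $k$; the first sums to a function in $L^1$. Hölder with
exponents $1/\alpha$ and $1/(1-\alpha)$, $\alpha=P/R$, recombines them. -/
lemma exists_lintegral_tsum_ballAverage_rpow_le_of_gt (h : IsDoubling μ Q C) {P R : ℝ}
    (hP : 1 < P) (hPR : P < R) :
    ∃ K : ℝ≥0, ∀ ρ : ι → ℝ, (∀ k, 0 < ρ k) → ∀ φ : ι → Z → ℝ≥0∞, (∀ k, Measurable (φ k)) →
      ∫⁻ ξ, (∑' k, ballAverage μ (ρ k) (φ k) ξ ^ R) ^ (P / R) ∂μ ≤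
        K * ∫⁻ ξ, (∑' k, φ k ξ ^ R) ^ (P / R) ∂μ := by
  have hR : 1 < R := hP.trans hPR
  have hR0 : 0 < R := by linarith
  have hP0 : 0 < P := by linarith
  have hRP0 : 0 < R - P := by linarith
  have hR10 : 0 < R - 1 := by linarith
  set α := P / R with hα
  have hα0 : 0 < α := by positivity
  have hα1 : α < 1 := (div_lt_one hR0).2 hPR
  -- The exponents are forced by $1-eR=\alpha$ and $eR'S=\alpha$, which turn both factors into $\int
  -- D^\alpha$. The condition $S>1$, needed for the maximal theorem, amounts to $P>1$.
  set S := (R - 1) * P / (R - P) with hS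
  have hS1 : 1 < S := by rw [hS, one_lt_div hRP0]; nlinarith
  have hS0 : 0 < S := by linarith
  set e := (R - P) / R ^ 2 with he
  have he0 : 0 < e := by positivity
  set R' := R.conjExponent
  have hRR' : R.HolderConjugate R' := Real.HolderConjugate.conjExponent hR
  have hR'eq : R' = R / (R - 1) := rfl
  obtain ⟨c, hc⟩ := h.exists_lintegral_maximalFunction_rpow_le hS1
  have hK : ENNReal.ofReal (C * 2 ^ Q) ^ α * (c : ℝ≥0∞) ^ (1 - α) ≠ ∞ :=
    ENNReal.mul_ne_top (ENNReal.rpow_ne_top_of_nonneg hα0.le ENNReal.ofReal_ne_top)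
      (ENNReal.rpow_ne_top_of_nonneg (by linarith) ENNReal.coe_ne_top)
  -- The added $1$ makes the constant nonzero, so the bound is trivial when $\int D^\alpha=\infty$.
  refine ⟨(ENNReal.ofReal (C * 2 ^ Q) ^ α * (c : ℝ≥0∞) ^ (1 - α)).toNNReal + 1,
    fun ρ hρ φ hφ => ?_⟩
  rw [ENNReal.coe_add, ENNReal.coe_toNNReal hK]
  set D : Z → ℝ≥0∞ := fun ξ => ∑' k, φ k ξ ^ R with hD
  have hDm : Measurable D := Measurable.tsum fun k => (hφ k).pow_const R
  by_cases hI : ∫⁻ ξ, D ξ ^ α ∂μ = ∞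
  · rw [hI, ENNReal.mul_top (by simp)]; exact le_top
  refine le_trans ?_ (mul_le_mul_left (le_add_of_nonneg_right zero_le) _)
  have hDfin : ∀ᵐ ξ ∂μ, D ξ ≠ ∞ := by
    filter_upwards [ae_lt_top (hDm.pow_const α) hI] with ξ hξ h0
    rw [h0, ENNReal.top_rpow_of_pos hα0] at hξ
    exact lt_irrefl _ hξ
  set U : Z → ℝ≥0∞ := fun ξ => D ξ ^ (e * R') with hU
  have hUm : Measurable U := hDm.pow_const _
  let v : ι → Z → ℝ≥0∞ := fun k ξ => φ k ξ ^ R * D ξ ^ (-(e * R))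
  have hvm : ∀ k, Measurable (v k) := fun k => ((hφ k).pow_const R).mul (hDm.pow_const _)
  set H : Z → ℝ≥0∞ := fun ξ => ∑' k, ballAverage μ (ρ k) (v k) ξ with hH
  have hHm : Measurable H := Measurable.tsum fun k => h.measurable_ballAverage _ (hvm k)
  have hpt : ∀ k ξ, ballAverage μ (ρ k) (φ k) ξ ^ R ≤
      ballAverage μ (ρ k) (v k) ξ * maximalFunction μ U ξ ^ (R - 1) := fun k ξ => by
    -- Inserting $D^{-e}D^e$ loses nothing: $D$ is finite almost everywhere, and $D=0$ forces every
    -- $\varphi_k$ to vanish.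
    have h1 : ∀ᵐ η ∂μ, φ k η ≤ (φ k η * D η ^ (-e)) * D η ^ e := by
      filter_upwards [hDfin] with η hη
      rcases eq_or_ne (D η) 0 with h0 | h0
      · have := ENNReal.tsum_eq_zero.1 h0 k
        rw [ENNReal.rpow_eq_zero_iff_of_pos hR0] at this
        rw [this]; exact zero_le
      · rw [mul_assoc, ← ENNReal.rpow_add _ _ h0 hη]; simp
    have h2 := ballAverage_mul_rpow_le (μ := μ) (r := ρ k) ((hφ k).mul (hDm.pow_const (-e)))
      (hDm.pow_const e) hRR' ξ
    refine (ENNReal.rpow_le_rpow (ballAverage_mono_ae h1 ξ) hR0.le).trans (h2.trans ?_)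
    have h3 : (fun η => (φ k * fun x => D x ^ (-e)) η ^ R) = v k := funext fun η => by
      simp only [v, Pi.mul_apply]
      rw [ENNReal.mul_rpow_of_nonneg _ _ hR0.le, ← ENNReal.rpow_mul, neg_mul]
    have h4 : (fun η => (D η ^ e) ^ R') = U := funext fun η => by
      rw [← ENNReal.rpow_mul]
    rw [h3, h4]
    gcongr
    exact ballAverage_le_maximalFunction (hρ k) U ξ
  have hHI : ∫⁻ ξ, H ξ ∂μ ≤ ENNReal.ofReal (C * 2 ^ Q) * ∫⁻ ξ, D ξ ^ α ∂μ := by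
    refine (h.lintegral_tsum_ballAverage_le hρ hvm).trans ?_
    refine mul_le_mul_right (lintegral_mono_ae ?_) _
    filter_upwards [hDfin] with ξ hξ
    simp only [v]
    rw [ENNReal.tsum_mul_right]
    change D ξ * D ξ ^ (-(e * R)) ≤ _
    rcases eq_or_ne (D ξ) 0 with h0 | h0
    · rw [h0, zero_mul]; exact zero_le
    · have h1 := ENNReal.rpow_add 1 (-(e * R)) h0 hξ
      rw [ENNReal.rpow_one] at h1
      rw [← h1]
      refine le_of_eq ?_
      congr 1
      rw [he, hα]; field_simp; ring
  have hMI : ∫⁻ ξ, maximalFunction μ U ξ ^ S ∂μ ≤ c * ∫⁻ ξ, D ξ ^ α ∂μ := by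
    refine (hc U hUm).trans (le_of_eq ?_)
    congr 1
    refine lintegral_congr fun ξ => ?_
    rw [hU, ← ENNReal.rpow_mul]
    congr 1
    rw [he, hα, hS, hR'eq]; field_simp
  have hconj : (1 / α).HolderConjugate (1 / (1 - α)) := by
    rw [Real.holderConjugate_iff]
    refine ⟨(one_lt_div hα0).2 hα1, ?_⟩
    simp
  have h1α : 0 < 1 - α := by linarith
  have hMm : Measurable (maximalFunction μ U) := measurable_maximalFunction U
  calc ∫⁻ ξ, (∑' k, ballAverage μ (ρ k) (φ k) ξ ^ R) ^ α ∂μ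
      ≤ ∫⁻ ξ, H ξ ^ α * maximalFunction μ U ξ ^ ((R - 1) * α) ∂μ := by
        refine lintegral_mono fun ξ => ?_
        calc _ ≤ (H ξ * maximalFunction μ U ξ ^ (R - 1)) ^ α := by
              refine ENNReal.rpow_le_rpow ?_ hα0.le
              rw [hH, ← ENNReal.tsum_mul_right]
              exact ENNReal.tsum_le_tsum fun k => hpt k ξ
          _ = _ := by rw [ENNReal.mul_rpow_of_nonneg _ _ hα0.le, ← ENNReal.rpow_mul]
    _ ≤ (∫⁻ ξ, (H ξ ^ α) ^ (1 / α) ∂μ) ^ (1 / (1 / α)) *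
          (∫⁻ ξ, (maximalFunction μ U ξ ^ ((R - 1) * α)) ^ (1 / (1 - α)) ∂μ) ^
            (1 / (1 / (1 - α))) :=
        ENNReal.lintegral_mul_le_Lp_mul_Lq μ hconj (hHm.pow_const _).aemeasurable
          (hMm.pow_const _).aemeasurable
    _ = (∫⁻ ξ, H ξ ∂μ) ^ α * (∫⁻ ξ, maximalFunction μ U ξ ^ S ∂μ) ^ (1 - α) := by
        rw [one_div_one_div, one_div_one_div]
        congr 2
        · refine lintegral_congr fun ξ => ?_
          rw [← ENNReal.rpow_mul, mul_one_div_cancel hα0.ne', ENNReal.rpow_one]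
        · refine lintegral_congr fun ξ => ?_
          rw [← ENNReal.rpow_mul]
          congr 1
          have : 1 - α = (R - P) / R := by rw [hα]; field_simp
          rw [this, hα, hS]; field_simp
    _ ≤ (ENNReal.ofReal (C * 2 ^ Q) * ∫⁻ ξ, D ξ ^ α ∂μ) ^ α *
          (c * ∫⁻ ξ, D ξ ^ α ∂μ) ^ (1 - α) := by gcongr
    _ = ENNReal.ofReal (C * 2 ^ Q) ^ α * (c : ℝ≥0∞) ^ (1 - α) *
          ((∫⁻ ξ, D ξ ^ α ∂μ) ^ α * (∫⁻ ξ, D ξ ^ α ∂μ) ^ (1 - α)) := by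
        rw [ENNReal.mul_rpow_of_nonneg _ _ hα0.le, ENNReal.mul_rpow_of_nonneg _ _ h1α.le]; ring
    _ = _ := by
        rw [← ENNReal.rpow_add_of_nonneg _ _ hα0.le h1α.le, add_sub_cancel, ENNReal.rpow_one]

lemma exists_lintegral_tsum_ballAverage_rpow_le (h : IsDoubling μ Q C) {P R : ℝ}
    (hP : 1 < P) (hR : 1 < R) :
    ∃ K : ℝ≥0, ∀ ρ : ι → ℝ, (∀ k, 0 < ρ k) → ∀ φ : ι → Z → ℝ≥0∞, (∀ k, Measurable (φ k)) →
      ∫⁻ ξ, (∑' k, ballAverage μ (ρ k) (φ k) ξ ^ R) ^ (P / R) ∂μ ≤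
        K * ∫⁻ ξ, (∑' k, φ k ξ ^ R) ^ (P / R) ∂μ := by
  rcases lt_trichotomy P R with hlt | rfl | hlt
  · exact h.exists_lintegral_tsum_ballAverage_rpow_le_of_gt hP hlt
  · refine ⟨Real.toNNReal (C * 2 ^ Q), fun ρ hρ φ hφ => ?_⟩
    rw [div_self (by linarith)]
    simp_rw [ENNReal.rpow_one]
    refine le_trans (lintegral_mono fun ξ => ENNReal.tsum_le_tsum fun k =>
      h.ballAverage_rpow_le (hρ k) (hφ k) hP ξ) ?_
    exact h.lintegral_tsum_ballAverage_le hρ fun k => (hφ k).pow_const P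
  · exact h.exists_lintegral_tsum_ballAverage_rpow_le_of_lt hR hlt

/-- The Fefferman–Stein inequality for a sequence of averaging operators. -/
theorem exists_lintegral_lqNorm_ballAverage_le (h : IsDoubling μ Q C) {P : ℝ} (hP : 1 < P)
    {R : ℝ≥0∞} (hR : 1 < R) :
    ∃ K : ℝ≥0, ∀ ρ : ι → ℝ, (∀ k, 0 < ρ k) → ∀ φ : ι → Z → ℝ≥0∞, (∀ k, Measurable (φ k)) →
      ∫⁻ ξ, lqNorm R (fun k => ballAverage μ (ρ k) (φ k) ξ) ^ P ∂μ ≤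
        K * ∫⁻ ξ, lqNorm R (fun k => φ k ξ) ^ P ∂μ := by
  by_cases hRt : R = ∞
  · subst hRt
    obtain ⟨c, hc⟩ := h.exists_lintegral_maximalFunction_rpow_le hP
    refine ⟨c, fun ρ hρ φ hφ => ?_⟩
    simp_rw [lqNorm_top]
    -- For $R=\infty$ every average is dominated by the maximal function of the pointwise supremum.
    refine le_trans (lintegral_mono fun ξ => ?_) (hc (fun ξ => ⨆ k, φ k ξ) (Measurable.iSup hφ))
    refine ENNReal.rpow_le_rpow (iSup_le fun k => ?_) (by linarith)
    exact (ballAverage_mono (fun η => le_iSup (fun k => φ k η) k) ξ).trans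
      (ballAverage_le_maximalFunction (hρ k) _ ξ)
  · have hR1 : 1 < R.toReal := by
      rw [← ENNReal.toReal_one]
      exact (ENNReal.toReal_lt_toReal ENNReal.one_ne_top hRt).2 hR
    obtain ⟨c, hc⟩ := h.exists_lintegral_tsum_ballAverage_rpow_le (ι := ι) hP hR1
    refine ⟨c, fun ρ hρ φ hφ => ?_⟩
    simp_rw [lqNorm_of_ne_top hRt, ← ENNReal.rpow_mul, one_div_mul_eq_div]
    exact hc ρ hρ φ hφ

end IsDoubling

/-! ### A Sobolev–Poincaré inequality with exponents below one. -/

open Filter Topology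

lemma two_zpow_neg_sub (k m : ℤ) : (2 : ℝ) ^ (-(k - m)) = 2 ^ m * 2 ^ (-k) := by
  rw [← zpow_add₀ (by norm_num)]; congr 1; ring

/-- Telescoping along points that approach `x`. -/
lemma edist_le_of_chain {M : Type*} [PseudoEMetricSpace M] {x c : M} {y : ℕ → M} {a₀ : ℝ≥0∞}
    {a b : ℕ → ℝ≥0∞} (hc : edist c (y 0) ≤ a₀ + a 0)
    (hstep : ∀ l, edist (y l) (y (l + 1)) ≤ a l + a (l + 1))
    (hlim : ∀ l, edist (y l) x ≤ a l + b l) (hb : Tendsto b atTop (𝓝 0)) :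
    edist x c ≤ a₀ + 3 * ∑' l, a l := by
  by_cases hfin : ∑' l, a l = ∞
  · rw [hfin, ENNReal.mul_top (by norm_num), add_top]; exact le_top
  have htend : Tendsto y atTop (𝓝 x) := by
    rw [tendsto_iff_edist_tendsto_0]
    refine tendsto_of_tendsto_of_tendsto_of_le_of_le tendsto_const_nhds ?_
      (fun _ => zero_le) hlim
    simpa using (ENNReal.tendsto_atTop_zero_of_tsum_ne_top hfin).add hb
  have h1 := edist_le_tsum_of_edist_le_of_tendsto₀ (fun l => a l + a (l + 1)) hstep htend
  have h2 : ∑' l, a (l + 1) ≤ ∑' l, a l :=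
    ENNReal.tsum_comp_le_tsum_of_injective (add_left_injective 1) a
  rw [ENNReal.tsum_add] at h1
  rw [edist_comm]
  calc edist c x ≤ edist c (y 0) + edist (y 0) x := edist_triangle _ _ _
    _ ≤ (a₀ + ∑' l, a l) + (∑' l, a l + ∑' l, a l) := by
        refine add_le_add (hc.trans ?_) (h1.trans ?_)
        · gcongr; exact ENNReal.le_tsum 0
        · gcongr
    _ = _ := by ring

namespace IsDoubling

variable {Z : Type*} [MetricSpace Z] [MeasurableSpace Z] {μ : Measure Z} {Q C : ℝ}

lemma ballAverage_le_mul (h : IsDoubling μ Q C) {z ξ : Z} {r ρ l : ℝ} (hr : 0 < r) (hl : 1 ≤ l)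
    (hsub : Metric.ball ξ r ⊆ Metric.ball z ρ) (hsub' : Metric.ball z ρ ⊆ Metric.ball ξ (l * r))
    (φ : Z → ℝ≥0∞) :
    ballAverage μ r φ ξ ≤ ENNReal.ofReal (C * l ^ Q) * ballAverage μ ρ φ z := by
  have hV := h.measure_ball_le hr hl hsub'
  have hV0 : μ (Metric.ball z ρ) ≠ 0 := fun h0 =>
    h.ne_zero ξ hr (measure_mono_null hsub h0)
  rw [ballAverage, ballAverage, ENNReal.div_le_iff (h.ne_zero ξ hr) (h.ne_top ξ r)]
  calc ∫⁻ η in Metric.ball ξ r, φ η ∂μ ≤ ∫⁻ η in Metric.ball z ρ, φ η ∂μ :=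
        lintegral_mono_set hsub
    _ = (∫⁻ η in Metric.ball z ρ, φ η ∂μ) / μ (Metric.ball z ρ) * μ (Metric.ball z ρ) :=
        (ENNReal.div_mul_cancel hV0 (h.ne_top z ρ)).symm
    _ ≤ (∫⁻ η in Metric.ball z ρ, φ η ∂μ) / μ (Metric.ball z ρ) *
          (ENNReal.ofReal (C * l ^ Q) * μ (Metric.ball ξ r)) := by gcongr
    _ = _ := by ring

variable [BorelSpace Z]

/-- A function is at most its mean somewhere outside any null set, applied to $\varphi^t$. This
supplies the points of the telescoping chains. -/
lemma exists_mem_ball_le_ballAverage (h : IsDoubling μ Q C) {φ : Z → ℝ≥0∞} (hφ : Measurable φ)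
    {E : Set Z} (hE : μ E = 0) (ξ : Z) {r : ℝ} (hr : 0 < r) {t : ℝ} (ht : 0 < t) :
    ∃ η ∈ Metric.ball ξ r, η ∉ E ∧
      φ η ≤ ballAverage μ r (fun x => φ x ^ t) ξ ^ (1 / t) := by
  have : IsFiniteMeasure (μ.restrict (Metric.ball ξ r)) :=
    ⟨by rw [Measure.restrict_apply_univ]; exact h.lt_top ξ r⟩
  have hne : μ.restrict (Metric.ball ξ r) ≠ 0 := by
    rw [Ne, Measure.restrict_eq_zero]; exact h.ne_zero ξ hr
  have hN : μ.restrict (Metric.ball ξ r) (E ∪ (Metric.ball ξ r)ᶜ) = 0 := by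
    refine measure_union_null (Measure.absolutelyContinuous_of_le Measure.restrict_le_self hE) ?_
    rw [Measure.restrict_apply Metric.isOpen_ball.measurableSet.compl]; simp
  obtain ⟨η, hη, hle⟩ := exists_notMem_null_le_laverage hne (hφ.pow_const t).aemeasurable hN
  rw [mem_union, not_or, notMem_compl_iff] at hη
  refine ⟨η, hη.2, hη.1, ?_⟩
  rw [setLAverage_eq] at hle
  calc φ η = (φ η ^ t) ^ (1 / t) := by
        rw [← ENNReal.rpow_mul, mul_one_div_cancel ht.ne', ENNReal.rpow_one]
    _ ≤ _ := ENNReal.rpow_le_rpow hle (by positivity)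

/-- Averages of radius $r\le\rho$ at points of $B(z,\rho)$ see only $\varphi$ on $B(z,2\rho)$, so
the global $L^1$ bound localizes. -/
lemma setLIntegral_ballAverage_le (h : IsDoubling μ Q C) {r ρ : ℝ} (hr : 0 < r) (hrρ : r ≤ ρ)
    {φ : Z → ℝ≥0∞} (hφ : Measurable φ) (z : Z) :
    ∫⁻ ξ in Metric.ball z ρ, ballAverage μ r φ ξ ∂μ ≤
      ENNReal.ofReal (C * 2 ^ Q) * ∫⁻ ξ in Metric.ball z (2 * ρ), φ ξ ∂μ := by
  have hB : MeasurableSet (Metric.ball z (2 * ρ)) := Metric.isOpen_ball.measurableSet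
  calc ∫⁻ ξ in Metric.ball z ρ, ballAverage μ r φ ξ ∂μ
      ≤ ∫⁻ ξ in Metric.ball z ρ, ballAverage μ r ((Metric.ball z (2 * ρ)).indicator φ) ξ ∂μ := by
        refine setLIntegral_mono' Metric.isOpen_ball.measurableSet fun ξ hξ => ?_
        refine ENNReal.div_le_div_right (le_of_eq ?_) _
        refine setLIntegral_congr_fun Metric.isOpen_ball.measurableSet fun η hη => ?_
        rw [indicator_of_mem]
        rw [Metric.mem_ball] at *
        linarith [dist_triangle η ξ z]
    _ ≤ ∫⁻ ξ, ballAverage μ r ((Metric.ball z (2 * ρ)).indicator φ) ξ ∂μ :=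
        setLIntegral_le_lintegral _ _
    _ ≤ ENNReal.ofReal (C * 2 ^ Q) * ∫⁻ ξ, (Metric.ball z (2 * ρ)).indicator φ ξ ∂μ :=
        h.lintegral_ballAverage_le hr (hφ.indicator hB)
    _ = _ := by rw [lintegral_indicator hB]

/-- Averages over small balls gain integrability, with a loss depending on the ratio of radii. -/
lemma setLIntegral_ballAverage_rpow_le (h : IsDoubling μ Q C) {r ρ : ℝ} (hr : 0 < r)
    (hrρ : r ≤ ρ) {φ : Z → ℝ≥0∞} (hφ : Measurable φ) (z : Z) {t : ℝ} (ht : 0 < t) (ht1 : t < 1) :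
    ∫⁻ ξ in Metric.ball z ρ, ballAverage μ r φ ξ ^ (1 / t) ∂μ ≤
      ENNReal.ofReal (C * 2 ^ Q) * ENNReal.ofReal (C * (3 * ρ / r) ^ Q) ^ (1 / t - 1) *
        μ (Metric.ball z (2 * ρ)) * ballAverage μ (2 * ρ) φ z ^ (1 / t) := by
  have hρ : 0 < ρ := hr.trans_le hrρ
  have ht' : 0 < 1 / t - 1 := by
    have := (one_lt_div ht).2 ht1
    linarith
  have h3 : 1 ≤ 3 * ρ / r := by rw [one_le_div hr]; linarith
  set A := ballAverage μ (2 * ρ) φ z with hA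
  set c := ENNReal.ofReal (C * (3 * ρ / r) ^ Q)
  -- The power $1/t$ splits as $(1/t-1)+1$: the first part is bounded uniformly by doubling, which
  -- causes the loss in $\rho/r$, and the last factor is integrated.
  have hpt : ∀ ξ ∈ Metric.ball z ρ, ballAverage μ r φ ξ ^ (1 / t) ≤
      (c * A) ^ (1 / t - 1) * ballAverage μ r φ ξ := fun ξ hξ => by
    rw [Metric.mem_ball] at hξ
    have h1 : ballAverage μ r φ ξ ≤ c * A := by
      refine h.ballAverage_le_mul hr h3 (Metric.ball_subset_ball' (by linarith)) ?_ φ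
      rw [div_mul_cancel₀ _ hr.ne']
      exact Metric.ball_subset_ball' (by rw [dist_comm]; linarith)
    calc ballAverage μ r φ ξ ^ (1 / t)
        = ballAverage μ r φ ξ ^ (1 / t - 1) * ballAverage μ r φ ξ ^ (1 : ℝ) := by
          rw [← ENNReal.rpow_add_of_nonneg _ _ ht'.le zero_le_one]; congr 1; ring
      _ ≤ _ := by rw [ENNReal.rpow_one]; gcongr
  calc ∫⁻ ξ in Metric.ball z ρ, ballAverage μ r φ ξ ^ (1 / t) ∂μ
      ≤ ∫⁻ ξ in Metric.ball z ρ, (c * A) ^ (1 / t - 1) * ballAverage μ r φ ξ ∂μ :=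
        setLIntegral_mono' Metric.isOpen_ball.measurableSet hpt
    _ = (c * A) ^ (1 / t - 1) * ∫⁻ ξ in Metric.ball z ρ, ballAverage μ r φ ξ ∂μ :=
        lintegral_const_mul _ (h.measurable_ballAverage r hφ)
    _ ≤ (c * A) ^ (1 / t - 1) *
          (ENNReal.ofReal (C * 2 ^ Q) * (A * μ (Metric.ball z (2 * ρ)))) := by
        refine mul_le_mul_right ((h.setLIntegral_ballAverage_le hr hrρ hφ z).trans ?_) _
        rw [hA, ballAverage, ENNReal.div_mul_cancel (h.ne_zero z (by linarith)) (h.ne_top z _)]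
    _ = ENNReal.ofReal (C * 2 ^ Q) * c ^ (1 / t - 1) * μ (Metric.ball z (2 * ρ)) *
          (A ^ (1 / t - 1) * A ^ (1 : ℝ)) := by
        rw [ENNReal.mul_rpow_of_nonneg _ _ ht'.le, ENNReal.rpow_one]; ring
    _ = _ := by
        rw [← ENNReal.rpow_add_of_nonneg _ _ ht'.le zero_le_one]; congr 2; ring

/-- A Sobolev–Poincaré inequality for functions with oscillation controlled at every dyadic scale:
the `L¹` oscillation is controlled by `L^t` averages with `t < 1`. -/
theorem exists_setLIntegral_enorm_sub_le (h : IsDoubling μ Q C) {t : ℝ} (ht : 0 < t)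
    (ht1 : t < 1) :
    ∃ K : ℝ≥0, ∀ (f : Z → ℂ) (E : Set Z) (T : ℤ → Z → ℝ≥0∞), μ E = 0 → (∀ j, Measurable (T j)) →
      (∀ ξ, Antitone fun j => T j ξ) →
      (∀ (j : ℤ) (ξ η : Z), ξ ∉ E → η ∉ E → dist ξ η < (2 : ℝ) ^ (-j) →
        ‖f ξ - f η‖ₑ ≤ T j ξ + T j η) →
      (∀ᵐ ξ ∂μ, ∀ k : ℤ, Tendsto (fun l : ℕ => T (k + l) ξ) atTop (𝓝 0)) →
      ∀ (z : Z) (k : ℤ), ∃ c : ℂ, ∫⁻ ξ in Metric.ball z ((2 : ℝ) ^ (-k)), ‖f ξ - c‖ₑ ∂μ ≤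
        K * μ (Metric.ball z (2 * (2 : ℝ) ^ (-k))) *
          ∑' l : ℕ, (2 : ℝ≥0∞) ^ ((l : ℝ) * (Q * (1 / t - 1))) *
            ballAverage μ (2 * (2 : ℝ) ^ (-k)) (fun ξ => T (k + l - 2) ξ ^ t) z ^ (1 / t) := by
  have ht' : 0 < 1 / t - 1 := by
    have := (one_lt_div ht).2 ht1
    linarith
  set c₁ := ENNReal.ofReal (C * 2 ^ Q) with hc₁
  set c₂ := ENNReal.ofReal (C * 3 ^ Q) with hc₂
  have hK : c₁ ^ (1 / t) + 3 * (c₁ * c₂ ^ (1 / t - 1)) ≠ ∞ := by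
    refine ENNReal.add_ne_top.2 ⟨ENNReal.rpow_ne_top_of_nonneg (by positivity)
      ENNReal.ofReal_ne_top, ENNReal.mul_ne_top (by norm_num) (ENNReal.mul_ne_top
      ENNReal.ofReal_ne_top (ENNReal.rpow_ne_top_of_nonneg ht'.le ENNReal.ofReal_ne_top))⟩
  refine ⟨(c₁ ^ (1 / t) + 3 * (c₁ * c₂ ^ (1 / t - 1))).toNNReal,
    fun f E T hE hT hanti hosc hlim z k => ?_⟩
  rw [ENNReal.coe_toNNReal hK]
  have hpos : ∀ j : ℤ, (0 : ℝ) < 2 ^ (-j) := fun j => by positivity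
  set V := μ (Metric.ball z (2 * (2 : ℝ) ^ (-k))) with hV
  set A : ℕ → ℝ≥0∞ := fun l =>
    ballAverage μ (2 * (2 : ℝ) ^ (-k)) (fun ξ => T (k + l - 2) ξ ^ t) z with hA
  let a : ℕ → Z → ℝ≥0∞ := fun l ξ =>
    ballAverage μ ((2 : ℝ) ^ (-(k + l))) (fun ξ => T (k + l - 2) ξ ^ t) ξ ^ (1 / t)
  set a₀ : ℝ≥0∞ :=
    ballAverage μ ((2 : ℝ) ^ (-k)) (fun ξ => T (k - 2) ξ ^ t) z ^ (1 / t) with ha₀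
  obtain ⟨ζ, hζB, hζE, hζ⟩ :=
    h.exists_mem_ball_le_ballAverage (hT (k - 2)) hE z (hpos k) ht
  refine ⟨f ζ, ?_⟩
  have hpt : ∀ᵐ ξ ∂μ, ξ ∈ Metric.ball z ((2 : ℝ) ^ (-k)) →
      ‖f ξ - f ζ‖ₑ ≤ a₀ + 3 * ∑' l, a l ξ := by
    have hE' : ∀ᵐ ξ ∂μ, ξ ∉ E := measure_eq_zero_iff_ae_notMem.1 hE
    filter_upwards [hlim, hE'] with ξ hξlim hξE hξB
    -- The points depend on `ξ`, but only through the measurable bounds `a l ξ`; no measurable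
    -- selection is needed.
    choose y hyB hyE hy using fun l : ℕ =>
      h.exists_mem_ball_le_ballAverage (hT (k + l - 2)) hE ξ (hpos (k + l)) ht
    simp only [Metric.mem_ball] at hyB hζB hξB
    rw [← edist_eq_enorm_sub]
    refine edist_le_of_chain (y := fun l => f (y l)) (a := fun l => a l ξ)
      (b := fun l => T (k + l) ξ) ?_ (fun l => ?_) (fun l => ?_) (hξlim k)
    · rw [edist_eq_enorm_sub]
      have h0 := hy 0
      have hB0 := hyB 0
      simp only [Nat.cast_zero, add_zero] at h0 hB0
      refine (hosc (k - 2) ζ (y 0) hζE (hyE 0) ?_).trans (add_le_add hζ ?_)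
      -- The path from `ζ` to `y 0` through `z` and `ξ` is shorter than $3\cdot2^{-k}<2^{-(k-2)}$;
      -- this is the origin of the shift by $2$.
      · rw [two_zpow_neg_sub]
        have h1 := dist_triangle ζ z (y 0)
        have h2 := dist_triangle_right z (y 0) ξ
        rw [dist_comm z ξ] at h2
        rw [show (2 : ℝ) ^ (2 : ℤ) = 4 by norm_num]
        linarith [hpos k]
      · simpa [a] using h0
    · rw [edist_eq_enorm_sub]
      -- The two points are within $2\cdot2^{-(k+l)}$, which is scale $k+l-1$. This index is the one
      -- attached to `y (l + 1)`, and it exceeds the one attached to `y l` by one.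
      refine (hosc (k + l - 1) (y l) (y (l + 1)) (hyE l) (hyE _) ?_).trans
        (add_le_add ((hanti _ (by omega)).trans (hy l)) ((hanti _ ?_).trans (hy (l + 1))))
      · have h1 := hyB l
        have h2 := hyB (l + 1)
        have h3 := dist_triangle_right (y l) (y (l + 1)) ξ
        have h4 : (2 : ℝ) ^ (-(k + ((l + 1 : ℕ) : ℤ))) ≤ 2 ^ (-(k + (l : ℤ))) :=
          zpow_le_zpow_right₀ (by norm_num) (by push_cast; omega)
        rw [two_zpow_neg_sub, zpow_one]
        linarith
      · push_cast; omega
    · rw [edist_eq_enorm_sub]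
      refine (hosc (k + l) (y l) ξ (hyE l) hξE (hyB l)).trans ?_
      gcongr
      exact (hanti _ (by omega)).trans (hy l)
  have ham : ∀ l, Measurable (a l) := fun l =>
    (h.measurable_ballAverage _ ((hT _).pow_const t)).pow_const _
  have hterm : ∀ l : ℕ, ∫⁻ ξ in Metric.ball z ((2 : ℝ) ^ (-k)), a l ξ ∂μ ≤
      c₁ * c₂ ^ (1 / t - 1) * V *
        ((2 : ℝ≥0∞) ^ ((l : ℝ) * (Q * (1 / t - 1))) * A l ^ (1 / t)) := fun l => by
    refine (h.setLIntegral_ballAverage_rpow_le (hpos (k + l))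
      (zpow_le_zpow_right₀ (by norm_num) (by omega)) ((hT _).pow_const t) z ht ht1).trans
      (le_of_eq ?_)
    have h1 : 3 * (2 : ℝ) ^ (-k) / 2 ^ (-(k + (l : ℤ))) = 3 * 2 ^ (l : ℝ) := by
      rw [mul_div_assoc, ← zpow_sub₀ (by norm_num)]
      congr 1
      rw [← Real.rpow_intCast]; congr 1; push_cast; ring
    have h2 : ENNReal.ofReal (C * (3 * (2 : ℝ) ^ (-k) / 2 ^ (-(k + (l : ℤ)))) ^ Q) ^ (1 / t - 1)
        = c₂ ^ (1 / t - 1) * 2 ^ ((l : ℝ) * (Q * (1 / t - 1))) := by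
      have hC : 0 ≤ C := zero_le_one.trans h.one_le
      rw [h1, Real.mul_rpow (by norm_num) (by positivity), ← Real.rpow_mul (by norm_num),
        ← mul_assoc, ENNReal.ofReal_mul (by positivity), ENNReal.ofReal_two_rpow,
        ENNReal.mul_rpow_of_nonneg _ _ ht'.le, ← ENNReal.rpow_mul, mul_assoc]
    rw [h2]
    simp only [hA, hV]
    ring
  have hzero : a₀ * μ (Metric.ball z ((2 : ℝ) ^ (-k))) ≤ c₁ ^ (1 / t) * V *
      ∑' l : ℕ, (2 : ℝ≥0∞) ^ ((l : ℝ) * (Q * (1 / t - 1))) * A l ^ (1 / t) := by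
    have h1 : a₀ ≤ c₁ ^ (1 / t) * A 0 ^ (1 / t) := by
      rw [← ENNReal.mul_rpow_of_nonneg _ _ (by positivity)]
      refine ENNReal.rpow_le_rpow ?_ (by positivity)
      simp only [hA, Nat.cast_zero, add_zero]
      exact h.ballAverage_le_mul (hpos k) (by norm_num)
        (Metric.ball_subset_ball (by linarith [hpos k])) subset_rfl _
    have h2 : μ (Metric.ball z ((2 : ℝ) ^ (-k))) ≤ V :=
      measure_mono (Metric.ball_subset_ball (by linarith [hpos k]))
    have h3 : A 0 ^ (1 / t) ≤
        ∑' l : ℕ, (2 : ℝ≥0∞) ^ ((l : ℝ) * (Q * (1 / t - 1))) * A l ^ (1 / t) := by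
      refine le_trans (le_of_eq ?_) (ENNReal.le_tsum 0)
      simp
    calc _ ≤ c₁ ^ (1 / t) * A 0 ^ (1 / t) * V := by gcongr
      _ = c₁ ^ (1 / t) * V * A 0 ^ (1 / t) := by ring
      _ ≤ _ := by gcongr
  calc ∫⁻ ξ in Metric.ball z ((2 : ℝ) ^ (-k)), ‖f ξ - f ζ‖ₑ ∂μ
      ≤ ∫⁻ ξ in Metric.ball z ((2 : ℝ) ^ (-k)), (a₀ + 3 * ∑' l, a l ξ) ∂μ :=
        setLIntegral_mono_ae' Metric.isOpen_ball.measurableSet hpt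
    _ = a₀ * μ (Metric.ball z ((2 : ℝ) ^ (-k))) +
          3 * ∑' l, ∫⁻ ξ in Metric.ball z ((2 : ℝ) ^ (-k)), a l ξ ∂μ := by
        rw [lintegral_add_left measurable_const, setLIntegral_const,
          lintegral_const_mul _ (Measurable.tsum ham), lintegral_tsum fun l => (ham l).aemeasurable]
    _ ≤ c₁ ^ (1 / t) * V *
          ∑' l : ℕ, (2 : ℝ≥0∞) ^ ((l : ℝ) * (Q * (1 / t - 1))) * A l ^ (1 / t) +
        3 * ∑' l : ℕ, c₁ * c₂ ^ (1 / t - 1) * V *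
          ((2 : ℝ≥0∞) ^ ((l : ℝ) * (Q * (1 / t - 1))) * A l ^ (1 / t)) := by
        gcongr with l
        exact hterm l
    _ = _ := by rw [ENNReal.tsum_mul_left]; ring

end IsDoubling

/-! ### Tails of fractional Hajłasz gradients and the Poincaré inequality for them. -/

/-- The oscillation at scale `2^{-j}` given by a fractional Hajłasz gradient. -/
def hajlaszTail {Z : Type*} (s : ℝ) (g : ℤ → Z → ℝ≥0∞) (j : ℤ) (ξ : Z) : ℝ≥0∞ :=
  2 ^ (-((j : ℝ) * s)) * expTail s (fun i => g i ξ) j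

section hajlaszTail

variable {Z : Type*} {s : ℝ} {g : ℤ → Z → ℝ≥0∞}

lemma hajlaszTail_eq_tsum (j : ℤ) (ξ : Z) :
    hajlaszTail s g j ξ = ∑' l : ℕ, 2 ^ (-(((j + l : ℤ) : ℝ) * s)) * g (j + l) ξ := by
  rw [hajlaszTail, expTail, ← ENNReal.tsum_mul_left]
  refine tsum_congr fun l => ?_
  rw [← mul_assoc, ← ENNReal.two_rpow_add]
  push_cast
  congr 2; ring

lemma term_le_hajlaszTail {i j : ℤ} (hij : j ≤ i) (ξ : Z) :
    2 ^ (-((i : ℝ) * s)) * g i ξ ≤ hajlaszTail s g j ξ := by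
  rw [hajlaszTail_eq_tsum]
  obtain ⟨l, rfl⟩ := Int.le.dest hij
  exact ENNReal.le_tsum (f := fun l : ℕ => 2 ^ (-(((j + l : ℤ) : ℝ) * s)) * g (j + l) ξ) l

lemma antitone_hajlaszTail (ξ : Z) : Antitone fun j => hajlaszTail s g j ξ := by
  refine antitone_int_of_succ_le fun j => ?_
  rw [hajlaszTail_eq_tsum, hajlaszTail_eq_tsum]
  refine le_trans (le_of_eq ?_) (ENNReal.tsum_comp_le_tsum_of_injective (add_left_injective 1) _)
  refine tsum_congr fun l => ?_
  have : j + 1 + (l : ℤ) = j + ((l + 1 : ℕ) : ℤ) := by push_cast; ring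
  rw [this]

lemma tendsto_hajlaszTail {ξ : Z} {k : ℤ} (hfin : hajlaszTail s g k ξ ≠ ∞) :
    Tendsto (fun l : ℕ => hajlaszTail s g (k + l) ξ) atTop (𝓝 0) := by
  rw [hajlaszTail_eq_tsum] at hfin
  refine (ENNReal.tendsto_sum_nat_add _ hfin).congr fun n => ?_
  rw [hajlaszTail_eq_tsum]
  refine tsum_congr fun l => ?_
  have : k + ((l + n : ℕ) : ℤ) = k + n + l := by push_cast; ring
  rw [this]

lemma hajlaszTail_ne_top (hs : 0 < s) {ξ : Z} {N : ℝ≥0∞} (hN : N ≠ ∞) (hg : ∀ i, g i ξ ≤ N)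
    (k : ℤ) : hajlaszTail s g k ξ ≠ ∞ := by
  refine ENNReal.mul_ne_top (ENNReal.two_rpow_ne_top _) ?_
  have : expTail s (fun i => g i ξ) k ≤ (∑' l : ℕ, (2 : ℝ≥0∞) ^ (-((l : ℝ) * s))) * N := by
    rw [← ENNReal.tsum_mul_right]
    exact ENNReal.tsum_le_tsum fun _ => by gcongr; exact hg _
  exact ne_top_of_le_ne_top (ENNReal.mul_ne_top (ENNReal.tsum_two_rpow_ne_top hs) hN) this

/-- Subadditivity of $x\mapsto x^t$ gives a bound linear in $(g_i^t)$, which commutes with averages.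
-/
lemma hajlaszTail_rpow_le {t : ℝ} (ht : 0 < t) (ht1 : t ≤ 1) (j : ℤ) (ξ : Z) :
    hajlaszTail s g j ξ ^ t ≤
      2 ^ (-((j : ℝ) * (s * t))) * expTail (s * t) (fun i => g i ξ ^ t) j := by
  rw [hajlaszTail, ENNReal.mul_rpow_of_nonneg _ _ ht.le, ← ENNReal.rpow_mul, neg_mul, mul_assoc]
  gcongr
  refine (ENNReal.rpow_tsum_le_tsum_rpow _ ht ht1).trans (le_of_eq (tsum_congr fun l => ?_))
  rw [ENNReal.mul_rpow_of_nonneg _ _ ht.le, ← ENNReal.rpow_mul]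
  congr 2; ring

variable [MeasurableSpace Z]

lemma measurable_expTail {d : ℝ} {φ : ℤ → Z → ℝ≥0∞} (hφ : ∀ k, Measurable (φ k)) (k : ℤ) :
    Measurable fun ξ => expTail d (fun i => φ i ξ) k :=
  Measurable.tsum fun _ => (hφ _).const_mul _

lemma ballAverage_expTail {Z : Type*} [MetricSpace Z] [MeasurableSpace Z] {μ : Measure Z}
    {d : ℝ} {φ : ℤ → Z → ℝ≥0∞} (hφ : ∀ k, Measurable (φ k)) (r : ℝ) (k : ℤ) (z : Z) :
    ballAverage μ r (fun ξ => expTail d (fun i => φ i ξ) k) z =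
      expTail d (fun i => ballAverage μ r (φ i) z) k := by
  simp only [ballAverage, expTail]
  rw [lintegral_tsum fun l => ((hφ _).const_mul _).aemeasurable, div_eq_mul_inv,
    ← ENNReal.tsum_mul_right]
  refine tsum_congr fun l => ?_
  rw [lintegral_const_mul _ (hφ _), div_eq_mul_inv, mul_assoc]

lemma measurable_hajlaszTail (hg : ∀ k, Measurable (g k)) (j : ℤ) :
    Measurable (hajlaszTail s g j) :=
  (measurable_expTail hg j).const_mul _

end hajlaszTail

/-- Distinct points closer than $2^{-j}$ have their distance in a single dyadic annulus of some
index $i\ge j$, and $g_i$ alone controls the difference. -/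
lemma enorm_sub_le_hajlaszTail {Z : Type*} [MetricSpace Z] {s : ℝ} (hs : 0 < s) {f : Z → ℂ}
    {g : ℤ → Z → ℝ≥0∞} {E : Set Z}
    (hg : ∀ (k : ℤ) (ξ η : Z), ξ ∉ E → η ∉ E →
      (2 : ℝ) ^ (-k - 1) ≤ dist ξ η → dist ξ η < (2 : ℝ) ^ (-k) →
        ‖f ξ - f η‖ₑ ≤ ENNReal.ofReal (dist ξ η ^ s) * (g k ξ + g k η))
    (j : ℤ) (ξ η : Z) (hξ : ξ ∉ E) (hη : η ∉ E) (hd : dist ξ η < (2 : ℝ) ^ (-j)) :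
    ‖f ξ - f η‖ₑ ≤ hajlaszTail s g j ξ + hajlaszTail s g j η := by
  rcases eq_or_ne ξ η with rfl | hne
  · simp
  obtain ⟨n, hn⟩ := exists_mem_Ico_zpow (dist_pos.2 hne) (y := (2 : ℝ)) (by norm_num)
  set i : ℤ := -n - 1 with hi
  have h1 : (2 : ℝ) ^ (-i - 1) ≤ dist ξ η := by
    have : -i - 1 = n := by omega
    rw [this]; exact hn.1
  have h2 : dist ξ η < (2 : ℝ) ^ (-i) := by
    have : -i = n + 1 := by omega
    rw [this]; exact hn.2
  have hji : j ≤ i := by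
    have := (zpow_lt_zpow_iff_right₀ (by norm_num : (1 : ℝ) < 2)).1 (hn.1.trans_lt hd)
    omega
  have h3 : ENNReal.ofReal (dist ξ η ^ s) ≤ 2 ^ (-((i : ℝ) * s)) := by
    rw [← ENNReal.ofReal_two_rpow]
    refine ENNReal.ofReal_le_ofReal ?_
    calc dist ξ η ^ s ≤ ((2 : ℝ) ^ (-i)) ^ s := Real.rpow_le_rpow dist_nonneg h2.le hs.le
      _ = _ := by
        rw [← Real.rpow_intCast, ← Real.rpow_mul (by norm_num)]; push_cast; congr 1; ring
  calc ‖f ξ - f η‖ₑ ≤ ENNReal.ofReal (dist ξ η ^ s) * (g i ξ + g i η) := hg i ξ η hξ hη h1 h2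
    _ ≤ 2 ^ (-((i : ℝ) * s)) * (g i ξ + g i η) := by gcongr
    _ = 2 ^ (-((i : ℝ) * s)) * g i ξ + 2 ^ (-((i : ℝ) * s)) * g i η := by ring
    _ ≤ _ := add_le_add (term_le_hajlaszTail hji ξ) (term_le_hajlaszTail hji η)

/-- The loss $2^{lQ(1/t-1)}$ meets the decay $2^{-(k+l)s}$ of the tails. After raising to the power
$t$, the sum over scales is a second exponential tail, of rate $(s-Q(1/t-1))t$, and moves inside the
average. -/
lemma IsDoubling.exists_hajlasz_poincare {Z : Type*} [MetricSpace Z] [MeasurableSpace Z]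
    [BorelSpace Z] {μ : Measure Z} {Q C : ℝ} (h : IsDoubling μ Q C) {s t : ℝ} (hs : 0 < s)
    (ht : 0 < t) (ht1 : t < 1) :
    ∃ K : ℝ≥0, ∀ (f : Z → ℂ) (g : ℤ → Z → ℝ≥0∞), (∀ k, Measurable (g k)) →
      IsHajlaszGradient μ s f g → (∀ᵐ ξ ∂μ, ∃ N ≠ ∞, ∀ k, g k ξ ≤ N) →
      ∀ (z : Z) (k : ℤ), ∃ c : ℂ,
        (2 ^ ((k : ℝ) * s) * ((∫⁻ ξ in Metric.ball z ((2 : ℝ) ^ (-k)), ‖f ξ - c‖ₑ ∂μ) /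
          μ (Metric.ball z (2 * (2 : ℝ) ^ (-k))))) ^ t ≤
        K * ballAverage μ (2 * (2 : ℝ) ^ (-k)) (fun ξ =>
          expTail ((s - Q * (1 / t - 1)) * t)
            (expTail (s * t) (fun i => g i ξ ^ t)) (k - 2)) z := by
  obtain ⟨K, hK⟩ := h.exists_setLIntegral_enorm_sub_le ht ht1
  have hc : (K : ℝ≥0∞) ^ t * 2 ^ (2 * (s * t)) ≠ ∞ :=
    ENNReal.mul_ne_top (ENNReal.rpow_ne_top_of_nonneg ht.le ENNReal.coe_ne_top)
      (ENNReal.two_rpow_ne_top _)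
  refine ⟨((K : ℝ≥0∞) ^ t * 2 ^ (2 * (s * t))).toNNReal, fun f g hgm hg hfin z k => ?_⟩
  rw [ENNReal.coe_toNNReal hc]
  obtain ⟨-, E, -, hE, hEg⟩ := hg
  obtain ⟨c, hc⟩ := hK f E (hajlaszTail s g) hE (measurable_hajlaszTail hgm) antitone_hajlaszTail
    (enorm_sub_le_hajlaszTail hs hEg) (by
      filter_upwards [hfin] with ξ ⟨N, hN, hgN⟩ k
      exact tendsto_hajlaszTail (hajlaszTail_ne_top hs hN hgN k)) z k
  refine ⟨c, ?_⟩
  have hr : (0 : ℝ) < 2 * 2 ^ (-k) := by positivity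
  set V := μ (Metric.ball z (2 * (2 : ℝ) ^ (-k))) with hV
  have hV0 : V ≠ 0 := h.ne_zero z hr
  have hVt : V ≠ ∞ := h.ne_top z _
  set e := Q * (1 / t - 1) with he
  have hψ : ∀ j, Measurable fun ξ => expTail (s * t) (fun i => g i ξ ^ t) j := fun j =>
    measurable_expTail (fun i => (hgm i).pow_const t) j
  have hdiv : (∫⁻ ξ in Metric.ball z ((2 : ℝ) ^ (-k)), ‖f ξ - c‖ₑ ∂μ) / V ≤
      K * ∑' l : ℕ, (2 : ℝ≥0∞) ^ ((l : ℝ) * e) *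
            ballAverage μ (2 * (2 : ℝ) ^ (-k)) (fun ξ => hajlaszTail s g (k + l - 2) ξ ^ t) z ^
              (1 / t) := by
    rw [ENNReal.div_le_iff hV0 hVt]
    exact hc.trans (le_of_eq (by ring))
  calc (2 ^ ((k : ℝ) * s) * ((∫⁻ ξ in Metric.ball z ((2 : ℝ) ^ (-k)), ‖f ξ - c‖ₑ ∂μ) / V)) ^ t
      ≤ (2 ^ ((k : ℝ) * s) * (K * ∑' l : ℕ, (2 : ℝ≥0∞) ^ ((l : ℝ) * e) *
            ballAverage μ (2 * (2 : ℝ) ^ (-k)) (fun ξ => hajlaszTail s g (k + l - 2) ξ ^ t) z ^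
              (1 / t))) ^ t := by gcongr
    _ ≤ 2 ^ ((k : ℝ) * (s * t)) * ((K : ℝ≥0∞) ^ t * ∑' l : ℕ, (2 : ℝ≥0∞) ^ ((l : ℝ) * e * t) *
            ballAverage μ (2 * (2 : ℝ) ^ (-k))
              (fun ξ => hajlaszTail s g (k + l - 2) ξ ^ t) z) := by
        rw [ENNReal.mul_rpow_of_nonneg _ _ ht.le, ENNReal.mul_rpow_of_nonneg _ _ ht.le,
          ← ENNReal.rpow_mul, mul_assoc]
        gcongr
        refine (ENNReal.rpow_tsum_le_tsum_rpow _ ht ht1.le).trans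
          (le_of_eq (tsum_congr fun l => ?_))
        rw [ENNReal.mul_rpow_of_nonneg _ _ ht.le, ← ENNReal.rpow_mul, ← ENNReal.rpow_mul,
          one_div_mul_cancel ht.ne', ENNReal.rpow_one]
    _ ≤ 2 ^ ((k : ℝ) * (s * t)) * ((K : ℝ≥0∞) ^ t * ∑' l : ℕ, (2 : ℝ≥0∞) ^ ((l : ℝ) * e * t) *
            (2 ^ (-(((k + l - 2 : ℤ) : ℝ) * (s * t))) * ballAverage μ (2 * (2 : ℝ) ^ (-k))
              (fun ξ => expTail (s * t) (fun i => g i ξ ^ t) (k + l - 2)) z)) := by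
        gcongr with l
        refine (ballAverage_mono (fun ξ => hajlaszTail_rpow_le ht ht1.le _ ξ) z).trans
          (le_of_eq ?_)
        simp only [ballAverage]
        rw [lintegral_const_mul _ (hψ _), mul_div_assoc]
    _ = (K : ℝ≥0∞) ^ t * 2 ^ (2 * (s * t)) * ∑' l : ℕ, (2 : ℝ≥0∞) ^ (-((l : ℝ) * ((s - e) * t))) *
            ballAverage μ (2 * (2 : ℝ) ^ (-k))
              (fun ξ => expTail (s * t) (fun i => g i ξ ^ t) (k - 2 + l)) z := by
        simp_rw [← ENNReal.tsum_mul_left]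
        refine tsum_congr fun l => ?_
        have h1 : (2 : ℝ≥0∞) ^ ((k : ℝ) * (s * t)) * 2 ^ ((l : ℝ) * e * t) *
            2 ^ (-(((k + l - 2 : ℤ) : ℝ) * (s * t))) =
            2 ^ (2 * (s * t)) * 2 ^ (-((l : ℝ) * ((s - e) * t))) := by
          rw [← ENNReal.two_rpow_add, ← ENNReal.two_rpow_add, ← ENNReal.two_rpow_add]
          push_cast; congr 1; ring
        have h2 : k + (l : ℤ) - 2 = k - 2 + l := by ring
        rw [mul_assoc ((K : ℝ≥0∞) ^ t), ← mul_assoc (2 ^ (2 * (s * t))), ← h1, h2]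
        ring
    _ = _ := by
        congr 1
        exact (ballAverage_expTail hψ _ _ _).symm

/-! ### Geometry of the filling: counting vertices and estimating the discrete derivative. -/

/-- Separated sets have boundedly many points in balls of comparable radius. -/
lemma IsDoubling.encard_le_of_separated {Z : Type*} [MetricSpace Z] [MeasurableSpace Z]
    [BorelSpace Z] {μ : Measure Z} {Q C : ℝ} (h : IsDoubling μ Q C) {A : Set Z} {r a : ℝ}
    (hr : 0 < r) (ha : 0 < a) (hA : A.Pairwise fun x y => r ≤ dist x y) {ξ : Z}
    (hAξ : ∀ x ∈ A, dist x ξ < a * r) :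
    (A.encard : ℝ≥0∞) ≤ ENNReal.ofReal (C * (4 * a + 1) ^ Q) := by
  set W := Metric.ball ξ (a * r + r / 2) with hW
  have hW0 : μ W ≠ 0 := h.ne_zero ξ (by positivity)
  have hdisj : Pairwise (Function.onFun Disjoint fun x : A => Metric.ball (x : Z) (r / 2)) :=
    fun x y hxy => Metric.ball_disjoint_ball (by
      have := hA x.2 y.2 (fun e => hxy (Subtype.ext e)); linarith)
  -- The balls $B(x,r/2)$ are disjoint and lie in $W$, while $W\subseteq B(x,(4a+1)r/2)$; doubling
  -- therefore bounds their number.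
  have h1 : (A.encard : ℝ≥0∞) * μ W ≤ ENNReal.ofReal (C * (4 * a + 1) ^ Q) * μ W :=
    calc (A.encard : ℝ≥0∞) * μ W = ∑' _ : A, μ W := by
          rw [← ENNReal.tsum_set_one, ← ENNReal.tsum_mul_right]; simp
      _ ≤ ∑' x : A, ENNReal.ofReal (C * (4 * a + 1) ^ Q) * μ (Metric.ball (x : Z) (r / 2)) := by
          refine ENNReal.tsum_le_tsum fun x =>
            h.measure_ball_le (by positivity) (by linarith) (Metric.ball_subset_ball' ?_)
          have := hAξ x x.2
          rw [dist_comm] at this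
          nlinarith
      _ = ENNReal.ofReal (C * (4 * a + 1) ^ Q) * ∑' x : A, μ (Metric.ball (x : Z) (r / 2)) :=
          ENNReal.tsum_mul_left
      _ ≤ ENNReal.ofReal (C * (4 * a + 1) ^ Q) * μ W := by
          gcongr
          refine (tsum_meas_le_meas_iUnion_of_disjoint μ
            (fun x => Metric.isOpen_ball.measurableSet) hdisj).trans (measure_mono ?_)
          refine iUnion_subset fun x => Metric.ball_subset_ball' ?_
          linarith [hAξ x x.2]
  exact (ENNReal.mul_le_mul_iff_left hW0 (h.ne_top ξ _)).1 h1

lemma enorm_setAverage_sub_le {Z : Type*} [MeasurableSpace Z] {μ : Measure Z} {f : Z → ℂ} {S : Set Z}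
    (h0 : μ S ≠ 0) (ht : μ S ≠ ∞) (hf : IntegrableOn f S μ) (c : ℂ) :
    ‖(⨍ η in S, f η ∂μ) - c‖ₑ ≤ (∫⁻ η in S, ‖f η - c‖ₑ ∂μ) / μ S := by
  have hr : μ.real S ≠ 0 := by
    rw [Measure.real, ENNReal.toReal_ne_zero]; exact ⟨h0, ht⟩
  have hc : IntegrableOn (fun _ => c) S μ := integrableOn_const ht
  have h1 : (⨍ η in S, f η ∂μ) - c = (μ.real S)⁻¹ • ∫ η in S, (f η - c) ∂μ := by
    rw [setAverage_eq, integral_sub hf hc, setIntegral_const, smul_sub, smul_smul,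
      inv_mul_cancel₀ hr, one_smul]
  rw [h1, enorm_smul, ENNReal.div_eq_inv_mul]
  gcongr
  · rw [Real.enorm_eq_ofReal (by positivity), ENNReal.ofReal_inv_of_pos
      (lt_of_le_of_ne measureReal_nonneg hr.symm), Measure.real, ENNReal.ofReal_toReal ht]
  · exact enorm_integral_le_lintegral_enorm _

namespace HyperbolicFilling

section Metric

variable {Z : Type*} [MetricSpace Z] {X : HyperbolicFilling Z}

lemma net_pairwise (X : HyperbolicFilling Z) (n : ℤ) :
    (X.net n).Pairwise fun x y => (2 : ℝ) ^ (-n - 1) ≤ dist x y := by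
  by_cases hb : Bornology.IsBounded (univ : Set Z)
  · obtain ⟨⟨z, hz⟩, hneg, hpos⟩ := X.net_bounded hb
    rcases lt_trichotomy n 0 with hn | rfl | hn
    · rw [hneg n hn]; exact Set.pairwise_empty _
    · rw [hz]; exact Set.pairwise_singleton _ _
    · exact (hpos n hn).prop
  · exact (X.net_unbounded hb n).prop

lemma ball_center_subset (x : X.Vertex) :
    Metric.ball (center x) ((2 : ℝ) ^ (-level x)) ⊆ ball x := by
  unfold ball
  split_ifs
  · exact subset_univ _
  · exact subset_rfl

lemma center_mem_ball (x : X.Vertex) : center x ∈ ball x :=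
  ball_center_subset x (Metric.mem_ball_self (by positivity))

lemma isOpen_ball (x : X.Vertex) : IsOpen (ball x) := by
  unfold ball
  split_ifs
  · exact isOpen_univ
  · exact Metric.isOpen_ball

/-- The balls of the neighbors of a vertex are contained in a fixed dilation of its ball. -/
lemma exists_ball_subset (Z : Type*) [MetricSpace Z] :
    ∃ m : ℕ, ∀ (X : HyperbolicFilling Z) (x y : X.Vertex), y = x ∨ X.graph.Adj x y →
      ball y ⊆ Metric.ball (center x) ((2 : ℝ) ^ (-(level x - m))) := by
  have key : ∀ (X : HyperbolicFilling Z) (x y : X.Vertex), (y = x ∨ X.graph.Adj x y) →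
      ball y = Metric.ball (center y) ((2 : ℝ) ^ (-level y)) →
      ball x = Metric.ball (center x) ((2 : ℝ) ^ (-level x)) → ∀ m : ℕ, 3 ≤ m →
      ball y ⊆ Metric.ball (center x) ((2 : ℝ) ^ (-(level x - m))) := by
    intro X x y hxy hy hx m hm
    have hpos : (0 : ℝ) < 2 ^ (-level x) := by positivity
    -- Neighboring centers are within $3\cdot2^{-|x|}$ and the neighbor's radius is at most
    -- $2\cdot2^{-|x|}$, so $8=2^3$ suffices.
    have h8 : 8 * (2 : ℝ) ^ (-level x) ≤ 2 ^ (-(level x - m)) := by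
      rw [two_zpow_neg_sub]
      gcongr
      calc (8 : ℝ) = 2 ^ (3 : ℤ) := by norm_num
        _ ≤ 2 ^ (m : ℤ) := zpow_le_zpow_right₀ (by norm_num) (by exact_mod_cast hm)
    rw [hy]
    rcases hxy with rfl | hxy
    · exact Metric.ball_subset_ball (by linarith)
    · obtain ⟨-, hlev, w, hwx, hwy⟩ := hxy
      rw [hx, Metric.mem_ball] at hwx
      rw [hy, Metric.mem_ball] at hwy
      have hly : (2 : ℝ) ^ (-level y) ≤ 2 * 2 ^ (-level x) := by
        have : (2 : ℝ) ^ (-(level x - 1)) = 2 * 2 ^ (-level x) := by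
          rw [two_zpow_neg_sub, zpow_one]
        rw [← this]
        rw [abs_le] at hlev
        exact zpow_le_zpow_right₀ (by norm_num) (by omega)
      refine Metric.ball_subset_ball' ?_
      have := dist_triangle_left (center y) (center x) w
      linarith
  by_cases hb : Bornology.IsBounded (univ : Set Z)
  · obtain ⟨D, hD⟩ := Metric.isBounded_iff.1 hb
    obtain ⟨m, hm⟩ := pow_unbounded_of_one_lt D (by norm_num : (1 : ℝ) < 2)
    refine ⟨m + 3, fun X x y hxy => ?_⟩
    -- Only vertices of level at most $1$ can be the root or adjacent to it; for them the dilated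
    -- ball is made to exceed the diameter. Hence `m` depends on `Z` but not on the filling.
    by_cases hlx : level x ≤ 1
    · intro w _
      rw [Metric.mem_ball]
      refine (hD trivial trivial).trans_lt (hm.trans_le ?_)
      rw [← zpow_natCast]
      exact zpow_le_zpow_right₀ (by norm_num) (by push_cast; omega)
    · refine key X x y hxy ?_ ?_ _ (by omega)
      · unfold ball
        rw [if_neg]
        rintro ⟨-, h0⟩
        rcases hxy with rfl | hxy
        · omega
        · have := hxy.2.1
          rw [abs_le] at this
          omega
      · unfold ball
        rw [if_neg]
        rintro ⟨-, h0⟩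
        omega
  · refine ⟨3, fun X x y hxy => key X x y hxy ?_ ?_ 3 le_rfl⟩
    · unfold ball; rw [if_neg fun h => hb h.1]
    · unfold ball; rw [if_neg fun h => hb h.1]

/-- The vertex of level `n` with center `a`. -/
def vertex (X : HyperbolicFilling Z) (n : ℤ) (a : X.net n) : X.Vertex := ⟨n, a⟩

lemma tsum_vertex (F : X.Vertex → ℝ≥0∞) :
    ∑' x : X.Vertex, F x = ∑' (n : ℤ) (a : X.net n), F (X.vertex n a) :=
  ENNReal.tsum_sigma (fun n (a : X.net n) => F (X.vertex n a))

end Metric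

variable {Z : Type*} [MetricSpace Z] [MeasurableSpace Z]

section Counting

variable [BorelSpace Z] {μ : Measure Z} {Q C : ℝ}

/-- Each level contributes boundedly many vertices of `S`, uniformly in the level, by separation of
the centers. -/
lemma tsum_subtype_le_of_dist_lt (h : IsDoubling μ Q C) (X : HyperbolicFilling Z) (ξ : Z) (M : ℕ)
    {S : Set X.Vertex} (hS : ∀ x ∈ S, dist (center x) ξ < 2 ^ (-(level x - M)))
    {F : X.Vertex → ℝ≥0∞} {b : ℤ → ℝ≥0∞} (hF : ∀ x ∈ S, F x ≤ b (level x)) :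
    ∑' x : S, F x ≤ ENNReal.ofReal (C * (4 * 2 ^ (M + 1) + 1) ^ Q) * ∑' n, b n := by
  rw [tsum_subtype S F, tsum_vertex, ← ENNReal.tsum_mul_left]
  refine ENNReal.tsum_le_tsum fun n => ?_
  let A : Set Z := {a | ∃ ha : a ∈ X.net n, X.vertex n ⟨a, ha⟩ ∈ S}
  have hAsub : A ⊆ X.net n := fun a ha => ha.1
  have hcard : (A.encard : ℝ≥0∞) ≤ ENNReal.ofReal (C * (4 * 2 ^ (M + 1) + 1) ^ Q) := by
    refine h.encard_le_of_separated (r := 2 ^ (-n - 1)) (a := 2 ^ (M + 1)) (by positivity)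
      (by positivity) ((X.net_pairwise n).mono hAsub) (ξ := ξ) fun a ha => ?_
    obtain ⟨ha, haS⟩ := ha
    have := hS _ haS
    refine this.trans_le (le_of_eq ?_)
    change (2 : ℝ) ^ (-(n - (M : ℤ))) = _
    rw [← zpow_natCast, ← zpow_add₀ (by norm_num)]
    congr 1; push_cast; ring
  calc ∑' a : X.net n, S.indicator F (X.vertex n a)
      ≤ ∑' a : X.net n, b n * A.indicator 1 (a : Z) := by
        refine ENNReal.tsum_le_tsum fun a => ?_
        by_cases ha : X.vertex n a ∈ S
        · have ha' : (a : Z) ∈ A := ⟨a.2, ha⟩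
          rw [indicator_of_mem ha, indicator_of_mem ha', Pi.one_apply, mul_one]
          exact hF _ ha
        · rw [indicator_of_notMem ha]; exact zero_le
    _ = b n * ∑' a : Z, (X.net n).indicator (A.indicator 1) a := by
        rw [ENNReal.tsum_mul_left, tsum_subtype (X.net n) (A.indicator 1)]
    _ = b n * A.encard := by
        rw [indicator_indicator, inter_eq_right.2 hAsub, ← tsum_subtype,
          ← ENNReal.tsum_set_one]
        rfl
    _ ≤ b n * ENNReal.ofReal (C * (4 * 2 ^ (M + 1) + 1) ^ Q) := by gcongr
    _ = _ := mul_comm _ _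

/-- Every point lies in boundedly many balls of each level. -/
lemma exists_lqNorm_cone_le (h : IsDoubling μ Q C) {q : ℝ≥0∞} (hq0 : q ≠ 0) :
    ∃ K : ℝ≥0, ∀ (X : HyperbolicFilling Z) (ξ : Z) (F : X.Vertex → ℝ≥0∞) (b : ℤ → ℝ≥0∞),
      (∀ x ∈ X.cone ξ, F x ≤ b (level x)) →
        lqNorm q (fun x : X.cone ξ => F x) ≤ K * lqNorm q b := by
  obtain ⟨m, hm⟩ := exists_ball_subset Z
  by_cases hq : q = ∞
  · subst hq
    refine ⟨1, fun X ξ F b hF => ?_⟩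
    rw [lqNorm_top, lqNorm_top, ENNReal.coe_one, one_mul]
    exact iSup_le fun x => (hF x x.2).trans (le_iSup b _)
  · have hr := ENNReal.toReal_pos hq0 hq
    set N := ENNReal.ofReal (C * (4 * 2 ^ (m + 1) + 1) ^ Q) with hN
    have hK : N ^ (1 / q.toReal) ≠ ∞ :=
      ENNReal.rpow_ne_top_of_nonneg (by positivity) ENNReal.ofReal_ne_top
    refine ⟨(N ^ (1 / q.toReal)).toNNReal, fun X ξ F b hF => ?_⟩
    rw [ENNReal.coe_toNNReal hK, lqNorm_of_ne_top hq, lqNorm_of_ne_top hq,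
      ← ENNReal.mul_rpow_of_nonneg _ _ (by positivity)]
    refine ENNReal.rpow_le_rpow ?_ (by positivity)
    refine tsum_subtype_le_of_dist_lt h X ξ m (S := X.cone ξ) (F := fun x => F x ^ q.toReal)
      (fun x hx => ?_) fun x hx => ENNReal.rpow_le_rpow (hF x hx) hr.le
    rw [dist_comm]
    exact hm X x x (Or.inl rfl) hx

/-- A vertex has boundedly many neighbors, spread over at most three levels, so the $\ell^2$ sum is
comparable to a maximum. -/
lemma exists_absDeriv_le (h : IsDoubling μ Q C) :
    ∃ K : ℝ≥0, ∀ (X : HyperbolicFilling Z) (u : X.Vertex → ℂ) (x : X.Vertex) (B : ℝ≥0∞),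
      (∀ y, X.graph.Adj x y → ‖u y - u x‖ₑ ≤ B) → absDeriv u x ≤ K * B := by
  obtain ⟨m, hm⟩ := exists_ball_subset Z
  set N := ENNReal.ofReal (C * (4 * 2 ^ (m + 1 + 1) + 1) ^ Q) with hN
  have hK : (N * 3) ^ (1 / 2 : ℝ) ≠ ∞ := ENNReal.rpow_ne_top_of_nonneg (by positivity)
    (ENNReal.mul_ne_top ENNReal.ofReal_ne_top (by norm_num))
  refine ⟨((N * 3) ^ (1 / 2 : ℝ)).toNNReal, fun X u x B hB => ?_⟩
  rw [ENNReal.coe_toNNReal hK, absDeriv]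
  have hBB : B = (B ^ 2) ^ (1 / 2 : ℝ) := by
    rw [← ENNReal.rpow_natCast, ← ENNReal.rpow_mul]; norm_num
  rw [hBB, ← ENNReal.mul_rpow_of_nonneg _ _ (by positivity)]
  refine ENNReal.rpow_le_rpow ?_ (by positivity)
  let b : ℤ → ℝ≥0∞ := fun n => if n ∈ Finset.Icc (level x - 1) (level x + 1) then B ^ 2 else 0
  have hb : ∑' n, b n = 3 * B ^ 2 := by
    rw [tsum_eq_sum (s := Finset.Icc (level x - 1) (level x + 1)) fun n hn => if_neg hn,
      Finset.sum_congr rfl fun n hn => if_pos hn, Finset.sum_const, Int.card_Icc, nsmul_eq_mul]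
    congr 1
    have : (level x + 1 + 1 - (level x - 1)).toNat = 3 := by omega
    rw [this]; rfl
  rw [mul_assoc, ← hb]
  refine tsum_subtype_le_of_dist_lt h X (center x) (m + 1) (S := X.graph.neighborSet x)
    (F := fun y => ‖u y - u x‖ₑ ^ 2) (fun y hy => ?_) fun y hy => ?_
  · have h1 := hm X x y (Or.inr hy) (center_mem_ball y)
    rw [Metric.mem_ball] at h1
    have h2 : |level x - level y| ≤ 1 := hy.2.1
    rw [abs_le] at h2
    exact h1.trans_le (zpow_le_zpow_right₀ (by norm_num) (by push_cast; omega))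
  · have h2 : |level x - level y| ≤ 1 := hy.2.1
    rw [abs_le] at h2
    simp only [b]
    rw [if_pos (Finset.mem_Icc.2 ⟨by omega, by omega⟩)]
    gcongr
    exact hB y hy

end Counting

variable [BorelSpace Z] {μ : Measure Z} {Q C : ℝ}

/-- The means over $B(x)$ and over the neighboring balls are all compared with the same `c`; these
balls lie in one dilated ball of comparable measure. -/
lemma exists_absDeriv_poisson_le (h : IsDoubling μ Q C) {m : ℕ}
    (hm : ∀ (X : HyperbolicFilling Z) (x y : X.Vertex), y = x ∨ X.graph.Adj x y →
      ball y ⊆ Metric.ball (center x) ((2 : ℝ) ^ (-(level x - m)))) :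
    ∃ K : ℝ≥0, ∀ (X : HyperbolicFilling Z) (f : Z → ℂ), LocInt μ f → ∀ (x : X.Vertex) (c : ℂ),
      absDeriv (X.poisson μ f) x ≤
        K * ((∫⁻ ξ in Metric.ball (center x) ((2 : ℝ) ^ (-(level x - m))), ‖f ξ - c‖ₑ ∂μ) /
          μ (Metric.ball (center x) (2 * (2 : ℝ) ^ (-(level x - m))))) := by
  obtain ⟨K₁, hK₁⟩ := exists_absDeriv_le h
  set c₁ := ENNReal.ofReal (C * (6 * 2 ^ m) ^ Q) with hc₁
  refine ⟨K₁ * (2 * c₁.toNNReal), fun X f hf x c => ?_⟩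
  push_cast
  rw [ENNReal.coe_toNNReal ENNReal.ofReal_ne_top, mul_assoc]
  refine hK₁ X _ x _ fun y hy => ?_
  set I := ∫⁻ ξ in Metric.ball (center x) ((2 : ℝ) ^ (-(level x - m))), ‖f ξ - c‖ₑ ∂μ with hI
  set V := μ (Metric.ball (center x) (2 * (2 : ℝ) ^ (-(level x - m)))) with hV
  have hpos : (0 : ℝ) < 2 ^ (-(level x - m)) := by positivity
  have hV0 : V ≠ 0 := h.ne_zero _ (by positivity)
  have hVt : V ≠ ∞ := h.ne_top _ _
  have key : ∀ y : X.Vertex, y = x ∨ X.graph.Adj x y →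
      ‖X.poisson μ f y - c‖ₑ ≤ c₁ * (I / V) := fun y hy => by
    have hsub := hm X x y hy
    have hcy := hsub (center_mem_ball y)
    rw [Metric.mem_ball] at hcy
    have hlev : level y ≤ level x + 1 := by
      rcases hy with rfl | hy
      · omega
      · have := hy.2.1
        rw [abs_le] at this
        omega
    have hmeas : V ≤ c₁ * μ (ball y) := by
      have h1 : V ≤ c₁ * μ (Metric.ball (center y) (2 ^ (-(level x + 1)))) := by
        refine h.measure_ball_le (by positivity) ?_ (Metric.ball_subset_ball' ?_)
        · have : (1 : ℝ) ≤ 2 ^ m := one_le_pow₀ (by norm_num)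
          linarith
        · have : (6 * (2 : ℝ) ^ m) * 2 ^ (-(level x + 1)) = 3 * 2 ^ (-(level x - m)) := by
            rw [two_zpow_neg_sub, neg_add, zpow_add₀ (by norm_num)]
            norm_num
            ring
          rw [this, dist_comm]
          linarith
      refine h1.trans ?_
      gcongr
      refine (Metric.ball_subset_ball ?_).trans (ball_center_subset y)
      exact zpow_le_zpow_right₀ (by norm_num) (by omega)
    have hy0 : μ (ball y) ≠ 0 := fun h0 => by
      rw [h0, mul_zero] at hmeas
      exact hV0 (le_zero_iff.1 hmeas)
    have hyt : μ (ball y) ≠ ∞ := ne_top_of_le_ne_top (h.ne_top _ _) (measure_mono hsub)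
    have hfy : IntegrableOn f (ball y) μ :=
      hf.2 _ (isOpen_ball y).measurableSet (Metric.isBounded_ball.subset hsub)
    refine (enorm_setAverage_sub_le hy0 hyt hfy c).trans ?_
    rw [ENNReal.div_le_iff hy0 hyt]
    calc ∫⁻ η in ball y, ‖f η - c‖ₑ ∂μ ≤ I := lintegral_mono_set hsub
      _ = I / V * V := (ENNReal.div_mul_cancel hV0 hVt).symm
      _ ≤ I / V * (c₁ * μ (ball y)) := by gcongr
      _ = _ := by ring
  calc ‖X.poisson μ f y - X.poisson μ f x‖ₑ
      = ‖(X.poisson μ f y - c) - (X.poisson μ f x - c)‖ₑ := by congr 1; ring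
    _ ≤ ‖X.poisson μ f y - c‖ₑ + ‖X.poisson μ f x - c‖ₑ := enorm_sub_le
    _ ≤ c₁ * (I / V) + c₁ * (I / V) := add_le_add (key y (Or.inr hy)) (key x (Or.inl rfl))
    _ = _ := by ring

end HyperbolicFilling

/-! ### Bounding the filling norm by a Hajłasz gradient. -/

lemma measurable_lqNorm {Z ι : Type*} [MeasurableSpace Z] [Countable ι] (q : ℝ≥0∞)
    {g : ι → Z → ℝ≥0∞} (hg : ∀ k, Measurable (g k)) :
    Measurable fun ξ => lqNorm q fun k => g k ξ := by
  by_cases hq : q = ∞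
  · subst hq
    simp_rw [lqNorm_top]
    exact Measurable.iSup hg
  · simp_rw [lqNorm_of_ne_top hq]
    exact (Measurable.tsum fun k => (hg k).pow_const _).pow_const _

/-- This makes the tails finite, hence convergent to $0$, almost everywhere, as the Poincaré
inequality requires. -/
lemma ae_exists_forall_le_of_lqNorm {Z : Type*} [MeasurableSpace Z] {μ : Measure Z} {p : ℝ}
    (hp : 0 < p) {q : ℝ≥0∞} (hq0 : q ≠ 0)
    {g : ℤ → Z → ℝ≥0∞} (hgm : ∀ k, Measurable (g k))
    (hfin : ∫⁻ ξ, lqNorm q (fun k => g k ξ) ^ p ∂μ ≠ ∞) :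
    ∀ᵐ ξ ∂μ, ∃ N ≠ ∞, ∀ k, g k ξ ≤ N := by
  filter_upwards [ae_lt_top ((measurable_lqNorm q hgm).pow_const p) hfin] with ξ hξ
  refine ⟨lqNorm q fun k => g k ξ, fun h0 => ?_, fun k => le_lqNorm hq0 (fun k => g k ξ) k⟩
  rw [h0, ENNReal.top_rpow_of_pos hp] at hξ
  exact lt_irrefl _ hξ

lemma expTail_le_of_le {d : ℝ} {φ : ℤ → ℝ≥0∞} {N : ℝ≥0∞} (h : ∀ i, φ i ≤ N) (k : ℤ) :
    expTail d φ k ≤ (∑' l : ℕ, (2 : ℝ≥0∞) ^ (-((l : ℝ) * d))) * N := by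
  rw [← ENNReal.tsum_mul_right]
  exact ENNReal.tsum_le_tsum fun _ => by gcongr; exact h _

namespace IsDoubling

variable {Z : Type*} [MetricSpace Z] [MeasurableSpace Z] [BorelSpace Z] {μ : Measure Z} {Q C : ℝ}

/-- Functions with a fractional Hajłasz gradient in `L^p(ℓ^q)` are locally integrable. -/
lemma locInt_of_isHajlaszGradient (h : IsDoubling μ Q C) {s t p : ℝ} (hs : 0 < s) (ht : 0 < t)
    (ht1 : t < 1) (hts : Q * (1 / t - 1) < s) (htp : t < p) {q : ℝ≥0∞} (hq0 : q ≠ 0)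
    {f : Z → ℂ} (hf : AEStronglyMeasurable f μ) {g : ℤ → Z → ℝ≥0∞} (hgm : ∀ k, Measurable (g k))
    (hg : IsHajlaszGradient μ s f g) (hfin : ∫⁻ ξ, lqNorm q (fun k => g k ξ) ^ p ∂μ ≠ ∞) :
    LocInt μ f := by
  have hp : 0 < p := ht.trans htp
  refine ⟨hf, fun S hS hSb => ?_⟩
  rcases S.eq_empty_or_nonempty with rfl | ⟨z, -⟩
  · exact integrableOn_empty
  obtain ⟨r, hr⟩ := hSb.subset_ball z
  obtain ⟨n, hn⟩ := pow_unbounded_of_one_lt r (by norm_num : (1 : ℝ) < 2)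
  set k : ℤ := -n with hk
  have hkr : (2 : ℝ) ^ (-k) = 2 ^ n := by rw [hk, neg_neg, zpow_natCast]
  have hSsub : S ⊆ Metric.ball z ((2 : ℝ) ^ (-k)) := by
    rw [hkr]; exact hr.trans (Metric.ball_subset_ball hn.le)
  refine IntegrableOn.mono_set ?_ hSsub
  obtain ⟨K, hK⟩ := h.exists_hajlasz_poincare hs ht ht1
  obtain ⟨c, hc⟩ := hK f g hgm hg (ae_exists_forall_le_of_lqNorm hp hq0 hgm hfin) z k
  have hpos : (0 : ℝ) < 2 * 2 ^ (-k) := by positivity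
  have hV0 := h.ne_zero z hpos
  have hVt := h.ne_top z (2 * (2 : ℝ) ^ (-k))
  set V := μ (Metric.ball z (2 * (2 : ℝ) ^ (-k)))
  set I := ∫⁻ ξ in Metric.ball z ((2 : ℝ) ^ (-k)), ‖f ξ - c‖ₑ ∂μ with hI
  have hIfin : I ≠ ∞ := by
    set δ := (s - Q * (1 / t - 1)) * t with hδ
    have hδ0 : 0 < δ := mul_pos (by linarith) ht
    set N : Z → ℝ≥0∞ := fun ξ => lqNorm q fun k => g k ξ with hN
    set c₁ := ∑' l : ℕ, (2 : ℝ≥0∞) ^ (-((l : ℝ) * δ)) with hc₁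
    set c₂ := ∑' l : ℕ, (2 : ℝ≥0∞) ^ (-((l : ℝ) * (s * t))) with hc₂
    have hc₁t : c₁ ≠ ∞ := ENNReal.tsum_two_rpow_ne_top hδ0
    have hc₂t : c₂ ≠ ∞ := ENNReal.tsum_two_rpow_ne_top (mul_pos hs ht)
    have hpt : ∀ ξ, expTail δ (expTail (s * t) fun i => g i ξ ^ t) (k - 2) ≤
        c₁ * (c₂ * (1 + N ξ ^ p)) := fun ξ => by
      refine expTail_le_of_le (fun i => expTail_le_of_le (fun j => ?_) i) _
      refine (ENNReal.rpow_le_rpow (le_lqNorm hq0 (fun k => g k ξ) j) ht.le).trans ?_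
      -- Since $t<p$, one has $N^t\le1+N^p$, which is integrable on balls.
      rcases le_total (N ξ) 1 with h1 | h1
      · exact (ENNReal.rpow_le_one h1 ht.le).trans le_self_add
      · exact (ENNReal.rpow_le_rpow_of_exponent_le h1 htp.le).trans le_add_self
    have havg : ballAverage μ (2 * (2 : ℝ) ^ (-k))
        (fun ξ => expTail δ (expTail (s * t) fun i => g i ξ ^ t) (k - 2)) z ≠ ∞ := by
      refine ENNReal.div_ne_top ?_ hV0
      refine ne_top_of_le_ne_top ?_ (lintegral_mono hpt)
      have hNm : Measurable fun ξ => N ξ ^ p := (measurable_lqNorm q hgm).pow_const p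
      rw [lintegral_const_mul _ ((hNm.const_add 1).const_mul _),
        lintegral_const_mul _ (hNm.const_add 1), lintegral_add_left measurable_const,
        setLIntegral_const, one_mul]
      refine ENNReal.mul_ne_top hc₁t (ENNReal.mul_ne_top hc₂t (ENNReal.add_ne_top.2 ⟨hVt, ?_⟩))
      exact ne_top_of_le_ne_top hfin (setLIntegral_le_lintegral _ _)
    intro hItop
    rw [hItop, ENNReal.top_div_of_ne_top hVt, ENNReal.mul_top (ENNReal.two_rpow_ne_zero _),
      ENNReal.top_rpow_of_pos ht, top_le_iff] at hc
    exact ENNReal.mul_ne_top ENNReal.coe_ne_top havg hc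
  have hsub : IntegrableOn (fun ξ => f ξ - c) (Metric.ball z ((2 : ℝ) ^ (-k))) μ :=
    ⟨(hf.sub aestronglyMeasurable_const).restrict, lt_top_iff_ne_top.2 hIfin⟩
  have := hsub.add (integrableOn_const (C := c) (h.ne_top z ((2 : ℝ) ^ (-k))))
  refine this.congr (Filter.Eventually.of_forall fun ξ => ?_)
  simp

/-- The norm of the filling is controlled by that of any measurable fractional Hajłasz gradient. -/
theorem exists_tlNorm_le (h : IsDoubling μ Q C) {s t p : ℝ} (hs : 0 < s) (ht : 0 < t)
    (ht1 : t < 1) (hts : Q * (1 / t - 1) < s) (htp : t < p) {q : ℝ≥0∞}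
    (htq : ENNReal.ofReal t < q) :
    ∃ K : ℝ≥0, ∀ (X : HyperbolicFilling Z) (f : Z → ℂ) (g : ℤ → Z → ℝ≥0∞), LocInt μ f →
      (∀ k, Measurable (g k)) → IsHajlaszGradient μ s f g →
      ∫⁻ ξ, lqNorm q (fun k => g k ξ) ^ p ∂μ ≠ ∞ →
      X.tlNorm μ s p q f ≤ K * (∫⁻ ξ, lqNorm q (fun k => g k ξ) ^ p ∂μ) ^ (1 / p) := by
  have hp : 0 < p := ht.trans htp
  have hq0 : q ≠ 0 := (zero_le.trans_lt htq).ne'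
  have ht0 : ENNReal.ofReal t ≠ 0 := by simpa using ht
  set δ := (s - Q * (1 / t - 1)) * t with hδ
  have hδ0 : 0 < δ := mul_pos (by linarith) ht
  set P := p / t with hP
  have hP1 : 1 < P := (one_lt_div ht).2 htp
  have hP0 : 0 < P := by linarith
  set R := q / ENNReal.ofReal t with hR
  have hR1 : 1 < R := by
    rw [hR, ENNReal.lt_div_iff_mul_lt (Or.inl ht0) (Or.inl ENNReal.ofReal_ne_top), one_mul]
    exact htq
  have hR0 : R ≠ 0 := (zero_lt_one.trans hR1).ne'
  obtain ⟨m, hm⟩ := HyperbolicFilling.exists_ball_subset Z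
  obtain ⟨K₁, hK₁⟩ := HyperbolicFilling.exists_absDeriv_poisson_le h hm
  obtain ⟨K₂, hK₂⟩ := h.exists_hajlasz_poincare hs ht ht1
  obtain ⟨K₃, hK₃⟩ := HyperbolicFilling.exists_lqNorm_cone_le h hq0
  obtain ⟨K₄, hK₄⟩ := h.exists_lintegral_lqNorm_ballAverage_le (ι := ℤ) hP1 hR1
  obtain ⟨K₅, hK₅⟩ := exists_lqNorm_expTail_le hδ0 hR0
  obtain ⟨K₆, hK₆⟩ := exists_lqNorm_expTail_le (mul_pos hs ht) hR0
  set c₁ := ENNReal.ofReal (C * 3 ^ Q) with hc₁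
  have h1t : 0 ≤ 1 / t := by positivity
  have h1p : 0 ≤ 1 / p := by positivity
  set c₂ : ℝ≥0∞ := K₁ * (2 ^ ((m : ℝ) * s) * (K₂ * c₁) ^ (1 / t)) with hc₂
  have hc₂t : c₂ ≠ ∞ := ENNReal.mul_ne_top ENNReal.coe_ne_top
    (ENNReal.mul_ne_top (ENNReal.two_rpow_ne_top _) (ENNReal.rpow_ne_top_of_nonneg h1t
      (ENNReal.mul_ne_top ENNReal.coe_ne_top ENNReal.ofReal_ne_top)))
  set c₃ : ℝ≥0∞ := (K₃ * c₂) ^ p * (K₄ * (K₅ * K₆) ^ P) with hc₃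
  have hc₃t : c₃ ≠ ∞ := ENNReal.mul_ne_top
    (ENNReal.rpow_ne_top_of_nonneg hp.le (ENNReal.mul_ne_top ENNReal.coe_ne_top hc₂t))
    (ENNReal.mul_ne_top ENNReal.coe_ne_top (ENNReal.rpow_ne_top_of_nonneg hP0.le
      (ENNReal.mul_ne_top ENNReal.coe_ne_top ENNReal.coe_ne_top)))
  have hKt : c₃ ^ (1 / p) ≠ ∞ := ENNReal.rpow_ne_top_of_nonneg h1p hc₃t
  refine ⟨(c₃ ^ (1 / p)).toNNReal, fun X f g hf hgm hg hfin => ?_⟩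
  rw [ENNReal.coe_toNNReal hKt, ← ENNReal.mul_rpow_of_nonneg _ _ h1p]
  refine ENNReal.rpow_le_rpow ?_ h1p
  let ψ : ℤ → Z → ℝ≥0∞ := fun k ξ => expTail δ (expTail (s * t) fun i => g i ξ ^ t) k
  have hψ : ∀ k, Measurable (ψ k) := fun k =>
    measurable_expTail (fun i => measurable_expTail (fun j => (hgm j).pow_const t) i) k
  -- Radius $4\cdot2^{-(n-m)}$ allows the average centered at $\xi_x$ to be replaced by one centered
  -- at `ξ`. The bound then depends on the vertex only through its level.
  let ρ : ℤ → ℝ := fun n => 4 * (2 : ℝ) ^ (-(n - (m : ℤ)))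
  have hρ : ∀ n, 0 < ρ n := fun n => by positivity
  -- The shift combines the dilation by $2^m$ with the two scales lost in the Poincaré inequality.
  let e : ℤ ≃ ℤ := Equiv.subRight ((m : ℤ) + 2)
  have hpt : ∀ ξ, ∀ x ∈ X.cone ξ,
      ENNReal.ofReal ((2 : ℝ) ^ ((HyperbolicFilling.level x : ℝ) * s)) *
        HyperbolicFilling.absDeriv (X.poisson μ f) x ≤
      c₂ * ballAverage μ (ρ (HyperbolicFilling.level x)) (ψ (e (HyperbolicFilling.level x))) ξ ^
        (1 / t) := fun ξ x hx => by
    set n := HyperbolicFilling.level x with hn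
    set z := HyperbolicFilling.center x with hz
    obtain ⟨c, hc⟩ := hK₂ f g hgm hg (ae_exists_forall_le_of_lqNorm hp hq0 hgm hfin) z (n - m)
    set D := (∫⁻ ξ in Metric.ball z ((2 : ℝ) ^ (-(n - (m : ℤ)))), ‖f ξ - c‖ₑ ∂μ) /
      μ (Metric.ball z (2 * (2 : ℝ) ^ (-(n - (m : ℤ))))) with hD
    have hpos : (0 : ℝ) < 2 ^ (-(n - (m : ℤ))) := by positivity
    have hdist : dist ξ z < (2 : ℝ) ^ (-(n - (m : ℤ))) := hm X x x (Or.inl rfl) hx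
    have he : n - m - 2 = e n := by simp only [e, Equiv.subRight_apply]; ring
    have h1 : 2 ^ (((n - m : ℤ) : ℝ) * s) * D ≤
        (K₂ * (c₁ * ballAverage μ (ρ n) (ψ (e n)) ξ)) ^ (1 / t) := by
      have h2 : (2 ^ (((n - m : ℤ) : ℝ) * s) * D) ^ t ≤
          K₂ * (c₁ * ballAverage μ (ρ n) (ψ (e n)) ξ) := by
        refine hc.trans ?_
        rw [he]
        gcongr
        refine h.ballAverage_le_mul (by positivity) (by norm_num)
          (Metric.ball_subset_ball' ?_) (Metric.ball_subset_ball' ?_) _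
        · rw [dist_comm]; simp only [ρ]; linarith
        · simp only [ρ]; linarith
      calc _ = ((2 ^ (((n - m : ℤ) : ℝ) * s) * D) ^ t) ^ (1 / t) := by
            rw [← ENNReal.rpow_mul, mul_one_div_cancel ht.ne', ENNReal.rpow_one]
        _ ≤ _ := ENNReal.rpow_le_rpow h2 h1t
    rw [ENNReal.ofReal_two_rpow]
    calc _ ≤ 2 ^ ((n : ℝ) * s) * (K₁ * D) := by gcongr; exact hK₁ X f hf x c
      _ = K₁ * (2 ^ ((m : ℝ) * s) * (2 ^ (((n - m : ℤ) : ℝ) * s) * D)) := by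
          have : (2 : ℝ≥0∞) ^ ((n : ℝ) * s) =
              2 ^ ((m : ℝ) * s) * 2 ^ (((n - m : ℤ) : ℝ) * s) := by
            rw [← ENNReal.two_rpow_add]; push_cast; congr 1; ring
          rw [this]; ring
      _ ≤ K₁ * (2 ^ ((m : ℝ) * s) *
            (K₂ * (c₁ * ballAverage μ (ρ n) (ψ (e n)) ξ)) ^ (1 / t)) := by gcongr
      _ = _ := by rw [← mul_assoc (K₂ : ℝ≥0∞), ENNReal.mul_rpow_of_nonneg _ _ h1t]; ring
  calc ∫⁻ ξ, lqNorm q (fun x : X.cone ξ =>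
          ENNReal.ofReal ((2 : ℝ) ^ ((HyperbolicFilling.level x.1 : ℝ) * s)) *
            HyperbolicFilling.absDeriv (X.poisson μ f) x.1) ^ p ∂μ
      ≤ ∫⁻ ξ, (K₃ * c₂) ^ p *
          lqNorm R (fun n => ballAverage μ (ρ n) (ψ (e n)) ξ) ^ P ∂μ := by
        refine lintegral_mono fun ξ => ?_
        have h1 := hK₃ X ξ (fun x =>
          ENNReal.ofReal ((2 : ℝ) ^ ((HyperbolicFilling.level x : ℝ) * s)) *
            HyperbolicFilling.absDeriv (X.poisson μ f) x)
          (fun n => c₂ * ballAverage μ (ρ n) (ψ (e n)) ξ ^ (1 / t)) (hpt ξ)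
        rw [lqNorm_const_mul hq0] at h1
        refine (ENNReal.rpow_le_rpow h1 hp.le).trans (le_of_eq ?_)
        rw [← mul_assoc, ENNReal.mul_rpow_of_nonneg _ _ hp.le]
        congr 1
        have h2 := lqNorm_rpow hq0 ht (fun n => ballAverage μ (ρ n) (ψ (e n)) ξ ^ (1 / t))
        simp_rw [← ENNReal.rpow_mul, one_div_mul_cancel ht.ne', ENNReal.rpow_one] at h2
        rw [← hR] at h2
        rw [← h2, ← ENNReal.rpow_mul, hP, mul_div_cancel₀ _ ht.ne']
    _ = (K₃ * c₂) ^ p * ∫⁻ ξ, lqNorm R (fun n => ballAverage μ (ρ n) (ψ (e n)) ξ) ^ P ∂μ :=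
        lintegral_const_mul _ ((measurable_lqNorm R fun n =>
          h.measurable_ballAverage (ρ n) (hψ (e n))).pow_const P)
    _ ≤ (K₃ * c₂) ^ p * (K₄ * ∫⁻ ξ, lqNorm R (fun n => ψ (e n) ξ) ^ P ∂μ) := by
        gcongr
        exact hK₄ ρ hρ (fun n => ψ (e n)) fun n => hψ _
    _ ≤ (K₃ * c₂) ^ p * (K₄ * ∫⁻ ξ, (K₅ * K₆) ^ P * lqNorm q (fun k => g k ξ) ^ p ∂μ) := by
        refine mul_le_mul_right (mul_le_mul_right (lintegral_mono fun ξ => ?_) _) _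
        rw [lqNorm_comp_equiv e (fun n => ψ n ξ)]
        have h1 : lqNorm R (fun n => ψ n ξ) ≤ K₅ * K₆ * lqNorm R (fun i => g i ξ ^ t) := by
          rw [mul_assoc]
          exact (hK₅ _).trans (by gcongr; exact hK₆ _)
        refine (ENNReal.rpow_le_rpow h1 hP0.le).trans (le_of_eq ?_)
        rw [ENNReal.mul_rpow_of_nonneg _ _ hP0.le, hR, ← lqNorm_rpow hq0 ht, ← ENNReal.rpow_mul,
          hP, mul_div_cancel₀ _ ht.ne']
    _ = _ := by
        rw [lintegral_const_mul _ ((measurable_lqNorm q hgm).pow_const p), hc₃]; ring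

end IsDoubling

/-- Measurable representatives remain a gradient once the null set where they differ is added to the
exceptional set. -/
lemma IsHajlaszGradient.exists_measurable {Z : Type*} [MetricSpace Z] [MeasurableSpace Z]
    {μ : Measure Z} {s : ℝ} {f : Z → ℂ} {g : ℤ → Z → ℝ≥0∞} (hg : IsHajlaszGradient μ s f g) :
    ∃ g' : ℤ → Z → ℝ≥0∞, (∀ k, Measurable (g' k)) ∧ IsHajlaszGradient μ s f g' ∧
      ∀ᵐ ξ ∂μ, ∀ k, g' k ξ = g k ξ := by
  obtain ⟨hm, E, hE, hE0, h⟩ := hg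
  have hae : ∀ᵐ ξ ∂μ, ∀ k, (hm k).mk (g k) ξ = g k ξ :=
    ae_all_iff.2 fun k => ((hm k).ae_eq_mk).symm
  refine ⟨fun k => (hm k).mk (g k), fun k => (hm k).measurable_mk,
    ⟨fun k => (hm k).measurable_mk.aemeasurable, ?_⟩, hae⟩
  refine ⟨E ∪ toMeasurable μ {ξ | ¬ ∀ k, (hm k).mk (g k) ξ = g k ξ},
    hE.union (measurableSet_toMeasurable _ _), ?_, fun k ξ η hξ hη h1 h2 => ?_⟩
  · exact measure_union_null hE0 (by rw [measure_toMeasurable]; exact ae_iff.1 hae)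
  · rw [mem_union, not_or] at hξ hη
    have hξ' := not_not.1 fun hc => hξ.2 (subset_toMeasurable μ _ hc)
    have hη' := not_not.1 fun hc => hη.2 (subset_toMeasurable μ _ hc)
    beta_reduce
    rw [hξ' k, hη' k]
    exact h k ξ η hξ.1 hη.1 h1 h2

/-! ### Boundary values of the Poisson extension and the gradient they provide. -/

lemma IsDoubling.isUnifLocDoublingMeasure {Z : Type*} [MetricSpace Z] [MeasurableSpace Z]
    {μ : Measure Z} {Q C : ℝ} (h : IsDoubling μ Q C) : IsUnifLocDoublingMeasure μ := by
  refine ⟨⟨(C * 4 ^ Q).toNNReal, ?_⟩⟩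
  filter_upwards [self_mem_nhdsWithin] with ε hε x
  have hε' : (0 : ℝ) < ε := hε
  calc μ (Metric.closedBall x (2 * ε)) ≤ μ (Metric.ball x (4 * ε)) :=
        measure_mono (Metric.closedBall_subset_ball (by linarith))
    _ ≤ ENNReal.ofReal (C * 4 ^ Q) * μ (Metric.ball x ε) :=
        h.measure_mul_le x ε 4 hε' (by norm_num)
    _ ≤ _ := mul_le_mul_right (measure_mono Metric.ball_subset_closedBall) _

lemma IsDoubling.isLocallyFiniteMeasure {Z : Type*} [MetricSpace Z] [MeasurableSpace Z]
    {μ : Measure Z} {Q C : ℝ} (h : IsDoubling μ Q C) : IsLocallyFiniteMeasure μ :=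
  ⟨fun x => ⟨Metric.ball x 1, Metric.ball_mem_nhds x one_pos, h.lt_top x 1⟩⟩

lemma LocInt.locallyIntegrable {Z : Type*} [MetricSpace Z] [MeasurableSpace Z] [BorelSpace Z]
    {μ : Measure Z} {f : Z → ℂ} (hf : LocInt μ f) : LocallyIntegrable f μ := fun x =>
  ⟨Metric.ball x 1, Metric.ball_mem_nhds x one_pos,
    hf.2 _ Metric.isOpen_ball.measurableSet Metric.isBounded_ball⟩

namespace HyperbolicFilling

section Metric

variable {Z : Type*} [MetricSpace Z] {X : HyperbolicFilling Z}

/-- Maximality puts a center within $2^{-n-1}$ of `ξ`, half the radius of the ball; the other half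
is left for the points near `ξ`. -/
lemma exists_vertex (X : HyperbolicFilling Z) {n : ℤ}
    (hn : ¬ Bornology.IsBounded (univ : Set Z) ∨ 0 ≤ n) (ξ : Z) :
    ∃ x : X.Vertex, level x = n ∧ Metric.ball ξ ((2 : ℝ) ^ (-n - 1)) ⊆ ball x := by
  have key : IsMaximalSeparated ((2 : ℝ) ^ (-n - 1)) (X.net n) →
      ∃ x : X.Vertex, level x = n ∧ Metric.ball ξ ((2 : ℝ) ^ (-n - 1)) ⊆ ball x := fun hA => by
    obtain ⟨z, hz, hlt⟩ := hA.exists_dist_lt (by positivity) ξ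
    refine ⟨X.vertex n ⟨z, hz⟩, rfl, (Metric.ball_subset_ball' ?_).trans (ball_center_subset _)⟩
    change (2 : ℝ) ^ (-n - 1) + dist ξ z ≤ 2 ^ (-n)
    have : (2 : ℝ) ^ (-n) = 2 * 2 ^ (-n - 1) := by
      rw [← zpow_one_add₀ (by norm_num)]; congr 1; ring
    linarith
  by_cases hb : Bornology.IsBounded (univ : Set Z)
  · have hn0 : 0 ≤ n := hn.resolve_left (not_not.2 hb)
    obtain ⟨⟨z, hz⟩, -, hpos⟩ := X.net_bounded hb
    rcases hn0.eq_or_lt with rfl | hn1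
    · have hz' : z ∈ X.net 0 := by rw [hz]; rfl
      refine ⟨X.vertex 0 ⟨z, hz'⟩, rfl, ?_⟩
      unfold ball
      rw [if_pos ⟨hb, rfl⟩]
      exact subset_univ _
    · exact key (hpos n hn1)
  · exact key (X.net_unbounded hb n)

/-- A vertex of level $k-1$ works, unless $Z$ is bounded and that level is negative; then the root
does, its ball being the whole space. -/
lemma exists_common_vertex (X : HyperbolicFilling Z) (k : ℤ) {ξ η : Z}
    (hd : dist ξ η < (2 : ℝ) ^ (-k)) :
    ∃ x : X.Vertex, k - 1 ≤ level x ∧ (¬ Bornology.IsBounded (univ : Set Z) ∨ 0 ≤ level x) ∧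
      ξ ∈ ball x ∧ η ∈ ball x := by
  by_cases hn : ¬ Bornology.IsBounded (univ : Set Z) ∨ 0 ≤ k - 1
  · obtain ⟨x, hx, hsub⟩ := X.exists_vertex hn ξ
    refine ⟨x, hx.ge, by rwa [hx], hsub (Metric.mem_ball_self (by positivity)), hsub ?_⟩
    rw [Metric.mem_ball, dist_comm]
    have : -(k - 1) - 1 = -k := by ring
    rwa [this]
  · rw [not_or, not_not] at hn
    obtain ⟨x, hx, -⟩ := X.exists_vertex (Or.inr le_rfl) ξ
    have hball : ball x = univ := by
      unfold ball
      rw [if_pos ⟨hn.1, hx⟩]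
    refine ⟨x, by omega, Or.inr hx.ge, ?_, ?_⟩ <;> rw [hball] <;> trivial

lemma enorm_sub_le_absDeriv (u : X.Vertex → ℂ) {x y : X.Vertex} (hxy : X.graph.Adj x y) :
    ‖u y - u x‖ₑ ≤ absDeriv u x := by
  have hB : ‖u y - u x‖ₑ = (‖u y - u x‖ₑ ^ 2) ^ (1 / 2 : ℝ) := by
    rw [← ENNReal.rpow_natCast, ← ENNReal.rpow_mul]; norm_num
  rw [hB, absDeriv]
  refine ENNReal.rpow_le_rpow ?_ (by positivity)
  exact ENNReal.le_tsum (f := fun y : X.graph.neighborSet x => ‖u y - u x‖ₑ ^ 2) ⟨y, hxy⟩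

/-- The largest value of `w` at the vertices of level `n` whose balls contain `ξ`. -/
def levelSup (w : X.Vertex → ℝ≥0∞) (n : ℤ) (ξ : Z) : ℝ≥0∞ :=
  ⨆ x : X.cone ξ, if level x.1 = n then w x else 0

lemma le_levelSup (w : X.Vertex → ℝ≥0∞) {x : X.Vertex} {ξ : Z} (hx : ξ ∈ ball x) :
    w x ≤ levelSup w (level x) ξ := by
  refine le_trans ?_ (le_iSup (fun y : X.cone ξ => if level y.1 = level x then w y else 0) ⟨x, hx⟩)
  simp

/-- The supremum over a level is dominated by the $\ell^q$ sum over that level, and the levels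
partition the cone. -/
lemma lqNorm_levelSup_le {q : ℝ≥0∞} (hq0 : q ≠ 0) (w : X.Vertex → ℝ≥0∞) (ξ : Z) :
    lqNorm q (fun n => levelSup w n ξ) ≤ lqNorm q fun x : X.cone ξ => w x := by
  by_cases hq : q = ∞
  · subst hq
    rw [lqNorm_top, lqNorm_top]
    refine iSup_le fun n => iSup_le fun x => ?_
    split_ifs
    · exact le_iSup (fun x : X.cone ξ => w x) x
    · exact zero_le
  · have hr := ENNReal.toReal_pos hq0 hq
    rw [lqNorm_of_ne_top hq, lqNorm_of_ne_top hq]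
    refine ENNReal.rpow_le_rpow ?_ (by positivity)
    calc ∑' n, levelSup w n ξ ^ q.toReal
        ≤ ∑' n, ∑' x : X.cone ξ, if n = level x.1 then w x ^ q.toReal else 0 := by
          refine ENNReal.tsum_le_tsum fun n => ?_
          rw [levelSup, ENNReal.rpow_iSup _ hr]
          refine iSup_le fun x => le_trans (le_of_eq ?_) (ENNReal.le_tsum x)
          by_cases hx : level x.1 = n
          · rw [if_pos hx, if_pos hx.symm]
          · rw [if_neg hx, if_neg (Ne.symm hx), ENNReal.zero_rpow_of_pos hr]
      _ = ∑' x : X.cone ξ, w x ^ q.toReal := by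
          rw [ENNReal.tsum_comm]
          exact tsum_congr fun x => tsum_ite_eq _ _

/-- Superlevel sets are unions of the open sets $B(x)$, so no countability of vertices is involved.
-/
lemma measurable_levelSup [MeasurableSpace Z] [BorelSpace Z] (w : X.Vertex → ℝ≥0∞) (n : ℤ) :
    Measurable (levelSup w n) := by
  refine measurable_of_Ioi fun a => IsOpen.measurableSet ?_
  have : levelSup w n ⁻¹' Ioi a =
      ⋃ (x : X.Vertex) (_ : a < if level x = n then w x else 0), ball x := by
    ext ξ
    simp only [levelSup, mem_preimage, mem_Ioi, lt_iSup_iff, mem_iUnion, Subtype.exists]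
    exact exists_congr fun x => ⟨fun ⟨h1, h2⟩ => ⟨h2, h1⟩, fun ⟨h1, h2⟩ => ⟨h2, h1⟩⟩
  rw [this]
  exact isOpen_iUnion fun x => isOpen_iUnion fun _ => isOpen_ball x

end Metric

variable {Z : Type*} [MetricSpace Z] [MeasurableSpace Z] {μ : Measure Z} {Q C : ℝ}

/-- The terms of the quasi-norm of the filling. -/
def weightedDeriv (X : HyperbolicFilling Z) (μ : Measure Z) (s : ℝ) (f : Z → ℂ)
    (x : X.Vertex) : ℝ≥0∞ :=
  ENNReal.ofReal ((2 : ℝ) ^ ((level x : ℝ) * s)) * absDeriv (X.poisson μ f) x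

/-- Vertices of consecutive levels whose balls contain `ξ` are adjacent, so each increment of the
Poisson extension along such a chain is at most the discrete derivative at its coarser vertex. -/
lemma edist_poisson_le_hajlaszTail (X : HyperbolicFilling Z) (s : ℝ) (f : Z → ℂ) {ξ : Z}
    (hlim : ∀ (x : ℕ → X.Vertex) (N : ℤ), (∀ l : ℕ, level (x l) = N + l) →
      (∀ l, ξ ∈ ball (x l)) → Tendsto (fun l => X.poisson μ f (x l)) atTop (𝓝 (f ξ)))
    {x₀ : X.Vertex} (hx₀ : ¬ Bornology.IsBounded (univ : Set Z) ∨ 0 ≤ level x₀)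
    (hξ : ξ ∈ ball x₀) :
    edist (X.poisson μ f x₀) (f ξ) ≤
      hajlaszTail s (levelSup (X.weightedDeriv μ s f)) (level x₀) ξ := by
  have hex : ∀ l : ℕ, ∃ x : X.Vertex, level x = level x₀ + l ∧ ξ ∈ ball x ∧ (l = 0 → x = x₀) := by
    intro l
    rcases eq_or_ne l 0 with rfl | hl
    · exact ⟨x₀, by simp, hξ, fun _ => rfl⟩
    · obtain ⟨x, hx, hsub⟩ := X.exists_vertex (n := level x₀ + l)
        (hx₀.imp_right fun h0 => by omega) ξ
      exact ⟨x, hx, hsub (Metric.mem_ball_self (by positivity)), fun h0 => absurd h0 hl⟩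
  choose x hlev hmem h0 using hex
  have := edist_le_tsum_of_edist_le_of_tendsto₀ (f := fun l => X.poisson μ f (x l))
    (fun l : ℕ => 2 ^ (-(((level x₀ + l : ℤ) : ℝ) * s)) *
      levelSup (X.weightedDeriv μ s f) (level x₀ + l) ξ) (fun l => ?_) (hlim x _ hlev hmem)
  · rw [hajlaszTail_eq_tsum]
    rwa [h0 0 rfl] at this
  · have hadj : X.graph.Adj (x l) (x l.succ) := by
      have h1 := hlev l
      have h2 := hlev l.succ
      push_cast at h2
      refine ⟨fun he => ?_, ?_, ⟨ξ, hmem l, hmem l.succ⟩⟩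
      · rw [← he] at h2; omega
      · rw [h1, h2, abs_le]; constructor <;> omega
    rw [edist_comm, edist_eq_enorm_sub]
    refine (enorm_sub_le_absDeriv _ hadj).trans ?_
    have hle := le_levelSup (X.weightedDeriv μ s f) (hmem l)
    rw [hlev l] at hle
    refine le_trans (le_of_eq ?_) (mul_le_mul_right hle _)
    rw [weightedDeriv, hlev l, ENNReal.ofReal_two_rpow, ← mul_assoc, ← ENNReal.two_rpow_add]
    simp

variable [BorelSpace Z]

/-- Nontangential convergence of the Poisson extension at almost every point. -/
lemma ae_tendsto_poisson (h : IsDoubling μ Q C) (X : HyperbolicFilling Z) {f : Z → ℂ}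
    (hf : LocInt μ f) :
    ∀ᵐ ξ ∂μ, ∀ (x : ℕ → X.Vertex) (N : ℤ), (∀ l : ℕ, level (x l) = N + l) →
      (∀ l, ξ ∈ ball (x l)) → Tendsto (fun l => X.poisson μ f (x l)) atTop (𝓝 (f ξ)) := by
  have := h.isUnifLocDoublingMeasure
  have := h.isLocallyFiniteMeasure
  have := h.secondCountableTopology
  filter_upwards [IsUnifLocDoublingMeasure.ae_tendsto_average_norm_sub μ hf.locallyIntegrable 1]
    with ξ hξ x N hx hmem
  -- A possible root, whose ball is the whole space, occurs at most once along the sequence.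
  have hball : ∀ᶠ l : ℕ in atTop,
      ball (x l) = Metric.ball (center (x l)) ((2 : ℝ) ^ (-level (x l))) := by
    filter_upwards [eventually_gt_atTop (-N).toNat] with l hl
    unfold ball
    rw [if_neg]
    rintro ⟨-, h0⟩
    have := hx l
    omega
  have hlim : Tendsto (fun l : ℕ => (2 : ℝ) ^ (-level (x l))) atTop (𝓝[>] 0) := by
    refine tendsto_nhdsWithin_iff.2 ⟨?_, Eventually.of_forall fun l => by
      rw [mem_Ioi]; positivity⟩
    have h1 : ∀ l : ℕ, (2 : ℝ) ^ (-level (x l)) = 2 ^ (-N) * (1 / 2) ^ l := fun l => by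
      rw [hx l, neg_add, zpow_add₀ (by norm_num), zpow_neg _ (l : ℤ), zpow_natCast, one_div,
        inv_pow]
    simp_rw [h1]
    simpa using (tendsto_pow_atTop_nhds_zero_of_lt_one (by norm_num : (0 : ℝ) ≤ 1 / 2)
      (by norm_num)).const_mul ((2 : ℝ) ^ (-N))
  have havg := hξ (fun l => center (x l)) (fun l : ℕ => (2 : ℝ) ^ (-level (x l))) hlim (by
    filter_upwards [hball] with l hl
    have := hmem l
    rw [hl] at this
    rw [one_mul]
    exact Metric.ball_subset_closedBall this)
  rw [tendsto_iff_edist_tendsto_0]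
  have hup : Tendsto (fun l => ENNReal.ofReal (C * 2 ^ Q) * ENNReal.ofReal
      (⨍ y in Metric.closedBall (center (x l)) ((2 : ℝ) ^ (-level (x l))), ‖f y - f ξ‖ ∂μ))
      atTop (𝓝 0) := by
    have := ENNReal.Tendsto.const_mul (ENNReal.tendsto_ofReal havg)
      (Or.inr (ENNReal.ofReal_ne_top (r := C * 2 ^ Q)))
    simpa using this
  refine tendsto_of_tendsto_of_tendsto_of_le_of_le' tendsto_const_nhds hup
    (Eventually.of_forall fun _ => zero_le) ?_
  filter_upwards [hball] with l hl
  set z := center (x l)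
  set r := (2 : ℝ) ^ (-level (x l))
  have hr : 0 < r := by positivity
  have hsub : Metric.ball z r ⊆ Metric.closedBall z r := Metric.ball_subset_closedBall
  have hcb : μ (Metric.closedBall z r) ≤ ENNReal.ofReal (C * 2 ^ Q) * μ (Metric.ball z r) :=
    (measure_mono (Metric.closedBall_subset_ball (by linarith))).trans
      (h.measure_mul_le z r 2 hr (by norm_num))
  have hcb0 : μ (Metric.closedBall z r) ≠ 0 := fun h0 =>
    h.ne_zero z hr (measure_mono_null hsub h0)
  have hcbt : μ (Metric.closedBall z r) ≠ ∞ :=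
    ne_top_of_le_ne_top (ENNReal.mul_ne_top ENNReal.ofReal_ne_top (h.ne_top z r)) hcb
  have hint : IntegrableOn (fun y => ‖f y - f ξ‖) (Metric.closedBall z r) μ :=
    ((hf.2 _ Metric.isClosed_closedBall.measurableSet Metric.isBounded_closedBall).sub
      (integrableOn_const hcbt)).norm
  have hintb : IntegrableOn f (Metric.ball z r) μ :=
    hf.2 _ Metric.isOpen_ball.measurableSet Metric.isBounded_ball
  rw [edist_eq_enorm_sub, poisson, hl, ofReal_setAverage hint
    (Eventually.of_forall fun _ => norm_nonneg _)]
  refine (enorm_setAverage_sub_le (h.ne_zero z hr) (h.ne_top z r) hintb (f ξ)).trans ?_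
  simp_rw [ofReal_norm]
  rw [ENNReal.div_le_iff (h.ne_zero z hr) (h.ne_top z r)]
  set J := ∫⁻ y in Metric.closedBall z r, ‖f y - f ξ‖ₑ ∂μ with hJ
  calc ∫⁻ y in Metric.ball z r, ‖f y - f ξ‖ₑ ∂μ ≤ J := lintegral_mono_set hsub
    _ = J / μ (Metric.closedBall z r) * μ (Metric.closedBall z r) :=
        (ENNReal.div_mul_cancel hcb0 hcbt).symm
    _ ≤ J / μ (Metric.closedBall z r) *
          (ENNReal.ofReal (C * 2 ^ Q) * μ (Metric.ball z r)) := by gcongr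
    _ = _ := by ring

/-- The gradient built from the discrete derivative of the Poisson extension. -/
lemma isHajlaszGradient_expTail (h : IsDoubling μ Q C) (X : HyperbolicFilling Z) {s : ℝ}
    (hs : 0 < s) {f : Z → ℂ} (hf : LocInt μ f) :
    IsHajlaszGradient μ s f fun k ξ =>
      2 ^ (2 * s) * expTail s (fun n => levelSup (X.weightedDeriv μ s f) n ξ) (k - 1) := by
  set b := levelSup (X.weightedDeriv μ s f)
  refine ⟨fun k => ((measurable_expTail (fun n => measurable_levelSup _ n)
    _).const_mul _).aemeasurable, ?_⟩
  have hlim := ae_tendsto_poisson h X hf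
  refine ⟨toMeasurable μ {ξ | ¬ _}, measurableSet_toMeasurable _ _,
    (measure_toMeasurable _).trans (ae_iff.1 hlim), fun k ξ η hξ hη h1 h2 => ?_⟩
  have hξ' := not_not.1 fun hc => hξ (subset_toMeasurable μ _ hc)
  have hη' := not_not.1 fun hc => hη (subset_toMeasurable μ _ hc)
  obtain ⟨x, hkx, hx, hξx, hηx⟩ := X.exists_common_vertex k h2
  have hmono : ∀ ζ, hajlaszTail s b (level x) ζ ≤ hajlaszTail s b (k - 1) ζ := fun ζ =>
    antitone_hajlaszTail ζ hkx
  -- The tail starts at level $k-1$ and $d(\xi,\eta)\ge2^{-k-1}$; the two scales in between cost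
  -- $2^{2s}$.
  have hscale : (2 : ℝ≥0∞) ^ (-(((k - 1 : ℤ) : ℝ) * s)) ≤
      ENNReal.ofReal (dist ξ η ^ s) * 2 ^ (2 * s) := by
    have h3 : (2 : ℝ≥0∞) ^ (((-k - 1 : ℤ) : ℝ) * s) ≤ ENNReal.ofReal (dist ξ η ^ s) := by
      rw [← ENNReal.ofReal_two_rpow]
      refine ENNReal.ofReal_le_ofReal ?_
      rw [Real.rpow_mul (by norm_num), Real.rpow_intCast]
      exact Real.rpow_le_rpow (by positivity) h1 hs.le
    refine le_trans (le_of_eq ?_) (mul_le_mul_left h3 _)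
    rw [← ENNReal.two_rpow_add]
    push_cast
    congr 1; ring
  calc ‖f ξ - f η‖ₑ = edist (f ξ) (f η) := (edist_eq_enorm_sub _ _).symm
    _ ≤ edist (X.poisson μ f x) (f ξ) + edist (X.poisson μ f x) (f η) :=
        edist_triangle_left _ _ _
    _ ≤ hajlaszTail s b (k - 1) ξ + hajlaszTail s b (k - 1) η :=
        add_le_add ((edist_poisson_le_hajlaszTail X s f hξ' hx hξx).trans (hmono ξ))
          ((edist_poisson_le_hajlaszTail X s f hη' hx hηx).trans (hmono η))
    _ = 2 ^ (-(((k - 1 : ℤ) : ℝ) * s)) *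
          (expTail s (fun n => b n ξ) (k - 1) + expTail s (fun n => b n η) (k - 1)) := by
        rw [hajlaszTail, hajlaszTail]; ring
    _ ≤ ENNReal.ofReal (dist ξ η ^ s) * 2 ^ (2 * s) *
          (expTail s (fun n => b n ξ) (k - 1) + expTail s (fun n => b n η) (k - 1)) := by gcongr
    _ = _ := by ring

lemma exists_hajlaszNorm_le (h : IsDoubling μ Q C) {s p : ℝ} (hs : 0 < s) (hp : 0 < p)
    {q : ℝ≥0∞} (hq0 : q ≠ 0) :
    ∃ K : ℝ≥0, ∀ (X : HyperbolicFilling Z) (f : Z → ℂ), LocInt μ f →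
      hajlaszNorm μ s p q f ≤ K * X.tlNorm μ s p q f := by
  obtain ⟨K, hK⟩ := exists_lqNorm_expTail_le hs hq0
  have hc : (2 : ℝ≥0∞) ^ (2 * s) * K ≠ ∞ :=
    ENNReal.mul_ne_top (ENNReal.two_rpow_ne_top _) ENNReal.coe_ne_top
  refine ⟨(2 ^ (2 * s) * K : ℝ≥0∞).toNNReal, fun X f hf => ?_⟩
  rw [ENNReal.coe_toNNReal hc]
  set b := levelSup (X.weightedDeriv μ s f)
  refine (iInf₂_le _ (isHajlaszGradient_expTail h X hs hf)).trans ?_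
  have hpt : ∀ ξ, lqNorm q (fun k : ℤ =>
      2 ^ (2 * s) * expTail s (fun n => b n ξ) (k - 1)) ^ p ≤
      (2 ^ (2 * s) * K) ^ p *
        lqNorm q (fun x : X.cone ξ => X.weightedDeriv μ s f x) ^ p := fun ξ => by
    rw [← ENNReal.mul_rpow_of_nonneg _ _ hp.le, lqNorm_const_mul hq0, mul_assoc]
    refine ENNReal.rpow_le_rpow (mul_le_mul_right ?_ _) hp.le
    refine (lqNorm_comp_equiv (Equiv.subRight (1 : ℤ)) (expTail s fun n => b n ξ)).le.trans ?_
    exact (hK _).trans (mul_le_mul_right (lqNorm_levelSup_le hq0 _ ξ) _)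
  calc _ ≤ (∫⁻ ξ, (2 ^ (2 * s) * K) ^ p *
        lqNorm q (fun x : X.cone ξ => X.weightedDeriv μ s f x) ^ p ∂μ) ^ (1 / p) :=
        ENNReal.rpow_le_rpow (lintegral_mono hpt) (by positivity)
    _ = _ := by
        -- Finiteness of the constant is used here, so that measurability of the norm over the cone
        -- is not needed.
        rw [lintegral_const_mul' _ _ (ENNReal.rpow_ne_top_of_nonneg hp.le hc),
          ENNReal.mul_rpow_of_nonneg _ _ (by positivity), ← ENNReal.rpow_mul,
          mul_one_div_cancel hp.ne', ENNReal.rpow_one]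
        rfl

end HyperbolicFilling

/-! ### Infimum over gradients, choice of the exponent, and conclusion. -/

namespace IsDoubling

variable {Z : Type*} [MetricSpace Z] [MeasurableSpace Z] [BorelSpace Z] {μ : Measure Z} {Q C : ℝ}

lemma locInt_of_mem_hajlaszSpace (h : IsDoubling μ Q C) {s t p : ℝ} (hs : 0 < s) (ht : 0 < t)
    (ht1 : t < 1) (hts : Q * (1 / t - 1) < s) (htp : t < p) {q : ℝ≥0∞} (hq0 : q ≠ 0)
    {f : Z → ℂ} (hf : f ∈ hajlaszSpace μ s p q) : LocInt μ f := by
  obtain ⟨hfm, hlt⟩ := hf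
  simp only [hajlaszNorm, iInf_lt_iff] at hlt
  obtain ⟨g, hg, hfin⟩ := hlt
  obtain ⟨g', hg'm, hg', hae⟩ := hg.exists_measurable
  refine h.locInt_of_isHajlaszGradient hs ht ht1 hts htp hq0 hfm hg'm hg' ?_
  have hp : 0 < p := ht.trans htp
  have : ∫⁻ ξ, lqNorm q (fun k => g' k ξ) ^ p ∂μ = ∫⁻ ξ, lqNorm q (fun k => g k ξ) ^ p ∂μ :=
    lintegral_congr_ae (by filter_upwards [hae] with ξ hξ; simp_rw [hξ])
  rw [this]
  intro htop
  rw [htop, ENNReal.top_rpow_of_pos (by positivity)] at hfin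
  exact lt_irrefl _ hfin

lemma exists_tlNorm_le_hajlaszNorm (h : IsDoubling μ Q C) {s t p : ℝ} (hs : 0 < s) (ht : 0 < t)
    (ht1 : t < 1) (hts : Q * (1 / t - 1) < s) (htp : t < p) {q : ℝ≥0∞}
    (htq : ENNReal.ofReal t < q) :
    ∃ K : ℝ≥0, ∀ (X : HyperbolicFilling Z) (f : Z → ℂ), LocInt μ f →
      X.tlNorm μ s p q f ≤ K * hajlaszNorm μ s p q f := by
  obtain ⟨K, hK⟩ := h.exists_tlNorm_le hs ht ht1 hts htp htq
  have hp : 0 < p := ht.trans htp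
  -- A nonzero constant can be divided out to reach the infimum, and it makes gradients of infinite
  -- norm harmless.
  refine ⟨K + 1, fun X f hf => ?_⟩
  have hK0 : ((K + 1 : ℝ≥0) : ℝ≥0∞) ≠ 0 := by simp
  rw [mul_comm, ← ENNReal.div_le_iff hK0 ENNReal.coe_ne_top]
  refine le_iInf₂ fun g hg => ?_
  rw [ENNReal.div_le_iff hK0 ENNReal.coe_ne_top, mul_comm]
  obtain ⟨g', hg'm, hg', hae⟩ := hg.exists_measurable
  have : ∫⁻ ξ, lqNorm q (fun k => g k ξ) ^ p ∂μ = ∫⁻ ξ, lqNorm q (fun k => g' k ξ) ^ p ∂μ :=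
    lintegral_congr_ae (by filter_upwards [hae] with ξ hξ; simp_rw [hξ])
  rw [this]
  by_cases hfin : ∫⁻ ξ, lqNorm q (fun k => g' k ξ) ^ p ∂μ = ∞
  · rw [hfin, ENNReal.top_rpow_of_pos (by positivity), ENNReal.mul_top hK0]
    exact le_top
  · refine (hK X f g' hf hg'm hg' hfin).trans (mul_le_mul_left ?_ _)
    exact_mod_cast le_self_add

end IsDoubling

/-- The inequality $Q(1/t-1)<s$ means $t>Q/(Q+s)$, so any $t$ between $Q/(Q+s)$ and $\min(1,p,q)$
will do. -/
lemma exists_exponent {Q s p : ℝ} (hQ : 0 < Q) (hs : 0 < s) (hp : Q / (Q + s) < p) {q : ℝ≥0∞}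
    (hq : ENNReal.ofReal (Q / (Q + s)) < q) :
    ∃ t : ℝ, 0 < t ∧ t < 1 ∧ Q * (1 / t - 1) < s ∧ t < p ∧ ENNReal.ofReal t < q := by
  have h1 : Q / (Q + s) < 1 := (div_lt_one (by positivity)).2 (by linarith)
  obtain ⟨q', -, hq', hqq⟩ := ENNReal.lt_iff_exists_real_btwn.1 hq
  have hqr : Q / (Q + s) < q' := (ENNReal.ofReal_lt_ofReal_iff_of_nonneg (by positivity)).1 hq'
  obtain ⟨t, ht, ht'⟩ := exists_between (lt_min h1 (lt_min hp hqr))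
  rw [lt_min_iff, lt_min_iff] at ht'
  have ht0 : 0 < t := lt_trans (by positivity) ht
  refine ⟨t, ht0, ht'.1, ?_, ht'.2.1,
    lt_of_le_of_lt (ENNReal.ofReal_le_ofReal ht'.2.2.le) hqq⟩
  rw [div_lt_iff₀ (by positivity)] at ht
  have h2 : Q * (1 / t - 1) = (Q - Q * t) / t := by field_simp
  rw [h2, div_lt_iff₀ ht0]
  linarith

theorem proposition3p1 {Z : Type*} [MetricSpace Z] [MeasurableSpace Z] [BorelSpace Z]
    (μ : Measure Z)
    (hμ : ∀ (ξ : Z) (r : ℝ), 0 < r → 0 < μ (Metric.ball ξ r) ∧ μ (Metric.ball ξ r) < ∞)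
    (Q C : ℝ) (hQ : 0 < Q) (hC : 1 ≤ C)
    (hdoubling : ∀ (ξ : Z) (r l : ℝ), 0 < r → 1 ≤ l →
      μ (Metric.ball ξ (l * r)) ≤ ENNReal.ofReal (C * l ^ Q) * μ (Metric.ball ξ r))
    (s : ℝ) (hs0 : 0 < s) (hs1 : s ≤ 1)
    (p : ℝ) (hp : Q / (Q + s) < p)
    (q : ℝ≥0∞) (hq : ENNReal.ofReal (Q / (Q + s)) < q) :
    ∃ K : ℝ≥0, ∀ X : HyperbolicFilling Z,
      X.tlSpace μ s p q = hajlaszSpace μ s p q ∧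
        ∀ f ∈ hajlaszSpace μ s p q,
          X.tlNorm μ s p q f ≤ K * hajlaszNorm μ s p q f ∧
            hajlaszNorm μ s p q f ≤ K * X.tlNorm μ s p q f := by
  have h : IsDoubling μ Q C :=
    { pos := fun ξ r hr => (hμ ξ r hr).1
      lt_top := fun ξ r => by
        rcases le_or_gt r 0 with hr | hr
        · rw [Metric.ball_eq_empty.2 hr, measure_empty]; exact ENNReal.zero_lt_top
        · exact (hμ ξ r hr).2
      dim_pos := hQ
      one_le := hC
      measure_mul_le := hdoubling }
  obtain ⟨t, ht, ht1, hts, htp, htq⟩ := exists_exponent hQ hs0 hp hq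
  have hq0 : q ≠ 0 := (zero_le.trans_lt htq).ne'
  obtain ⟨K₁, hK₁⟩ := h.exists_tlNorm_le_hajlaszNorm hs0 ht ht1 hts htp htq
  obtain ⟨K₂, hK₂⟩ := HyperbolicFilling.exists_hajlaszNorm_le h hs0 (ht.trans htp) hq0
  have hmul : ∀ (K : ℝ≥0) (a : ℝ≥0∞), a < ∞ → K * a < ∞ := fun K a ha =>
    ENNReal.mul_lt_top ENNReal.coe_lt_top ha
  have hloc : ∀ f ∈ hajlaszSpace μ s p q, LocInt μ f := fun f hf =>
    h.locInt_of_mem_hajlaszSpace hs0 ht ht1 hts htp hq0 hf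
  refine ⟨max K₁ K₂, fun X => ⟨Set.ext fun f => ⟨fun hf => ?_, fun hf => ?_⟩, fun f hf => ⟨?_, ?_⟩⟩⟩
  · exact ⟨hf.1.1, (hK₂ X f hf.1).trans_lt (hmul _ _ hf.2)⟩
  · exact ⟨hloc f hf, (hK₁ X f (hloc f hf)).trans_lt (hmul _ _ hf.2)⟩
  · refine (hK₁ X f (hloc f hf)).trans (mul_le_mul_left ?_ _)
    exact_mod_cast le_max_left K₁ K₂
  · refine (hK₂ X f (hloc f hf)).trans (mul_le_mul_left ?_ _)
    exact_mod_cast le_max_right K₁ K₂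

end
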